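/- **Setting.** $\lambda\in\mathbb N$ is the security parameter. A *QPT state generator* with key length $\kappa(\lambda)$, input length $m(\lambda)$ and output length $n(\lambda)$ is a uniform polynomial-time family of quantum circuits which, on a key $k\in\{0,1\}^{\kappa(\lambda)}$ and a string $x\in\{0,1\}^{m(\lambda)}$, outputs an $n(\lambda)$-qubit state $G(k,x)$; here uniform means that a fixed classical algorithm, given $1^\lambda$ and the length $m(\lambda)$ of the input string, prints the $\lambda$-th circuit (over the gates $H$, $T$, CNOT, Toffoli) together with its numbers of output and remaining wires in time polynomial in $\lambda$. It is required that $G(k,x)$ is a pure state for all $\lambda,k,x$. Adversaries are non-uniform quantum polynomial-time, i.e. sequences $A=\{A_\lambda\}$ of quantum circuits of polynomial size. $\mathcal H_n$ denotes the Haar measure on $n$-qubit pure states. * A *$(\lambda,n,\ell)$-PRS generator* (in the plain model) is a QPT state generator with key length $\lambda$, no input string and output length $n(\lambda)$ such that for every non-uniform QPT adversary $A$ $$\Big|\Pr_{k\leftarrow\{0,1\}^\lambda}\big[A_\lambda(G(k)^{\otimes\ell(\lambda)})=1\big]-\Pr_{|\varphi\rangle\leftarrow\mathcal H_{n(\lambda)}}\big[A_\lambda(|\varphi\rangle\langle\varphi|^{\otimes\ell(\lambda)})=1\big]\Big|$$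 is negligible in $\lambda$. * A *selectively secure $(2\lambda,m,n,\ell)$-PRFS generator* (in the plain model) is a QPT state generator with key length $2\lambda$, input length $m(\lambda)$ and output length $n(\lambda)$ such that for every non-uniform QPT adversary $A$ and every choice, for each $\lambda$, of a tuple of (possibly repeated) strings $x_1,\dots,x_{\ell(\lambda)}\in\{0,1\}^{m(\lambda)}$, $$\Big|\Pr_{k\leftarrow\{0,1\}^{2\lambda}}\Big[A_\lambda\Big(x_1,\dots,x_{\ell(\lambda)},\bigotimes_{i=1}^{\ell(\lambda)}G(k,x_i)\Big)=1\Big]-\Pr_{\forall x\in\{0,1\}^{m(\lambda)}:\ |\varphi_x\rangle\leftarrow\mathcal H_{n(\lambda)}}\Big[A_\lambda\Big(x_1,\dots,x_{\ell(\lambda)},\bigotimes_{i=1}^{\ell(\lambda)}|\varphi_{x_i}\rangle\langle\varphi_{x_i}|\Big)=1\Big]\Big|$$ is negligible in $\lambda$, where the states $|\varphi_x\rangle$ are independent. **Statement.** Let $c\in[0,1)$ and $\varepsilon>0$ be constants and let $m,n,\ell:\mathbb N\to\mathbb N$ be such that $m(\lambda)$ is $\lambda^c$ rounded (up or down) to an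 integer, $n(\lambda)>\lambda$ for all $\lambda$, and $\ell(\lambda)=O\big(\lambda^{1-c}/\log(\lambda)^{1+\varepsilon}\big)$. If a $(\lambda,n,\ell)$-PRS generator exists, then a selectively secure $(2\lambda,m,n,\ell)$-PRFS generator exists. -/

import Mathlib

open Filter MeasureTheory

noncomputable section

namespace PRFS

/-! ### Quantum circuits -/

/-- Gates over the universal gate set `{H, T, CNOT, Toffoli}`, on wires labelled by `W`.
In `cnot c t` and `toffoli c d t` the last argument is the target. -/
inductive Gate (W : Type) : Type
  | had (i : W)
  | tee (i : W)
  | cnot (c t : W)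
  | toffoli (c d t : W)

/-- Relabelling of wires. -/
def Gate.map {W V : Type} (f : W → V) : Gate W → Gate V
  | .had i => .had (f i)
  | .tee i => .tee (f i)
  | .cnot c t => .cnot (f c) (f t)
  | .toffoli c d t => .toffoli (f c) (f d) (f t)

/-- The operator of a gate in the computational basis `W → Bool`. A controlled gate whose target
coincides with one of its controls is read as the identity. -/
def Gate.mat {W : Type} [Fintype W] [DecidableEq W] :
    Gate W → Matrix (W → Bool) (W → Bool) ℂ
  | .had i => fun a b =>
      if ∀ j, j ≠ i → a j = b j then
        (if a i = true ∧ b i = true then -1 else 1) / (Real.sqrt 2 : ℂ)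
      else 0
  | .tee i => Matrix.diagonal fun b =>
      if b i = true then Complex.exp (Complex.I * Real.pi / 4) else 1
  | .cnot c t => fun a b =>
      if a = (if b c = true ∧ c ≠ t then Function.update b t (!(b t)) else b) then 1 else 0
  | .toffoli c d t => fun a b =>
      if a = (if b c = true ∧ b d = true ∧ c ≠ t ∧ d ≠ t
              then Function.update b t (!(b t)) else b) then 1 else 0

/-- The operator of a circuit; the head of the list is applied first. -/
def circuitMat {W : Type} [Fintype W] [DecidableEq W] :
    List (Gate W) → Matrix (W → Bool) (W → Bool) ℂ
  | [] => 1
  | g :: gs => circuitMat gs * g.mat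

/-! ### Polynomial-time uniformity: successor random access machines printing circuits -/

/-- Configuration of the classical machine that prints a circuit: variables, an array with indirect
addressing, and the list of gates printed so far. -/
structure Config : Type where
  var : ℕ → ℕ
  arr : ℕ → ℕ
  out : List (Gate ℕ)

/-- The elementary operations. New numbers arise only by adding one, so that charging one time unit
per operation is polynomially equivalent to Turing machine time. -/
inductive Op : Type
  /-- `x := 0` -/
  | zero (x : ℕ)
  /-- `x := x + 1` -/
  | inc (x : ℕ)
  /-- `x := x - 1` (and `0` stays `0`) -/
  | dec (x : ℕ)
  /-- `x := y` -/
  | copy (x y : ℕ)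
  /-- `x := arr[y]` -/
  | load (x y : ℕ)
  /-- `arr[x] := y` -/
  | store (x y : ℕ)
  /-- print a gate whose wires are the current values of the named variables -/
  | emit (g : Gate ℕ)

def Op.exec : Op → Config → Config
  | .zero x, s => { s with var := Function.update s.var x 0 }
  | .inc x, s => { s with var := Function.update s.var x (s.var x + 1) }
  | .dec x, s => { s with var := Function.update s.var x (s.var x - 1) }
  | .copy x y, s => { s with var := Function.update s.var x (s.var y) }
  | .load x y, s => { s with var := Function.update s.var x (s.arr (s.var y)) }
  | .store x y, s => { s with arr := Function.update s.arr (s.var x) (s.var y) }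
  | .emit g, s => { s with out := s.out ++ [g.map s.var] }

/-- Programs. A program is a finite text and hence names only finitely many variables. -/
inductive Prog : Type
  | op (o : Op)
  | seq (P Q : Prog)
  /-- if `x ≠ 0` then `P` else `Q` -/
  | ite (x : ℕ) (P Q : Prog)
  /-- while `x ≠ 0` do `P` -/
  | loop (x : ℕ) (P : Prog)

/-- `Run P s s' T`: started in `s`, the program `P` halts in `s'` after exactly `T` steps. -/
inductive Run : Prog → Config → Config → ℕ → Prop
  | op (o : Op) (s : Config) : Run (.op o) s (o.exec s) 1
  | seq {P Q : Prog} {s s' s'' : Config} {T T' : ℕ} :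
      Run P s s' T → Run Q s' s'' T' → Run (.seq P Q) s s'' (T + T')
  | ite_true {x : ℕ} {P Q : Prog} {s s' : Config} {T : ℕ} :
      s.var x ≠ 0 → Run P s s' T → Run (.ite x P Q) s s' (T + 1)
  | ite_false {x : ℕ} {P Q : Prog} {s s' : Config} {T : ℕ} :
      s.var x = 0 → Run Q s s' T → Run (.ite x P Q) s s' (T + 1)
  | loop_stop {x : ℕ} {P : Prog} {s : Config} : s.var x = 0 → Run (.loop x P) s s 1
  | loop_step {x : ℕ} {P : Prog} {s s' s'' : Config} {T T' : ℕ} :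
      s.var x ≠ 0 → Run P s s' T → Run (.loop x P) s' s'' T' →
        Run (.loop x P) s s'' (T + T' + 1)

/-- Start: variable `0` holds the security parameter, variable `1` the length of the input string;
everything else is zero and nothing has been printed. -/
def Config.init (lam m : ℕ) : Config where
  var := fun i => if i = 0 then lam else if i = 1 then m else 0
  arr := fun _ => 0
  out := []

/-! ### Quantum algorithms that generate states -/

/-- A family of quantum circuits which, for security parameter `lam`, takes a key of `κ lam` bits
and an input string of `m lam` bits and outputs `n lam` qubits. The circuit has
`n lam + junk lam` wires; the classical data are loaded on the first `κ lam + m lam` wires, all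
other wires start in `|0⟩`, the first `n lam` wires are the output and the others are traced out.
-/
structure StateGen (κ m n : ℕ → ℕ) : Type where
  junk : ℕ → ℕ
  gates : (lam : ℕ) → List (Gate (Fin (n lam + junk lam)))
  fits : ∀ lam, κ lam + m lam ≤ n lam + junk lam

namespace StateGen

variable {κ m n : ℕ → ℕ}

/-- The computational basis state on which the circuit is started. -/
def start (G : StateGen κ m n) (lam : ℕ) (k : Fin (κ lam) → Bool) (x : Fin (m lam) → Bool) :
    Fin (n lam + G.junk lam) → Bool :=
  fun i => if h : (i : ℕ) < κ lam + m lam then Fin.append k x ⟨i, h⟩ else false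

/-- The joint state vector of all wires at the end. -/
def final (G : StateGen κ m n) (lam : ℕ) (k : Fin (κ lam) → Bool) (x : Fin (m lam) → Bool) :
    (Fin (n lam + G.junk lam) → Bool) → ℂ :=
  fun b => circuitMat (G.gates lam) b (G.start lam k x)

/-- The output `G(k, x)`: the reduced density matrix of the first `n lam` wires. -/
def output (G : StateGen κ m n) (lam : ℕ) (k : Fin (κ lam) → Bool) (x : Fin (m lam) → Bool) :
    Matrix (Fin (n lam) → Bool) (Fin (n lam) → Bool) ℂ :=
  fun u v => ∑ g : Fin (G.junk lam) → Bool,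
    G.final lam k x (Fin.append u g) * star (G.final lam k x (Fin.append v g))

/-- `G` is a (uniform) quantum polynomial-time algorithm: one classical program, given the security
parameter and the length of the input string, prints the circuit together with its number of output
wires (left in variable `0`) and of remaining wires (left in variable `1`), in time polynomial in
the security parameter. -/
def IsQPT (G : StateGen κ m n) : Prop :=
  ∃ (P : Prog) (p : Polynomial ℕ), ∀ lam : ℕ, ∃ (s : Config) (T : ℕ),
    Run P (Config.init lam (m lam)) s T ∧ T ≤ p.eval lam ∧
      s.out = (G.gates lam).map (Gate.map Fin.val) ∧
      s.var 0 = n lam ∧ s.var 1 = G.junk lam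

end StateGen

/-! ### Pure states and the Haar measure -/

/-- Unit vectors of `(ℂ²)^{⊗ n}`. -/
abbrev PureState (n : ℕ) : Type :=
  Metric.sphere (0 : EuclideanSpace ℂ (Fin n → Bool)) 1

/-- The density matrix `|φ⟩⟨φ|`. -/
def PureState.density {n : ℕ} (φ : PureState n) :
    Matrix (Fin n → Bool) (Fin n → Bool) ℂ :=
  fun u v => φ.1 u * star (φ.1 v)

/-- The Haar measure on `n`-qubit pure states: the normalized surface measure of the sphere. -/
def haarState (n : ℕ) : Measure (PureState n) :=
  ((volume : Measure (EuclideanSpace ℂ (Fin n → Bool))).toSphere Set.univ)⁻¹ •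
    (volume : Measure (EuclideanSpace ℂ (Fin n → Bool))).toSphere

instance haarState.instIsProbabilityMeasure (n : ℕ) : IsProbabilityMeasure (haarState n) where
  measure_univ := by
    have h : (volume : Measure (EuclideanSpace ℂ (Fin n → Bool))).toSphere ≠ 0 :=
      Measure.toSphere_ne_zero _
    simp only [haarState, Measure.smul_apply, smul_eq_mul]
    exact ENNReal.inv_mul_cancel (by rwa [ne_eq, Measure.measure_univ_eq_zero]) (measure_ne_top _ _)

/-- `ρ₁ ⊗ ⋯ ⊗ ρ_ℓ` for `n`-qubit density matrices; qubit `j` of factor `i` is labelled `(i, j)`. -/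
def tensor {ℓ n : ℕ} (ρ : Fin ℓ → Matrix (Fin n → Bool) (Fin n → Bool) ℂ) :
    Matrix (Fin ℓ × Fin n → Bool) (Fin ℓ × Fin n → Bool) ℂ :=
  fun u v => ∏ i, ρ i (fun j => u (i, j)) (fun j => v (i, j))

/-- `|x₁, …, x_ℓ⟩⟨x₁, …, x_ℓ| ⊗ ρ` for classical strings `x₁, …, x_ℓ` of `m` bits. -/
def withStrings {ℓ m : ℕ} {Q : Type} (x : Fin ℓ → Fin m → Bool)
    (ρ : Matrix (Q → Bool) (Q → Bool) ℂ) :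
    Matrix ((Fin ℓ × Fin m) ⊕ Q → Bool) ((Fin ℓ × Fin m) ⊕ Q → Bool) ℂ :=
  fun u v =>
    if (∀ i j, u (.inl (i, j)) = x i j) ∧ (∀ i j, v (.inl (i, j)) = x i j) then
      ρ (fun q => u (.inr q)) (fun q => v (.inr q))
    else 0

/-! ### Distinguishers -/

/-- A quantum circuit that is run on the qubits `Q` and on `anc` ancillas in `|0⟩`, and whose
output bit is obtained by measuring the wire `out`. -/
structure Distinguisher (Q : Type) : Type where
  anc : ℕ
  gates : List (Gate (Q ⊕ Fin anc))
  out : Q ⊕ Fin anc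

/-- Number of gates and ancillas. -/
def Distinguisher.size {Q : Type} (A : Distinguisher Q) : ℕ := A.gates.length + A.anc

/-- `ρ ⊗ |0⟩⟨0|` -/
def padZero {Q : Type} (a : ℕ) (ρ : Matrix (Q → Bool) (Q → Bool) ℂ) :
    Matrix (Q ⊕ Fin a → Bool) (Q ⊕ Fin a → Bool) ℂ :=
  fun u v =>
    if (∀ i, u (.inr i) = false) ∧ (∀ i, v (.inr i) = false) then
      ρ (fun q => u (.inl q)) (fun q => v (.inl q))
    else 0

/-- `Pr[A(ρ) = 1]` -/
def Distinguisher.accept {Q : Type} [Fintype Q] [DecidableEq Q] (A : Distinguisher Q)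
    (ρ : Matrix (Q → Bool) (Q → Bool) ℂ) : ℝ :=
  ∑ b : Q ⊕ Fin A.anc → Bool,
    if b A.out = true then
      ((circuitMat A.gates * padZero A.anc ρ * (circuitMat A.gates).conjTranspose) b b).re
    else 0

/-- Non-uniform quantum polynomial-time adversaries: circuits of polynomial size. -/
def PolySize {Q : ℕ → Type} (A : (lam : ℕ) → Distinguisher (Q lam)) : Prop :=
  ∃ p : Polynomial ℕ, ∀ lam, (A lam).size ≤ p.eval lam

/-- Negligible functions of the security parameter. -/
def Negligible (f : ℕ → ℝ) : Prop :=
  Asymptotics.SuperpolynomialDecay atTop (fun lam : ℕ => (lam : ℝ)) f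

/-! ### The two primitives, in the plain model -/

/-- For every key and every input the output is a pure state. -/
def StateGen.IsPure {κ m n : ℕ → ℕ} (G : StateGen κ m n) : Prop :=
  ∀ lam k x, ∃ φ : PureState (n lam), G.output lam k x = φ.density

/-- `G` is a `(λ, n, ℓ)`-PRS generator: keys have `λ` bits, there is no further input (an input
string of length `0`), and `ℓ` copies of the output for a uniform key are computationally
indistinguishable from `ℓ` copies of a Haar state. -/
def IsPRS (n ℓ : ℕ → ℕ) (G : StateGen (fun lam => lam) (fun _ => 0) n) : Prop :=
  G.IsQPT ∧ G.IsPure ∧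
    ∀ A : (lam : ℕ) → Distinguisher (Fin (ℓ lam) × Fin (n lam)), PolySize A →
      Negligible fun lam =>
        |(∑ k : Fin lam → Bool,
            (A lam).accept (tensor fun _ => G.output lam k Fin.elim0)) / 2 ^ lam
          - ∫ φ, (A lam).accept (tensor fun _ => φ.density) ∂(haarState (n lam))|

/-- `G` is a selectively secure `(κ, m, n, ℓ)`-PRFS generator: for all `ℓ`-tuples of (possibly
repeated) `m`-bit inputs fixed in advance, the outputs for a uniform `κ`-bit key are
computationally indistinguishable from independent Haar states, one for each input string. -/
def IsSelectivePRFS (κ m n ℓ : ℕ → ℕ) (G : StateGen κ m n) : Prop :=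
  G.IsQPT ∧ G.IsPure ∧
    ∀ (A : (lam : ℕ) →
          Distinguisher ((Fin (ℓ lam) × Fin (m lam)) ⊕ (Fin (ℓ lam) × Fin (n lam))))
      (x : (lam : ℕ) → Fin (ℓ lam) → Fin (m lam) → Bool), PolySize A →
      Negligible fun lam =>
        |(∑ k : Fin (κ lam) → Bool,
            (A lam).accept (withStrings (x lam)
              (tensor fun i => G.output lam k (x lam i)))) / 2 ^ κ lam
          - ∫ φ : (Fin (m lam) → Bool) → PureState (n lam),
              (A lam).accept (withStrings (x lam)
                (tensor fun i => (φ (x lam i)).density))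
              ∂(Measure.pi fun _ => haarState (n lam))|

end PRFS

end

noncomputable section

namespace PRFS

/-! ### Programs: Hoare-style rules with time bounds -/

/-- Started in `s`, the program `P` halts within `B` steps in a configuration satisfying `Q`. -/
def Halts (P : Prog) (s : Config) (B : ℕ) (Q : Config → Prop) : Prop :=
  ∃ s' T, Run P s s' T ∧ T ≤ B ∧ Q s'

theorem Halts.mono {P : Prog} {s : Config} {B B' : ℕ} {Q Q' : Config → Prop}
    (h : Halts P s B Q) (hB : B ≤ B') (hQ : ∀ s', Q s' → Q' s') : Halts P s B' Q' := by
  obtain ⟨s', T, hr, hT, hq⟩ := h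
  exact ⟨s', T, hr, hT.trans hB, hQ _ hq⟩

theorem Halts.op {o : Op} {s : Config} {Q : Config → Prop} (h : Q (o.exec s)) :
    Halts (.op o) s 1 Q := ⟨_, _, .op o s, le_rfl, h⟩

theorem Halts.seq {P P' : Prog} {s : Config} {B B' : ℕ} {Q Q' : Config → Prop}
    (h : Halts P s B Q) (h' : ∀ s', Q s' → Halts P' s' B' Q') :
    Halts (.seq P P') s (B + B') Q' := by
  obtain ⟨s', T, hr, hT, hq⟩ := h
  obtain ⟨s'', T', hr', hT', hq'⟩ := h' s' hq
  exact ⟨s'', T + T', .seq hr hr', by omega, hq'⟩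

theorem Halts.ite {x : ℕ} {P P' : Prog} {s : Config} {B : ℕ} {Q : Config → Prop}
    (h : s.var x ≠ 0 → Halts P s B Q) (h' : s.var x = 0 → Halts P' s B Q) :
    Halts (.ite x P P') s (B + 1) Q := by
  by_cases hx : s.var x = 0
  · obtain ⟨s', T, hr, hT, hq⟩ := h' hx
    exact ⟨s', T + 1, .ite_false hx hr, by omega, hq⟩
  · obtain ⟨s', T, hr, hT, hq⟩ := h hx
    exact ⟨s', T + 1, .ite_true hx hr, by omega, hq⟩

/-- Counting loops: `x` is decremented in every round and `I k` holds after `k` rounds. -/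
theorem Halts.loop {x : ℕ} {P : Prog} {B N : ℕ} {I : ℕ → Config → Prop}
    (hstep : ∀ k s, k < N → I k s → s.var x = N - k →
      Halts P s B fun s' => I (k + 1) s' ∧ s'.var x = N - (k + 1))
    {s : Config} (h0 : I 0 s) (hx : s.var x = N) :
    Halts (.loop x P) s (N * (B + 1) + 1) (I N) := by
  suffices H : ∀ r k s, k + r = N → I k s → s.var x = N - k →
      Halts (.loop x P) s (r * (B + 1) + 1) (I N) from
    H N 0 s (by omega) h0 (by omega)
  intro r
  induction r with
  | zero =>
    intro k s hk hI hs
    obtain rfl : k = N := by omega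
    exact ⟨s, 1, Run.loop_stop (by omega), by omega, hI⟩
  | succ r ih =>
    intro k s hk hI hs
    obtain ⟨s', T, hr, hT, hI', hs'⟩ := hstep k s (by omega) hI hs
    obtain ⟨s'', T', hr', hT', hq⟩ := ih (k + 1) s' (by omega) hI' hs'
    refine ⟨s'', T + T' + 1, .loop_step (by omega) hr hr', ?_, hq⟩
    rw [Nat.succ_mul]
    omega

/-- `dst := dst + src`, with `cnt` as a scratch counter. -/
def addVar (cnt dst src : ℕ) : Prog :=
  .seq (.op (.copy cnt src)) (.loop cnt (.seq (.op (.dec cnt)) (.op (.inc dst))))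

theorem addVar_halts {cnt dst src : ℕ} (h : dst ≠ cnt) (s : Config) :
    Halts (addVar cnt dst src) s (3 * s.var src + 2) fun s' =>
      s'.var dst = s.var dst + s.var src ∧
      (∀ i, i ≠ dst → i ≠ cnt → s'.var i = s.var i) ∧ s'.arr = s.arr ∧ s'.out = s.out := by
  refine Halts.mono (Halts.seq (Q := fun s' => s'.var cnt = s.var src ∧
      (∀ i, i ≠ cnt → s'.var i = s.var i) ∧ s'.arr = s.arr ∧ s'.out = s.out) (Halts.op ?_)
    fun s1 h1 => Halts.loop (N := s.var src) (B := 2)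
      (I := fun k s' => s'.var dst = s.var dst + k ∧
        (∀ i, i ≠ dst → i ≠ cnt → s'.var i = s.var i) ∧ s'.arr = s.arr ∧ s'.out = s.out)
      (fun k s2 hk h2 hs2 => ?_) ?_ h1.1) (by omega) (fun s' h => h)
  · simp only [Op.exec, Function.update_self, and_self, and_true, true_and]
    intro i hi
    simp [Function.update_of_ne hi]
  · obtain ⟨ha, hb, hc, hd⟩ := h2
    refine Halts.seq (B := 1) (B' := 1) (Q := fun s' => s' = Op.exec (.dec cnt) s2)
      (Halts.op rfl) ?_
    rintro _ rfl
    refine Halts.op ?_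
    simp only [Op.exec, Function.update_of_ne h, Function.update_of_ne h.symm,
      Function.update_self]
    refine ⟨⟨by omega, fun i hi hi' => ?_, hc, hd⟩, by omega⟩
    rw [Function.update_of_ne hi, Function.update_of_ne hi', hb i hi hi']
  · obtain ⟨ha, hb, hc, hd⟩ := h1
    exact ⟨by rw [hb dst h, add_zero], fun i _ hi => hb i hi, hc, hd⟩

/-! ### Growth of the contents of variables -/

theorem Run.bound {P : Prog} {s s' : Config} {T : ℕ} (h : Run P s s' T) :
    ∀ M, (∀ i, s.var i ≤ M) → (∀ i, s.arr i ≤ M) →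
      (∀ i, s'.var i ≤ M + T) ∧ ∀ i, s'.arr i ≤ M + T := by
  induction h with
  | op o s =>
    intro M hv ha
    have hv' := fun i => (hv i).trans (Nat.le_succ M)
    have ha' := fun i => (ha i).trans (Nat.le_succ M)
    cases o <;> refine ⟨fun i => ?_, fun i => ?_⟩ <;>
      simp only [Op.exec, Function.update_apply] <;> (try split_ifs) <;>
      first
        | exact hv' _
        | exact ha' _
        | exact Nat.succ_le_succ (hv _)
        | exact (Nat.sub_le _ _).trans (hv' _)
        | exact Nat.zero_le _
  | seq _ _ ih ih' =>
    intro M hv ha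
    have h1 := ih M hv ha
    simpa only [add_assoc] using ih' _ h1.1 h1.2
  | ite_true _ _ ih =>
    intro M hv ha
    have h1 := ih M hv ha
    exact ⟨fun i => (h1.1 i).trans (by omega), fun i => (h1.2 i).trans (by omega)⟩
  | ite_false _ _ ih =>
    intro M hv ha
    have h1 := ih M hv ha
    exact ⟨fun i => (h1.1 i).trans (by omega), fun i => (h1.2 i).trans (by omega)⟩
  | loop_stop _ =>
    intro M hv ha
    exact ⟨fun i => (hv i).trans (by omega), fun i => (ha i).trans (by omega)⟩
  | loop_step _ _ _ ih ih' =>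
    intro M hv ha
    have h1 := ih M hv ha
    have h2 := ih' _ h1.1 h1.2
    exact ⟨fun i => (h2.1 i).trans (by omega), fun i => (h2.2 i).trans (by omega)⟩

/-! ### Shifting the wires of all printed gates -/

/-- The largest variable named in a gate. -/
def Gate.top : Gate ℕ → ℕ
  | .had i => i
  | .tee i => i
  | .cnot c t => max c t
  | .toffoli c d t => max c (max d t)

/-- The largest variable named in an operation. -/
def Op.top : Op → ℕ
  | .zero x => x
  | .inc x => x
  | .dec x => x
  | .copy x y => max x y
  | .load x y => max x y
  | .store x y => max x y
  | .emit g => g.top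

/-- The largest variable named in a program. -/
def Prog.top : Prog → ℕ
  | .op o => o.top
  | .seq P Q => max P.top Q.top
  | .ite x P Q => max x (max P.top Q.top)
  | .loop x P => max x P.top

/-- `dst := a + V`, where `V` holds the offset and `V + 1` is a scratch counter. -/
def offsetVar (V dst a : ℕ) : Prog := .seq (.op (.copy dst a)) (addVar (V + 1) dst V)

/-- Print a gate with all its wires increased by the content of `V`. -/
def emitShifted (V : ℕ) : Gate ℕ → Prog
  | .had i => .seq (offsetVar V (V + 2) i) (.op (.emit (.had (V + 2))))
  | .tee i => .seq (offsetVar V (V + 2) i) (.op (.emit (.tee (V + 2))))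
  | .cnot c t => .seq (offsetVar V (V + 2) c) (.seq (offsetVar V (V + 3) t)
      (.op (.emit (.cnot (V + 2) (V + 3)))))
  | .toffoli c d t => .seq (offsetVar V (V + 2) c) (.seq (offsetVar V (V + 3) d)
      (.seq (offsetVar V (V + 4) t) (.op (.emit (.toffoli (V + 2) (V + 3) (V + 4))))))

/-- The program in which each printed gate is shifted by the content of `V`. -/
def Prog.shift (V : ℕ) : Prog → Prog
  | .op (.emit g) => emitShifted V g
  | .op o => .op o
  | .seq P Q => .seq (P.shift V) (Q.shift V)
  | .ite x P Q => .ite x (P.shift V) (Q.shift V)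
  | .loop x P => .loop x (P.shift V)

/-- `t` simulates `s`: the same memory below `V`, the offset `S` in `V`, the variables from `V + 5`
on are as in `r`, and the shifted gates have been appended to those of `r`. -/
structure Simulates (V S : ℕ) (r s t : Config) : Prop where
  var_lt : ∀ i, i < V → t.var i = s.var i
  offset : t.var V = S
  frame : ∀ i, V + 5 ≤ i → t.var i = r.var i
  arr : t.arr = s.arr
  out : t.out = r.out ++ s.out.map (Gate.map (S + ·))

theorem offsetVar_halts {V dst a : ℕ} (hdst : V + 1 < dst) (s : Config) :
    Halts (offsetVar V dst a) s (3 * s.var V + 3) fun s' =>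
      s'.var dst = s.var V + s.var a ∧
      (∀ i, i ≠ dst → i ≠ V + 1 → s'.var i = s.var i) ∧ s'.arr = s.arr ∧ s'.out = s.out := by
  have h := addVar_halts (cnt := V + 1) (dst := dst) (src := V) (by omega)
    (Op.exec (.copy dst a) s)
  have hV : (Op.exec (.copy dst a) s).var V = s.var V := Function.update_of_ne (by omega) _ _
  have hd : (Op.exec (.copy dst a) s).var dst = s.var a := Function.update_self _ _ _
  refine Halts.mono (Halts.seq (B := 1) (Q := fun s' => s' = Op.exec (.copy dst a) s)
    (Halts.op rfl) (by rintro _ rfl; exact h)) (by omega) ?_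
  rintro s' ⟨h1, h2, h3, h4⟩
  refine ⟨by rw [h1, hV, hd, add_comm], fun i hi hi' => ?_, h3, h4⟩
  rw [h2 i hi hi']
  exact Function.update_of_ne hi _ _

theorem emitShifted_halts {V S : ℕ} {g : Gate ℕ} (hg : g.top < V) {r s t : Config}
    (h : Simulates V S r s t) :
    Halts (emitShifted V g) t (9 * S + 10) (Simulates V S r (Op.exec (.emit g) s)) := by
  obtain ⟨h1, h2, h3, h4, h5⟩ := h
  cases g with
  | had i =>
    simp only [Gate.top] at hg
    refine Halts.mono (Halts.seq (offsetVar_halts (by omega) t) fun t1 ⟨a1, a2, a3, a4⟩ =>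
      Halts.op (Q := Simulates V S r (Op.exec (.emit (.had i)) s)) ⟨fun j hj => ?_, ?_,
        fun j hj => ?_, a3.trans h4, ?_⟩) (by omega) fun _ h => h
    · exact (a2 j (by omega) (by omega)).trans (h1 j hj)
    · exact (a2 _ (by omega) (by omega)).trans h2
    · exact (a2 j (by omega) (by omega)).trans (h3 j hj)
    · simp [Op.exec, Gate.map, a1, a4, h5, h2, h1 i hg]
  | tee i =>
    simp only [Gate.top] at hg
    refine Halts.mono (Halts.seq (offsetVar_halts (by omega) t) fun t1 ⟨a1, a2, a3, a4⟩ =>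
      Halts.op (Q := Simulates V S r (Op.exec (.emit (.tee i)) s)) ⟨fun j hj => ?_, ?_,
        fun j hj => ?_, a3.trans h4, ?_⟩) (by omega) fun _ h => h
    · exact (a2 j (by omega) (by omega)).trans (h1 j hj)
    · exact (a2 _ (by omega) (by omega)).trans h2
    · exact (a2 j (by omega) (by omega)).trans (h3 j hj)
    · simp [Op.exec, Gate.map, a1, a4, h5, h2, h1 i hg]
  | cnot c u =>
    simp only [Gate.top, max_lt_iff] at hg
    refine Halts.mono (Halts.seq (offsetVar_halts (by omega) t) fun t1 ⟨a1, a2, a3, a4⟩ =>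
      (Halts.seq (offsetVar_halts (by omega) t1) fun t2 ⟨b1, b2, b3, b4⟩ =>
      Halts.op (Q := Simulates V S r (Op.exec (.emit (.cnot c u)) s)) ⟨fun j hj => ?_, ?_,
        fun j hj => ?_, b3.trans (a3.trans h4), ?_⟩).mono (B' := 3 * S + 4) ?_ fun _ h => h)
        (by omega) fun _ h => h
    · rw [a2 _ (by omega) (by omega), h2]
    · exact (b2 j (by omega) (by omega)).trans
        ((a2 j (by omega) (by omega)).trans (h1 j hj))
    · exact (b2 _ (by omega) (by omega)).trans ((a2 _ (by omega) (by omega)).trans h2)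
    · exact (b2 j (by omega) (by omega)).trans
        ((a2 j (by omega) (by omega)).trans (h3 j hj))
    · have e1 : t2.var (V + 2) = S + s.var c := by
        rw [b2 _ (by omega) (by omega), a1, h2, h1 _ hg.1]
      have e2 : t2.var (V + 3) = S + s.var u := by
        rw [b1, a2 _ (by omega) (by omega), a2 _ (by omega) (by omega), h2, h1 _ hg.2]
      simp [Op.exec, Gate.map, e1, e2, a4, b4, h5]
  | toffoli c d u =>
    simp only [Gate.top, max_lt_iff] at hg
    refine Halts.mono (Halts.seq (offsetVar_halts (by omega) t) fun t1 ⟨a1, a2, a3, a4⟩ =>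
      (Halts.seq (offsetVar_halts (by omega) t1) fun t2 ⟨b1, b2, b3, b4⟩ =>
      (Halts.seq (offsetVar_halts (by omega) t2) fun t3 ⟨c1, c2, c3, c4⟩ =>
      Halts.op (Q := Simulates V S r (Op.exec (.emit (.toffoli c d u)) s)) ⟨fun j hj => ?_, ?_,
        fun j hj => ?_, c3.trans (b3.trans (a3.trans h4)), ?_⟩).mono
        (B' := 3 * S + 4) ?_ fun _ h => h).mono (B' := 6 * S + 7) ?_ fun _ h => h)
        (by omega) fun _ h => h
    · rw [a2 _ (by omega) (by omega), h2]; omega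
    · rw [b2 _ (by omega) (by omega), a2 _ (by omega) (by omega), h2]
    · exact (c2 j (by omega) (by omega)).trans ((b2 j (by omega) (by omega)).trans
        ((a2 j (by omega) (by omega)).trans (h1 j hj)))
    · exact (c2 _ (by omega) (by omega)).trans
        ((b2 _ (by omega) (by omega)).trans ((a2 _ (by omega) (by omega)).trans h2))
    · exact (c2 j (by omega) (by omega)).trans ((b2 j (by omega) (by omega)).trans
        ((a2 j (by omega) (by omega)).trans (h3 j hj)))
    · have e1 : t3.var (V + 2) = S + s.var c := by
        rw [c2 _ (by omega) (by omega), b2 _ (by omega) (by omega), a1, h2, h1 _ hg.1]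
      have e2 : t3.var (V + 3) = S + s.var d := by
        rw [c2 _ (by omega) (by omega), b1, a2 _ (by omega) (by omega),
          a2 _ (by omega) (by omega), h2, h1 _ hg.2.1]
      have e3 : t3.var (V + 4) = S + s.var u := by
        rw [c1, b2 _ (by omega) (by omega), a2 _ (by omega) (by omega),
          b2 _ (by omega) (by omega), a2 _ (by omega) (by omega), h2, h1 _ hg.2.2]
      simp [Op.exec, Gate.map, e1, e2, e3, a4, b4, c4, h5]

theorem Op.exec_simulates {V S : ℕ} {o : Op} (ho : o.top < V) (hne : ∀ g, o ≠ .emit g)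
    {r s t : Config} (h : Simulates V S r s t) : Simulates V S r (o.exec s) (o.exec t) := by
  obtain ⟨h1, h2, h3, h4, h5⟩ := h
  cases o <;> simp only [Op.top, max_lt_iff] at ho <;>
    first
      | exact absurd rfl (hne _)
      | (refine ⟨fun i hi => ?_, ?_, fun i hi => ?_, ?_, ?_⟩ <;>
          simp_all [Op.exec, Function.update_apply] <;> omega)

theorem Run.shift {V S : ℕ} {P : Prog} {s s' : Config} {T : ℕ} (h : Run P s s' T) :
    P.top < V → ∀ r t, Simulates V S r s t →
      Halts (P.shift V) t (T * (9 * S + 10)) (Simulates V S r s') := by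
  induction h with
  | op o s =>
    intro hP r t hst
    by_cases hne : ∀ g, o ≠ .emit g
    · have : Prog.shift V (.op o) = .op o := by
        cases o <;> first | rfl | exact absurd rfl (hne _)
      rw [this]
      exact Halts.mono (Halts.op (Op.exec_simulates hP hne hst)) (by omega) fun _ h => h
    · push Not at hne
      obtain ⟨g, rfl⟩ := hne
      exact Halts.mono (emitShifted_halts hP hst) (by omega) fun _ h => h
  | seq _ _ ih ih' =>
    intro hP r t hst
    simp only [Prog.top, max_lt_iff] at hP
    exact Halts.mono (Halts.seq (ih hP.1 r t hst) fun t1 h1 => ih' hP.2 r t1 h1)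
      (by rw [add_mul]) fun _ h => h
  | ite_true hx _ ih =>
    intro hP r t hst
    simp only [Prog.top, max_lt_iff] at hP
    exact Halts.mono (Halts.ite (fun _ => ih hP.2.1 r t hst)
      (fun h0 => absurd ((hst.var_lt _ hP.1).symm.trans h0) hx)) (by rw [add_mul]; omega)
      fun _ h => h
  | ite_false hx _ ih =>
    intro hP r t hst
    simp only [Prog.top, max_lt_iff] at hP
    exact Halts.mono (Halts.ite (fun h0 => absurd ((hst.var_lt _ hP.1).trans hx) h0)
      (fun _ => ih hP.2.2 r t hst)) (by rw [add_mul]; omega) fun _ h => h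
  | loop_stop hx =>
    intro hP r t hst
    simp only [Prog.top, max_lt_iff] at hP
    exact ⟨t, 1, Run.loop_stop ((hst.var_lt _ hP.1).trans hx), by omega, hst⟩
  | loop_step hx _ _ ih ih' =>
    intro hP r t hst
    have hP' := hP
    simp only [Prog.top, max_lt_iff] at hP
    obtain ⟨t1, T1, hr1, hT1, h1⟩ := ih hP.2 r t hst
    obtain ⟨t2, T2, hr2, hT2, h2⟩ := ih' hP' r t1 h1
    refine ⟨t2, T1 + T2 + 1, .loop_step ?_ hr1 hr2, ?_, h2⟩
    · rw [hst.var_lt _ hP.1]; exact hx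
    · rw [add_mul, add_mul]; omega

/-! ### The program that prints the circuits of the PRFS generator -/

/-- The gates of the PRFS generator built from the gates `L` of a PRS generator. With
`S = 2 * lam + m`, the first `S` wires hold the two halves `k₁`, `k₂` of the key and the string `x`,
and the PRS circuit lives on the wires from `S` on. First `k₁` is copied to its place, then the PRS
circuit is run, then qubit `t < lam` of its output gets a phase `-1` controlled by bit `t` of `k₂`
and bit `t % m` of `x`, and finally the output is swapped to the front. -/
def prfsGates (lam m n : ℕ) (L : List (Gate ℕ)) : List (Gate ℕ) :=
  (List.range lam).map (fun i => .cnot i (2 * lam + m + i)) ++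
  (L.map (Gate.map (2 * lam + m + ·)) ++
  ((List.range lam).flatMap (fun t => [.had (2 * lam + m + t),
    .toffoli (lam + t) (2 * lam + t % m) (2 * lam + m + t), .had (2 * lam + m + t)]) ++
  (List.range n).flatMap (fun i => [.cnot i (2 * lam + m + i), .cnot (2 * lam + m + i) i,
    .cnot i (2 * lam + m + i)])))

/-- Straight-line programs. -/
def block : List Op → Prog
  | [] => .op (.copy 0 0)
  | o :: os => .seq (.op o) (block os)

theorem block_halts (l : List Op) {s : Config} {Q : Config → Prop}
    (h : Q (l.foldl (fun s o => o.exec s) s)) : Halts (block l) s (l.length + 1) Q := by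
  induction l generalizing s with
  | nil =>
    refine Halts.op ?_
    have : Op.exec (.copy 0 0) s = s := by simp [Op.exec]
    rw [this]
    exact h
  | cons o os ih =>
    refine Halts.mono (Halts.seq (Q := fun s' => s' = o.exec s) (Halts.op rfl)
      (by rintro _ rfl; exact ih h)) (by simp only [List.length_cons]; omega) fun _ h => h

/-- Compute `2 * lam + m` and save the parameters. -/
def initProg (V : ℕ) : Prog :=
  .seq (block [.copy (V + 5) 0, .copy (V + 6) 1, .copy (V + 9) 0]) <|
  .seq (addVar (V + 1) (V + 9) (V + 5)) <|
  .seq (block [.copy V (V + 9), .zero 1]) (addVar (V + 1) V (V + 6))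

/-- The parameters saved by `initProg`. -/
structure Saved (V lam m : ℕ) (s : Config) : Prop where
  offset : s.var V = 2 * lam + m
  lam_eq : s.var (V + 5) = lam
  m_eq : s.var (V + 6) = m
  two_lam : s.var (V + 9) = 2 * lam

theorem initProg_halts {V : ℕ} (hV : 1 < V) (lam m : ℕ) :
    Halts (initProg V) (Config.init lam m) (3 * lam + 3 * m + 11) fun s =>
      Saved V lam m s ∧ (∀ i, i < V → s.var i = (Config.init lam 0).var i) ∧
      s.arr = (Config.init lam 0).arr ∧ s.out = [] := by
  refine Halts.mono (Halts.seq (Q := fun s => s.var (V + 5) = lam ∧ s.var (V + 6) = m ∧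
      s.var (V + 9) = lam ∧ (∀ i, i < V → s.var i = (Config.init lam m).var i) ∧
      s.arr = (Config.init lam 0).arr ∧ s.out = []) (block_halts _ ?_)
    fun s1 h1 => (Halts.seq ((addVar_halts (by omega) s1)) fun s2 h2 =>
      (Halts.seq (Q := fun s => s.var V = 2 * lam ∧ s.var (V + 5) = lam ∧ s.var (V + 6) = m ∧
      s.var (V + 9) = 2 * lam ∧ (∀ i, i < V → s.var i = (Config.init lam 0).var i) ∧
      s.arr = (Config.init lam 0).arr ∧ s.out = []) (block_halts _ ?_)
      fun s3 h3 => (addVar_halts (by omega) s3).mono (B' := 3 * m + 2)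
        (by rw [h3.2.2.1]) fun s4 h4 => ?_)).mono (B' := 3 * lam + 2 + 3 + (3 * m + 2)) ?_
          fun _ h => h) (by simp only [List.length_cons, List.length_nil]; omega) fun _ h => h
  · simp only [List.foldl, Op.exec, Config.init]
    refine ⟨?_, ?_, ?_, fun i hi => ?_, trivial, trivial⟩
    on_goal 4 => repeat rw [Function.update_of_ne (by omega)]
    all_goals simp
  · obtain ⟨a1, a2, a3, a4, a5, a6⟩ := h1
    obtain ⟨b1, b2, b3, b4⟩ := h2
    simp only [List.foldl, Op.exec]
    have c1 : s2.var (V + 5) = lam := by rw [b2 _ (by omega) (by omega), a1]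
    have c2 : s2.var (V + 6) = m := by rw [b2 _ (by omega) (by omega), a2]
    have c3 : s2.var (V + 9) = 2 * lam := by rw [b1, a3, a1]; omega
    refine ⟨?_, ?_, ?_, ?_, fun i hi => ?_, b3.trans a5, b4.trans a6⟩
    · rw [Function.update_of_ne (by omega), Function.update_self, c3]
    · rw [Function.update_of_ne (by omega), Function.update_of_ne (by omega), c1]
    · rw [Function.update_of_ne (by omega), Function.update_of_ne (by omega), c2]
    · rw [Function.update_of_ne (by omega), Function.update_of_ne (by omega), c3]
    · by_cases h1 : i = 1
      · subst h1; simp [Config.init]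
      · rw [Function.update_of_ne h1, Function.update_of_ne (by omega),
          b2 _ (by omega) (by omega), a4 i hi]
        simp [Config.init, h1]
  · obtain ⟨a1, a2, a3, a4, a5, a6, a7⟩ := h3
    obtain ⟨b1, b2, b3, b4⟩ := h4
    refine ⟨⟨by rw [b1, a1, a3], ?_, ?_, ?_⟩, fun i hi => ?_, b3.trans a6, b4.trans a7⟩
    · rw [b2 _ (by omega) (by omega), a2]
    · rw [b2 _ (by omega) (by omega), a3]
    · rw [b2 _ (by omega) (by omega), a4]
    · rw [b2 _ (by omega) (by omega), a5 i hi]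
  · obtain ⟨a1, a2, a3, a4, a5, a6⟩ := h1
    simp only [List.length_cons, List.length_nil, a1]
    omega

/-- Print the gates copying `k₁`. -/
def copyProg (V : ℕ) : Prog :=
  .seq (block [.zero (V + 2), .copy (V + 3) V, .copy (V + 7) (V + 5)]) <|
  .loop (V + 7) (block [.dec (V + 7), .emit (.cnot (V + 2) (V + 3)), .inc (V + 2), .inc (V + 3)])

theorem copyProg_halts {V lam m : ℕ} {s : Config} (h : Saved V lam m s) :
    Halts (copyProg V) s (6 * lam + 5) fun s' =>
      Saved V lam m s' ∧ (∀ i, i < V → s'.var i = s.var i) ∧ s'.arr = s.arr ∧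
      s'.out = s.out ++ (List.range lam).map (fun i => .cnot i (2 * lam + m + i)) := by
  obtain ⟨h1, h2, h3, h4⟩ := h
  refine Halts.mono (Halts.seq (Q := fun s' => s'.var (V + 7) = lam ∧
      (s'.var (V + 2) = 0 ∧ s'.var (V + 3) = 2 * lam + m ∧
      Saved V lam m s' ∧ (∀ i, i < V → s'.var i = s.var i) ∧ s'.arr = s.arr ∧ s'.out = s.out))
    (block_halts _ ?_)
    fun s1 g1 => Halts.loop (N := lam) (B := 5)
      (I := fun k s' => s'.var (V + 2) = k ∧ s'.var (V + 3) = 2 * lam + m + k ∧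
      Saved V lam m s' ∧ (∀ i, i < V → s'.var i = s.var i) ∧ s'.arr = s.arr ∧
      s'.out = s.out ++ (List.range k).map (fun i => .cnot i (2 * lam + m + i)))
      (fun k s2 hk g2 hs2 => (block_halts _ ?_)) ?_ g1.1)
    (by simp only [List.length_cons, List.length_nil]; omega) ?_
  · simp only [List.foldl, Op.exec]
    refine ⟨?_, ?_, ?_, ⟨?_, ?_, ?_, ?_⟩, fun i hi => ?_, trivial, trivial⟩
    on_goal 8 => repeat rw [Function.update_of_ne (by omega)]
    all_goals simp <;> omega
  · obtain ⟨a1, a2, ⟨a3, a4, a5, a6⟩, a7, a8, a9⟩ := g2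
    simp only [List.foldl, Op.exec]
    refine ⟨⟨?_, ?_, ⟨?_, ?_, ?_, ?_⟩, fun i hi => ?_, a8, ?_⟩, ?_⟩
    · simp [a1]
    · simp [a2]; omega
    · simp [a3]
    · simp [a4]
    · simp [a5]
    · simp [a6]
    · rw [← a7 i hi]
      repeat rw [Function.update_of_ne (by omega)]
    · simp [Gate.map, a1, a2, a9, List.range_succ]
    · simp [hs2]; omega
  · obtain ⟨_, a1, a2, a3, a4, a5, a6⟩ := g1
    exact ⟨a1, by omega, a3, a4, a5, by simpa using a6⟩
  · rintro s' ⟨_, _, h⟩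
    exact h

/-- Print the controlled phases. -/
def phaseProg (V : ℕ) : Prog :=
  .seq (block [.copy (V + 2) V, .copy (V + 3) (V + 5), .copy (V + 4) (V + 9),
    .copy (V + 8) (V + 6), .copy (V + 7) (V + 5)]) <|
  .loop (V + 7) <|
    .seq (block [.dec (V + 7), .emit (.had (V + 2)), .emit (.toffoli (V + 3) (V + 4) (V + 2)),
      .emit (.had (V + 2)), .inc (V + 2), .inc (V + 3), .inc (V + 4), .dec (V + 8)])
    (.ite (V + 8) (block []) (block [.copy (V + 4) (V + 9), .copy (V + 8) (V + 6)]))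

theorem phaseProg_halts {V lam m : ℕ} (hm : 0 < lam → 0 < m) {s : Config}
    (h : Saved V lam m s) :
    Halts (phaseProg V) s (14 * lam + 7) fun s' =>
      Saved V lam m s' ∧ (∀ i, i < V → s'.var i = s.var i) ∧
      s'.out = s.out ++ (List.range lam).flatMap (fun t => [.had (2 * lam + m + t),
        .toffoli (lam + t) (2 * lam + t % m) (2 * lam + m + t), .had (2 * lam + m + t)]) := by
  obtain ⟨h1, h2, h3, h4⟩ := h
  refine Halts.mono (Halts.seq (Q := fun s' => s'.var (V + 7) = lam ∧
      (s'.var (V + 2) = 2 * lam + m ∧ s'.var (V + 3) = lam ∧ s'.var (V + 4) = 2 * lam ∧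
        s'.var (V + 8) = m ∧
      Saved V lam m s' ∧ (∀ i, i < V → s'.var i = s.var i) ∧ s'.out = s.out))
    (block_halts _ ?_)
    fun s1 g1 => Halts.loop (N := lam) (B := 13)
      (I := fun k s' => s'.var (V + 2) = 2 * lam + m + k ∧ s'.var (V + 3) = lam + k ∧
        s'.var (V + 4) = 2 * lam + k % m ∧ s'.var (V + 8) = m - k % m ∧
      Saved V lam m s' ∧ (∀ i, i < V → s'.var i = s.var i) ∧
      s'.out = s.out ++ (List.range k).flatMap (fun t => [.had (2 * lam + m + t),
        .toffoli (lam + t) (2 * lam + t % m) (2 * lam + m + t), .had (2 * lam + m + t)]))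
      (fun k s2 hk g2 hs2 => (Halts.seq (Q := fun s' => s'.var (V + 7) = lam - (k + 1) ∧
        s'.var (V + 2) = 2 * lam + m + (k + 1) ∧
        s'.var (V + 3) = lam + (k + 1) ∧ s'.var (V + 4) = 2 * lam + k % m + 1 ∧
        s'.var (V + 8) = m - k % m - 1 ∧
        Saved V lam m s' ∧ (∀ i, i < V → s'.var i = s.var i) ∧
        s'.out = s.out ++ (List.range (k + 1)).flatMap (fun t => [.had (2 * lam + m + t),
        .toffoli (lam + t) (2 * lam + t % m) (2 * lam + m + t), .had (2 * lam + m + t)]))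
        (block_halts _ ?_) fun s3 g3 => Halts.ite (B := 3)
          (fun hz => (block_halts _ ?_).mono (by simp) fun _ h => h)
          (fun hz => (block_halts _ ?_).mono (by simp) fun _ h => h)).mono (by simp) fun _ h => h)
          ?_ g1.1)
    (by simp only [List.length_cons, List.length_nil]; omega) ?_
  · simp only [List.foldl, Op.exec]
    refine ⟨?_, ?_, ?_, ?_, ?_, ⟨?_, ?_, ?_, ?_⟩, fun i hi => ?_, trivial⟩
    on_goal 10 => repeat rw [Function.update_of_ne (by omega)]
    all_goals simp; try omega
  · obtain ⟨a1, a2, a11, a12, ⟨a3, a4, a5, a6⟩, a7, a9⟩ := g2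
    simp only [List.foldl, Op.exec]
    refine ⟨?_, ?_, ?_, ?_, ?_, ⟨?_, ?_, ?_, ?_⟩, fun i hi => ?_, ?_⟩
    · simp [hs2]; omega
    · simp [a1]; omega
    · simp [a2]; omega
    · simp [a11]
    · simp [a12]
    · simp [a3]
    · simp [a4]
    · simp [a5]
    · simp [a6]
    · rw [← a7 i hi]
      repeat rw [Function.update_of_ne (by omega)]
    · simp [Gate.map, a1, a2, a11, a9, List.range_succ]
  · obtain ⟨a1, a2, a3, a4, a5, a6, a7, a8⟩ := g3
    have hm' := hm (by omega)
    have hlt := Nat.mod_lt k hm'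
    have : (k + 1) % m = k % m + 1 := by
      rw [Nat.add_mod, Nat.mod_eq_of_lt (a := 1) (by omega), Nat.mod_eq_of_lt (by omega)]
    simp only [List.foldl]
    exact ⟨⟨a2, a3, by omega, by omega, a6, a7, a8⟩, a1⟩
  · obtain ⟨a1, a2, a3, a4, a5, ⟨b1, b2, b3, b4⟩, a7, a8⟩ := g3
    have hm' := hm (by omega)
    have hlt := Nat.mod_lt k hm'
    have : (k + 1) % m = 0 := by
      rw [Nat.add_mod]
      rcases Nat.lt_or_ge 1 m with h | h
      · rw [Nat.mod_eq_of_lt h, show k % m + 1 = m by omega, Nat.mod_self]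
      · rw [show m = 1 by omega, Nat.mod_one]
    simp only [List.foldl, Op.exec]
    refine ⟨⟨?_, ?_, ?_, ?_, ⟨?_, ?_, ?_, ?_⟩, fun i hi => ?_, a8⟩, ?_⟩
    · simp [a2]
    · simp [a3]
    · simp [b4, this]
    · simp [b3, this]
    · simp [b1]
    · simp [b2]
    · simp [b3]
    · simp [b4]
    · rw [← a7 i hi]
      repeat rw [Function.update_of_ne (by omega)]
    · simp [a1]
  · obtain ⟨_, a1, a2, a3, a4, a5, a6, a7⟩ := g1
    exact ⟨a1, by omega, by simpa using a3, by simpa using a4, a5, a6, by simpa using a7⟩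
  · rintro s' ⟨_, _, _, _, h⟩
    exact h

/-- Print the swaps. -/
def swapProg (V : ℕ) : Prog :=
  .seq (block [.zero (V + 2), .copy (V + 3) V, .copy (V + 7) 0]) <|
  .loop (V + 7) (block [.dec (V + 7), .emit (.cnot (V + 2) (V + 3)),
    .emit (.cnot (V + 3) (V + 2)), .emit (.cnot (V + 2) (V + 3)), .inc (V + 2), .inc (V + 3)])

theorem swapProg_halts {V lam m n : ℕ} {s : Config} (h : Saved V lam m s)
    (hn : s.var 0 = n) :
    Halts (swapProg V) s (8 * n + 5) fun s' =>
      Saved V lam m s' ∧ (∀ i, i < V → s'.var i = s.var i) ∧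
      s'.out = s.out ++ (List.range n).flatMap (fun i => [.cnot i (2 * lam + m + i),
        .cnot (2 * lam + m + i) i, .cnot i (2 * lam + m + i)]) := by
  obtain ⟨h1, h2, h3, h4⟩ := h
  refine Halts.mono (Halts.seq (Q := fun s' => s'.var (V + 7) = n ∧
      (s'.var (V + 2) = 0 ∧ s'.var (V + 3) = 2 * lam + m ∧
      Saved V lam m s' ∧ (∀ i, i < V → s'.var i = s.var i) ∧ s'.out = s.out))
    (block_halts _ ?_)
    fun s1 g1 => Halts.loop (N := n) (B := 7)
      (I := fun k s' => s'.var (V + 2) = k ∧ s'.var (V + 3) = 2 * lam + m + k ∧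
      Saved V lam m s' ∧ (∀ i, i < V → s'.var i = s.var i) ∧
      s'.out = s.out ++ (List.range k).flatMap (fun i => [.cnot i (2 * lam + m + i),
        .cnot (2 * lam + m + i) i, .cnot i (2 * lam + m + i)]))
      (fun k s2 hk g2 hs2 => (block_halts _ ?_)) ?_ g1.1)
    (by simp only [List.length_cons, List.length_nil]; omega) ?_
  · simp only [List.foldl, Op.exec]
    refine ⟨?_, ?_, ?_, ⟨?_, ?_, ?_, ?_⟩, fun i hi => ?_, trivial⟩
    on_goal 8 => repeat rw [Function.update_of_ne (by omega)]
    all_goals simp <;> omega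
  · obtain ⟨a1, a2, ⟨a3, a4, a5, a6⟩, a7, a9⟩ := g2
    simp only [List.foldl, Op.exec]
    refine ⟨⟨?_, ?_, ⟨?_, ?_, ?_, ?_⟩, fun i hi => ?_, ?_⟩, ?_⟩
    · simp [a1]
    · simp [a2]; omega
    · simp [a3]
    · simp [a4]
    · simp [a5]
    · simp [a6]
    · rw [← a7 i hi]
      repeat rw [Function.update_of_ne (by omega)]
    · simp [Gate.map, a1, a2, a9, List.range_succ]
    · simp [hs2]; omega
  · obtain ⟨_, a1, a2, a3, a4, a6⟩ := g1
    exact ⟨a1, by omega, a3, a4, by simpa using a6⟩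
  · rintro s' ⟨_, _, h⟩
    exact h

/-- The program printing the circuits of the PRFS generator, where `P` prints those of the PRS
generator and names no variable from `V` on. -/
def prfsProg (V : ℕ) (P : Prog) : Prog :=
  .seq (initProg V) <| .seq (copyProg V) <| .seq (P.shift V) <| .seq (phaseProg V) <|
  .seq (swapProg V) (addVar (V + 1) 1 V)

theorem prfsProg_halts {V lam m : ℕ} (hm : 0 < lam → 0 < m) {P : Prog} (hP : P.top < V)
    (hV : 1 < V) {s : Config} {T : ℕ} (hr : Run P (Config.init lam 0) s T) :
    Halts (prfsProg V P) (Config.init lam m)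
      (3 * lam + 3 * m + 11 + (6 * lam + 5 + (T * (9 * (2 * lam + m) + 10) + (14 * lam + 7 +
        (8 * (lam + T) + 5 + (3 * (2 * lam + m) + 2))))))
      fun s' => s'.out = prfsGates lam m (s.var 0) s.out ∧ s'.var 0 = s.var 0 ∧
        s'.var 1 = 2 * lam + m + s.var 1 := by
  have hb : s.var 0 ≤ lam + T := by
    refine (hr.bound lam (fun i => ?_) (fun i => Nat.zero_le _)).1 0
    simp only [Config.init]
    split_ifs <;> omega
  refine Halts.seq (initProg_halts hV lam m) fun s1 ⟨a1, a2, a3, a4⟩ => ?_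
  refine Halts.seq (copyProg_halts a1) fun s2 ⟨b1, b2, b3, b4⟩ => ?_
  refine Halts.seq (hr.shift (S := 2 * lam + m) hP s2 s2 ⟨fun i hi => ?_, b1.1, fun _ _ => rfl,
    b3.trans a3, by simp [Config.init]⟩) fun s3 hs => ?_
  · rw [b2 i hi, a2 i hi]
  have c1 : Saved V lam m s3 := ⟨hs.offset, by rw [hs.frame _ le_rfl, b1.lam_eq],
    by rw [hs.frame _ (by omega), b1.m_eq], by rw [hs.frame _ (by omega), b1.two_lam]⟩
  refine Halts.seq (phaseProg_halts hm c1) fun s4 ⟨d1, d2, d3⟩ => ?_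
  have hn : s4.var 0 = s.var 0 := by rw [d2 _ (by omega), hs.var_lt _ (by omega)]
  refine Halts.seq ((swapProg_halts d1 hn).mono (B' := 8 * (lam + T) + 5)
    (by omega) fun _ h => h) fun s5 ⟨e1, e2, e3⟩ => ?_
  refine (addVar_halts (by omega) s5).mono (by rw [e1.offset]) fun s6 ⟨f1, f2, f3, f4⟩ => ?_
  refine ⟨?_, ?_, ?_⟩
  · rw [f4, e3, d3, hs.out, b4, a4, prfsGates]
    simp only [List.nil_append, List.append_assoc]
  · rw [f2 _ (by omega) (by omega), e2 _ (by omega), hn]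
  · rw [f1, e1.offset, e2 _ hV, d2 _ hV, hs.var_lt _ hV, add_comm]

/-! ### The action of circuits on state vectors -/

section Circuits

theorem extend_comp_self {W V : Type} (ι : W → V) (b : V → Bool) : Function.extend ι (b ∘ ι) b = b := by
  classical
  funext v
  by_cases hv : ∃ w, ι w = v
  · simp only [Function.extend, dif_pos hv, Function.comp]
    rw [Classical.choose_spec hv]
  · rw [Function.extend_apply' _ _ _ hv]

variable {W V : Type} [DecidableEq W] [DecidableEq V]

/-- The action of `Gate.cnot c t` on basis states. -/
def cnotFun (c t : W) (a : W → Bool) : W → Bool :=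
  if a c = true ∧ c ≠ t then Function.update a t (!(a t)) else a

/-- The action of `Gate.toffoli c d t` on basis states. -/
def toffoliFun (c d t : W) (a : W → Bool) : W → Bool :=
  if a c = true ∧ a d = true ∧ c ≠ t ∧ d ≠ t then Function.update a t (!(a t)) else a

theorem cnotFun_of_ne {c t : W} (h : c ≠ t) (a : W → Bool) :
    cnotFun c t a = Function.update a t (a c ^^ a t) := by
  cases hc : a c <;> simp [cnotFun, hc, h]

theorem cnotFun_involutive (c t : W) : Function.Involutive (cnotFun c t) := by
  intro a
  by_cases h : a c = true ∧ c ≠ t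
  · have : cnotFun c t a = Function.update a t (!(a t)) := if_pos h
    rw [this, cnotFun, if_pos ⟨by rw [Function.update_of_ne h.2]; exact h.1, h.2⟩]
    simp
  · have : cnotFun c t a = a := if_neg h
    rw [this, this]

theorem toffoliFun_involutive (c d t : W) : Function.Involutive (toffoliFun c d t) := by
  intro a
  by_cases h : a c = true ∧ a d = true ∧ c ≠ t ∧ d ≠ t
  · have : toffoliFun c d t a = Function.update a t (!(a t)) := if_pos h
    rw [this, toffoliFun, if_pos ⟨by rw [Function.update_of_ne h.2.2.1]; exact h.1,
      by rw [Function.update_of_ne h.2.2.2]; exact h.2.1, h.2.2⟩]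
    simp
  · have : toffoliFun c d t a = a := if_neg h
    rw [this, this]

theorem update_extend {ι : W → V} (hι : Function.Injective ι) (a : W → Bool) (b : V → Bool)
    (i : W) (x : Bool) :
    Function.update (Function.extend ι a b) (ι i) x =
      Function.extend ι (Function.update a i x) b := by
  funext v
  by_cases hv : ∃ w, ι w = v
  · obtain ⟨w, rfl⟩ := hv
    rw [hι.extend_apply]
    by_cases hw : w = i
    · subst hw; simp
    · rw [Function.update_of_ne (hι.ne hw), Function.update_of_ne hw, hι.extend_apply]
  · rw [Function.extend_apply' _ _ _ hv, Function.update_of_ne, Function.extend_apply' _ _ _ hv]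
    rintro rfl
    exact hv ⟨i, rfl⟩

variable [Fintype W] [Fintype V]

theorem had_mulVec (i : W) (ψ : (W → Bool) → ℂ) (a : W → Bool) :
    ((Gate.had i).mat.mulVec ψ) a =
      (ψ (Function.update a i false) +
        (if a i = true then -1 else 1) * ψ (Function.update a i true)) / (Real.sqrt 2 : ℂ) := by
  have hne : Function.update a i false ≠ Function.update a i true := fun h => by
    simpa using congrFun h i
  have h1 : ∀ x : Bool, ∀ j, j ≠ i → a j = Function.update a i x j := fun x j hj => by
    rw [Function.update_of_ne hj]
  rw [Matrix.mulVec, dotProduct, Finset.sum_eq_add _ _ hne]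
  · simp only [Gate.mat, if_pos (h1 false), if_pos (h1 true), Function.update_self]
    simp only [Bool.false_eq_true, and_false, if_false, and_true]
    split_ifs <;> ring
  · rintro b - ⟨hb0, hb1⟩
    simp only [Gate.mat]
    rw [if_neg, zero_mul]
    intro h
    cases hb : b i
    · exact hb0 (funext fun j => by
        by_cases hj : j = i
        · subst hj; simp [hb]
        · rw [Function.update_of_ne hj, h j hj])
    · exact hb1 (funext fun j => by
        by_cases hj : j = i
        · subst hj; simp [hb]
        · rw [Function.update_of_ne hj, h j hj])
  · simp
  · simp

theorem tee_mulVec (i : W) (ψ : (W → Bool) → ℂ) (a : W → Bool) :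
    ((Gate.tee i).mat.mulVec ψ) a =
      (if a i = true then Complex.exp (Complex.I * Real.pi / 4) else 1) * ψ a := by
  simp only [Gate.mat, Matrix.mulVec_diagonal]

theorem mulVec_of_involutive {f : (W → Bool) → W → Bool} (hf : Function.Involutive f)
    (ψ : (W → Bool) → ℂ) (a : W → Bool) :
    Matrix.mulVec (fun a b => if a = f b then (1 : ℂ) else 0) ψ a = ψ (f a) := by
  change ∑ b, (if a = f b then (1 : ℂ) else 0) * ψ b = ψ (f a)
  rw [Finset.sum_eq_single (f a)]
  · simp [hf a]
  · intro b _ hb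
    rw [if_neg (fun h => hb (by rw [h, hf b])), zero_mul]
  · simp

theorem cnot_mulVec (c t : W) (ψ : (W → Bool) → ℂ) (a : W → Bool) :
    ((Gate.cnot c t).mat.mulVec ψ) a = ψ (cnotFun c t a) :=
  mulVec_of_involutive (cnotFun_involutive c t) ψ a

theorem toffoli_mulVec (c d t : W) (ψ : (W → Bool) → ℂ) (a : W → Bool) :
    ((Gate.toffoli c d t).mat.mulVec ψ) a = ψ (toffoliFun c d t a) :=
  mulVec_of_involutive (toffoliFun_involutive c d t) ψ a

/-- Run a circuit on a state vector. -/
def runCircuit (L : List (Gate W)) (ψ : (W → Bool) → ℂ) : (W → Bool) → ℂ :=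
  (circuitMat L).mulVec ψ

@[simp] theorem runCircuit_nil (ψ : (W → Bool) → ℂ) : runCircuit [] ψ = ψ := by
  simp [runCircuit, circuitMat]

theorem runCircuit_cons (g : Gate W) (L : List (Gate W)) (ψ : (W → Bool) → ℂ) :
    runCircuit (g :: L) ψ = runCircuit L (g.mat.mulVec ψ) := by
  simp [runCircuit, circuitMat]

theorem runCircuit_append (L L' : List (Gate W)) (ψ : (W → Bool) → ℂ) :
    runCircuit (L ++ L') ψ = runCircuit L' (runCircuit L ψ) := by
  induction L generalizing ψ with
  | nil => simp
  | cons g L ih => rw [List.cons_append, runCircuit_cons, ih, runCircuit_cons]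

theorem circuitMat_apply (L : List (Gate W)) (a b : W → Bool) :
    circuitMat L a b = runCircuit L (Pi.single b 1) a := by
  simp [runCircuit]

/-! ### Unitarity -/

theorem sum_update_add {f : (W → Bool) → ℝ} (i : W) :
    ∑ a, (f (Function.update a i false) + f (Function.update a i true)) = 2 * ∑ a, f a := by
  have h : Function.Involutive fun a : W → Bool => Function.update a i (!(a i)) := by
    intro a; simp
  have h2 : ∑ a, f (Function.update a i (!(a i))) = ∑ a, f a :=
    (Equiv.sum_comp h.toPerm f)
  calc _ = ∑ a, (f a + f (Function.update a i (!(a i)))) := by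
        refine Finset.sum_congr rfl fun a _ => ?_
        have e : ∀ x : Bool, a i = x → Function.update a i x = a := fun x hx =>
          Function.update_eq_self_iff.2 hx.symm
        cases ha : a i
        · rw [Bool.not_false, e _ ha]
        · rw [Bool.not_true, e _ ha, add_comm]
    _ = _ := by rw [Finset.sum_add_distrib, h2]; ring

theorem gate_norm (g : Gate W) (ψ : (W → Bool) → ℂ) :
    ∑ a, ‖g.mat.mulVec ψ a‖ ^ 2 = ∑ a, ‖ψ a‖ ^ 2 := by
  cases g with
  | had i =>
    have key : ∀ a, ‖(Gate.had i).mat.mulVec ψ (Function.update a i false)‖ ^ 2 +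
        ‖(Gate.had i).mat.mulVec ψ (Function.update a i true)‖ ^ 2 =
        ‖ψ (Function.update a i false)‖ ^ 2 + ‖ψ (Function.update a i true)‖ ^ 2 := by
      intro a
      simp only [had_mulVec, Function.update_idem, Function.update_self]
      have hs : ‖(Real.sqrt 2 : ℂ)‖ ^ 2 = 2 := by
        rw [Complex.norm_real, Real.norm_eq_abs, sq_abs, Real.sq_sqrt (by norm_num)]
      simp only [norm_div, div_pow, hs]
      have := parallelogram_law_with_norm ℝ (ψ (Function.update a i false))
        (ψ (Function.update a i true))
      simp only [Bool.false_eq_true, if_false, if_true, one_mul, neg_mul, ← sub_eq_add_neg]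
      linarith
    have h1 := sum_update_add (f := fun a => ‖(Gate.had i).mat.mulVec ψ a‖ ^ 2) i
    have h2 := sum_update_add (f := fun a => ‖ψ a‖ ^ 2) i
    rw [Finset.sum_congr rfl fun a _ => key a, h2] at h1
    linarith
  | tee i =>
    refine Finset.sum_congr rfl fun a _ => ?_
    rw [tee_mulVec, norm_mul]
    have : ‖Complex.exp (Complex.I * Real.pi / 4)‖ = 1 := by
      rw [Complex.norm_exp]; simp
    split_ifs <;> simp [this]
  | cnot c t =>
    simp only [cnot_mulVec]
    exact Equiv.sum_comp (cnotFun_involutive c t).toPerm fun a => ‖ψ a‖ ^ 2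
  | toffoli c d t =>
    simp only [toffoli_mulVec]
    exact Equiv.sum_comp (toffoliFun_involutive c d t).toPerm fun a => ‖ψ a‖ ^ 2

theorem runCircuit_norm (L : List (Gate W)) (ψ : (W → Bool) → ℂ) :
    ∑ a, ‖runCircuit L ψ a‖ ^ 2 = ∑ a, ‖ψ a‖ ^ 2 := by
  induction L generalizing ψ with
  | nil => simp
  | cons g L ih => rw [runCircuit_cons, ih, gate_norm]

/-! ### Running a circuit on a subset of the wires -/

theorem gate_map_mulVec {ι : W → V} (hι : Function.Injective ι) (g : Gate W)
    (ψ : (V → Bool) → ℂ) (b : V → Bool) (a : W → Bool) :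
    (g.map ι).mat.mulVec ψ (Function.extend ι a b) =
      g.mat.mulVec (fun a => ψ (Function.extend ι a b)) a := by
  cases g with
  | had i => simp only [Gate.map, had_mulVec, update_extend hι, hι.extend_apply]
  | tee i => simp only [Gate.map, tee_mulVec, hι.extend_apply]
  | cnot c t =>
    simp only [Gate.map, cnot_mulVec, cnotFun, hι.extend_apply, update_extend hι, hι.ne_iff]
    split_ifs <;> rfl
  | toffoli c d t =>
    simp only [Gate.map, toffoli_mulVec, toffoliFun, hι.extend_apply, update_extend hι, hι.ne_iff]
    split_ifs <;> rfl

theorem runCircuit_map_extend {ι : W → V} (hι : Function.Injective ι) (L : List (Gate W))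
    (ψ : (V → Bool) → ℂ) (b : V → Bool) (a : W → Bool) :
    runCircuit (L.map (Gate.map ι)) ψ (Function.extend ι a b) =
      runCircuit L (fun a => ψ (Function.extend ι a b)) a := by
  induction L generalizing ψ with
  | nil => simp
  | cons g L ih =>
    rw [List.map_cons, runCircuit_cons, ih, runCircuit_cons]
    congr 1
    funext a
    exact gate_map_mulVec hι g ψ b a

theorem runCircuit_map {ι : W → V} (hι : Function.Injective ι) (L : List (Gate W))
    (ψ : (V → Bool) → ℂ) (b : V → Bool) :
    runCircuit (L.map (Gate.map ι)) ψ b =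
      runCircuit L (fun a => ψ (Function.extend ι a b)) (b ∘ ι) := by
  conv_lhs => rw [← extend_comp_self ι b]
  exact runCircuit_map_extend hι L ψ b _

/-! ### Derived gates -/

theorem runCircuit_classical {α : Type} (l : List α) (G : α → List (Gate W))
    (f : α → (W → Bool) → W → Bool)
    (h : ∀ x ∈ l, ∀ ψ a, runCircuit (G x) ψ a = ψ (f x a)) (ψ : (W → Bool) → ℂ)
    (a : W → Bool) :
    runCircuit (l.flatMap G) ψ a = ψ (l.foldr f a) := by
  induction l generalizing ψ with
  | nil => simp
  | cons x l ih =>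
    rw [List.flatMap_cons, runCircuit_append,
      ih (fun y hy => h y (List.mem_cons_of_mem _ hy)), h x List.mem_cons_self, List.foldr_cons]

theorem runCircuit_phases {α : Type} (l : List α) (G : α → List (Gate W))
    (f : α → (W → Bool) → ℂ)
    (h : ∀ x ∈ l, ∀ ψ a, runCircuit (G x) ψ a = f x a * ψ a) (ψ : (W → Bool) → ℂ)
    (a : W → Bool) :
    runCircuit (l.flatMap G) ψ a = (l.map fun x => f x a).prod * ψ a := by
  induction l generalizing ψ with
  | nil => simp
  | cons x l ih =>
    rw [List.flatMap_cons, runCircuit_append,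
      ih (fun y hy => h y (List.mem_cons_of_mem _ hy)), h x List.mem_cons_self, List.map_cons,
      List.prod_cons]
    ring

/-- The Pauli `Z` gate. -/
def zGate (i : W) : List (Gate W) := List.replicate 4 (.tee i)

/-- The Pauli `X` gate. -/
def xGate (i : W) : List (Gate W) := .had i :: (zGate i ++ [.had i])

theorem runCircuit_zGate (i : W) (ψ : (W → Bool) → ℂ) (a : W → Bool) :
    runCircuit (zGate i) ψ a = (if a i = true then -1 else 1) * ψ a := by
  have h : Complex.exp (Complex.I * Real.pi / 4) ^ 4 = -1 := by
    rw [← Complex.exp_nat_mul]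
    rw [← Complex.exp_pi_mul_I]
    congr 1
    push_cast
    ring
  simp only [zGate, List.replicate, runCircuit_cons, runCircuit_nil, tee_mulVec]
  split_ifs
  · rw [← h]; ring
  · ring

theorem sqrt_two_sq : (Real.sqrt 2 : ℂ) * (Real.sqrt 2 : ℂ) = 2 := by
  rw [← Complex.ofReal_mul, Real.mul_self_sqrt (by norm_num)]
  norm_num

theorem runCircuit_had_conj {G : List (Gate W)} {i : W} {p : (W → Bool) → Bool}
    (hp : ∀ a x, p (Function.update a i x) = p a)
    (h : ∀ ψ a, runCircuit G ψ a = (if p a = true ∧ a i = true then -1 else 1) * ψ a)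
    (ψ : (W → Bool) → ℂ) (a : W → Bool) :
    runCircuit (.had i :: (G ++ [.had i])) ψ a =
      ψ (if p a = true then Function.update a i (!(a i)) else a) := by
  have h2 : (Real.sqrt 2 : ℂ) ≠ 0 := fun h0 => by simpa [h0] using sqrt_two_sq
  rw [runCircuit_cons, runCircuit_append, runCircuit_cons, runCircuit_nil, had_mulVec, h, h,
    had_mulVec, had_mulVec]
  simp only [Function.update_idem, Function.update_self, hp]
  have e : ∀ x : Bool, a i = x → Function.update a i x = a := fun x hx =>
    Function.update_eq_self_iff.2 hx.symm
  cases hpa : p a <;> cases ha : a i <;> simp [e _ ha] <;> field_simp <;>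
    simp only [pow_two, sqrt_two_sq] <;> ring

theorem runCircuit_xGate (i : W) (ψ : (W → Bool) → ℂ) (a : W → Bool) :
    runCircuit (xGate i) ψ a = ψ (Function.update a i (!(a i))) := by
  have := runCircuit_had_conj (G := zGate i) (i := i) (p := fun _ => true) (fun _ _ => rfl)
    (fun ψ a => by simp [runCircuit_zGate]) ψ a
  simpa [xGate] using this

/-- A Toffoli gate conjugated by Hadamard gates is a doubly controlled `Z`. -/
theorem runCircuit_ccz {c d t : W} (hc : c ≠ t) (hd : d ≠ t) (ψ : (W → Bool) → ℂ)
    (a : W → Bool) :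
    runCircuit [.had t, .toffoli c d t, .had t] ψ a =
      (if a c = true ∧ a d = true ∧ a t = true then -1 else 1) * ψ a := by
  have h2 : (Real.sqrt 2 : ℂ) ≠ 0 := fun h0 => by simpa [h0] using sqrt_two_sq
  have e : ∀ x : Bool, a t = x → Function.update a t x = a := fun x hx =>
    Function.update_eq_self_iff.2 hx.symm
  simp only [runCircuit_cons, runCircuit_nil, had_mulVec, toffoli_mulVec, toffoliFun,
    Function.update_idem, Function.update_self, Function.update_of_ne hc,
    Function.update_of_ne hd]
  cases hac : a c <;> cases had : a d <;> cases hat : a t <;>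
    simp [hc, hd, e _ hat] <;> field_simp <;> simp only [pow_two, sqrt_two_sq] <;> ring

theorem runCircuit_swap (i j : W) (ψ : (W → Bool) → ℂ) (a : W → Bool) :
    runCircuit [.cnot i j, .cnot j i, .cnot i j] ψ a = ψ (a ∘ Equiv.swap i j) := by
  simp only [runCircuit_cons, runCircuit_nil, cnot_mulVec]
  congr 1
  by_cases hij : i = j
  · subst hij
    simp [cnotFun]
  funext w
  simp only [Function.comp, cnotFun_of_ne hij, cnotFun_of_ne (Ne.symm hij)]
  by_cases hi : w = i
  · subst hi
    cases h1 : a w <;> cases h2 : a j <;> simp [hij, Ne.symm hij, h1, h2]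
  · by_cases hj : w = j
    · subst hj
      simp [hij, Ne.symm hij]
    · rw [Equiv.swap_apply_of_ne_of_ne hi hj]
      simp [hi, hj]

end Circuits

/-! ### The PRFS generator -/

/-- Bit `i` of a string, `false` beyond its end. -/
def bitAt {n : ℕ} (x : Fin n → Bool) (i : ℕ) : Bool := if h : i < n then x ⟨i, h⟩ else false

theorem bitAt_of_lt {n : ℕ} (x : Fin n → Bool) {i : ℕ} (h : i < n) : bitAt x i = x ⟨i, h⟩ :=
  dif_pos h

/-- Numbers as wires. -/
def toWire {N : ℕ} (hN : 0 < N) (i : ℕ) : Fin N := if h : i < N then ⟨i, h⟩ else ⟨0, hN⟩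

theorem toWire_of_lt {N : ℕ} (hN : 0 < N) {i : ℕ} (h : i < N) : toWire hN i = ⟨i, h⟩ := dif_pos h

theorem toWire_val {N : ℕ} (hN : 0 < N) {i : ℕ} (h : i < N) : (toWire hN i : ℕ) = i := by
  rw [toWire_of_lt hN h]

theorem gate_map_toWire {N : ℕ} (hN : 0 < N) {g : Gate ℕ} (h : g.top < N) :
    (g.map (toWire hN)).map Fin.val = g := by
  cases g <;> simp only [Gate.top, max_lt_iff] at h <;> simp only [Gate.map] <;>
    simp [toWire_val, h]

theorem gate_map_val_top {N : ℕ} (g : Gate (Fin N)) : (g.map Fin.val).top < N := by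
  cases g <;> simp [Gate.map, Gate.top]

theorem gate_map_map {W V U : Type} (f : W → V) (f' : V → U) (g : Gate W) :
    (g.map f).map f' = g.map (f' ∘ f) := by
  cases g <;> rfl

theorem gate_map_top {f : ℕ → ℕ} (hf : Monotone f) (g : Gate ℕ) : (g.map f).top = f g.top := by
  cases g <;> simp [Gate.map, Gate.top, hf.map_max]

theorem prfsGates_top {lam m n N : ℕ} {L : List (Gate ℕ)} (hL : ∀ g ∈ L, 2 * lam + m + g.top < N)
    (hlam : lam ≤ n) (hN : 2 * lam + m + n ≤ N) : ∀ g ∈ prfsGates lam m n L, g.top < N := by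
  intro g hg
  simp only [prfsGates, List.mem_append, List.mem_map, List.mem_range, List.mem_flatMap,
    List.mem_cons, List.not_mem_nil, or_false] at hg
  rcases hg with ⟨i, hi, rfl⟩ | ⟨g, hg, rfl⟩ | ⟨t, ht, rfl | rfl | rfl⟩ |
    ⟨i, hi, rfl | rfl | rfl⟩
  · simp only [Gate.top]; omega
  · rw [gate_map_top (fun a b h => Nat.add_le_add_left h _)]
    exact hL g hg
  · simp only [Gate.top]; omega
  · have := Nat.mod_le t m
    simp only [Gate.top]; omega
  all_goals simp only [Gate.top]; omega

section

variable {n : ℕ → ℕ} (G : StateGen (fun lam => lam) (fun _ => 0) n) (m : ℕ → ℕ)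
  (hn : ∀ lam, lam < n lam)

/-- The PRFS generator built from the PRS generator `G`. -/
def prfsGen : StateGen (fun lam => 2 * lam) m n where
  junk lam := 2 * lam + m lam + G.junk lam
  gates lam := (prfsGates lam (m lam) (n lam) ((G.gates lam).map (Gate.map Fin.val))).map
    (Gate.map (toWire (Nat.add_pos_left (Nat.zero_lt_of_lt (hn lam)) _)))
  fits lam := by omega

theorem prfsGen_gates_val (lam : ℕ) :
    ((prfsGen G m hn).gates lam).map (Gate.map Fin.val) =
      prfsGates lam (m lam) (n lam) ((G.gates lam).map (Gate.map Fin.val)) := by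
  simp only [prfsGen, List.map_map]
  refine (List.map_congr_left fun g hg => ?_).trans (List.map_id _)
  refine gate_map_toWire _ (prfsGates_top (fun g hg => ?_) (hn lam).le (by omega) g hg)
  obtain ⟨g, -, rfl⟩ := List.mem_map.1 hg
  have := gate_map_val_top g
  omega

theorem prfsGen_isQPT (hG : G.IsQPT) (hm : ∀ lam, 0 < lam → 0 < m lam)
    (hm' : ∀ lam, m lam ≤ lam + 1) : (prfsGen G m hn).IsQPT := by
  obtain ⟨P, p, h⟩ := hG
  let q : Polynomial ℕ := 3 * .X + 3 * (.X + 1) + 11 + (6 * .X + 5 +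
    (p * (9 * (2 * .X + (.X + 1)) + 10) + (14 * .X + 7 + (8 * (.X + p) + 5 +
    (3 * (2 * .X + (.X + 1)) + 2)))))
  refine ⟨prfsProg (P.top + 2) P, q, fun lam => ?_⟩
  obtain ⟨s, T, hr, hT, hout, h0, h1⟩ := h lam
  obtain ⟨s', T', hr', hT', hout', h0', h1'⟩ :=
    prfsProg_halts (V := P.top + 2) (hm lam) (by omega) (by omega) hr
  refine ⟨s', T', hr', hT'.trans ?_, ?_, h0'.trans h0, ?_⟩
  · simp only [q, Polynomial.eval_add, Polynomial.eval_mul, Polynomial.eval_X,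
      Polynomial.eval_ofNat, Polynomial.eval_one]
    have := hm' lam
    gcongr
  · rw [hout', h0, hout, prfsGen_gates_val]
  · rw [h1', h1]; rfl

end

/-! ### Partial traces -/

/-- The reduced density matrix of the wires `j`. -/
def partialTrace {n : ℕ} {W : Type} [Fintype W] [DecidableEq W] (j : Fin n → W)
    (Ψ : (W → Bool) → ℂ) (u v : Fin n → Bool) : ℂ :=
  ∑ b : W → Bool, if b ∘ j = u then Ψ b * star (Ψ (Function.extend j v b)) else 0

theorem extend_castAdd {n J : ℕ} (u v : Fin n → Bool) (g : Fin J → Bool) :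
    Function.extend (Fin.castAdd J) v (Fin.append u g) = Fin.append v g := by
  funext w
  refine Fin.addCases (fun i => ?_) (fun i => ?_) w
  · rw [(Fin.castAdd_injective n J).extend_apply, Fin.append_left]
  · rw [Function.extend_apply', Fin.append_right, Fin.append_right]
    rintro ⟨a, ha⟩
    have := congrArg Fin.val ha
    simp at this
    omega

theorem sum_append_eq_partialTrace {n J : ℕ} (Ψ : (Fin (n + J) → Bool) → ℂ)
    (u v : Fin n → Bool) :
    ∑ g : Fin J → Bool, Ψ (Fin.append u g) * star (Ψ (Fin.append v g)) =
      partialTrace (Fin.castAdd J) Ψ u v := by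
  refine Fintype.sum_of_injective (fun g : Fin J → Bool => Fin.append u g) ?_ _ _ ?_ ?_
  · intro g g' h
    funext i
    simpa using congrFun h (Fin.natAdd n i)
  · intro b hb
    rw [if_neg]
    rintro rfl
    refine hb ⟨b ∘ Fin.natAdd n, ?_⟩
    funext w
    refine Fin.addCases (fun i => ?_) (fun i => ?_) w <;> simp
  · intro g
    rw [if_pos (by funext i; simp), extend_castAdd]

theorem partialTrace_comp {n : ℕ} {W : Type} [Fintype W] [DecidableEq W] (j : Fin n → W)
    (hj : Function.Injective j) (e : Equiv.Perm W) (Ψ : (W → Bool) → ℂ) (u v : Fin n → Bool) :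
    partialTrace (e ∘ j) (fun b => Ψ (b ∘ e)) u v = partialTrace j Ψ u v := by
  refine Fintype.sum_equiv (Equiv.arrowCongr e.symm (Equiv.refl Bool)) _ _ fun b => ?_
  have h1 : (Equiv.arrowCongr e.symm (Equiv.refl Bool)) b = b ∘ e := by
    funext w; simp
  have h2 : Function.extend (e ∘ j) v b ∘ e = Function.extend j v (b ∘ e) := by
    funext w
    by_cases hw : ∃ i, j i = w
    · obtain ⟨i, rfl⟩ := hw
      rw [hj.extend_apply]
      exact (e.injective.comp hj).extend_apply v b i
    · rw [Function.extend_apply' _ _ _ hw, Function.comp, Function.extend_apply']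
      · rfl
      · rintro ⟨i, hi⟩
        exact hw ⟨i, e.injective hi⟩
  rw [h1]
  simp only [h2]
  rfl

/-- If the wires outside of the range of `ι` are in a basis state and those inside in the state
`s * Φ`, where the sign `s` depends on the wires `j` only, then the reduced density matrix is that
of `Φ` up to signs. -/
theorem partialTrace_of_embedding {n : ℕ} {W V : Type} [Fintype W] [DecidableEq W] [Fintype V]
    [DecidableEq V] (j : Fin n → V) (hj : Function.Injective j) (ι : V → W)
    (hι : Function.Injective ι) (b₀ : W → Bool) (s : (Fin n → Bool) → ℂ) (Φ : (V → Bool) → ℂ)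
    (Ψ : (W → Bool) → ℂ) (h0 : ∀ b, Function.extend ι (b ∘ ι) b₀ ≠ b → Ψ b = 0)
    (h1 : ∀ d, Ψ (Function.extend ι d b₀) = s (d ∘ j) * Φ d) (u v : Fin n → Bool) :
    partialTrace (ι ∘ j) Ψ u v = s u * star (s v) * partialTrace j Φ u v := by
  rw [partialTrace, partialTrace, Finset.mul_sum]
  symm
  have hcomp : ∀ d, Function.extend ι d b₀ ∘ ι = d := fun d => by
    funext i; exact hι.extend_apply d b₀ i
  refine Fintype.sum_of_injective (fun d : V → Bool => Function.extend ι d b₀) ?_ _ _ ?_ ?_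
  · intro d d' h
    rw [← hcomp d, ← hcomp d']
    exact congrArg (· ∘ ι) h
  · intro b hb
    rw [h0 b (fun h => hb ⟨_, h⟩), zero_mul, ite_self]
  · intro d
    have e1 : Function.extend (ι ∘ j) v (Function.extend ι d b₀) =
        Function.extend ι (Function.extend j v d) b₀ := by
      funext w
      by_cases hw : ∃ i, ι i = w
      · obtain ⟨w, rfl⟩ := hw
        rw [hι.extend_apply]
        by_cases hw : ∃ i, j i = w
        · obtain ⟨i, rfl⟩ := hw
          rw [hj.extend_apply]
          exact (hι.comp hj).extend_apply v _ i
        · rw [Function.extend_apply' _ _ _ hw, Function.extend_apply', hι.extend_apply]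
          rintro ⟨i, hi⟩
          exact hw ⟨i, hι hi⟩
      · rw [Function.extend_apply' _ _ _ hw, Function.extend_apply',
          Function.extend_apply' _ _ _ hw]
        rintro ⟨i, hi⟩
        exact hw ⟨j i, hi⟩
    have e2 : Function.extend j v d ∘ j = v := by
      funext i; exact hj.extend_apply v d i
    rw [← Function.comp_assoc, hcomp]
    by_cases hd : d ∘ j = u
    · rw [if_pos hd, if_pos hd, e1, h1, h1, e2, hd, star_mul']
      ring
    · rw [if_neg hd, if_neg hd, mul_zero]

/-! ### The output of the PRFS generator -/

/-- The sign that the PRFS generator gives to the basis state `u`, for the second half `k` of the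
key and the input `x`. -/
def phaseSign (lam : ℕ) {a m n : ℕ} (k : Fin a → Bool) (x : Fin m → Bool) (u : Fin n → Bool) : ℂ :=
  ∏ t ∈ Finset.range lam,
    if bitAt k t = true ∧ bitAt x (t % m) = true ∧ bitAt u t = true then -1 else 1

/-- The first half of the key. -/
def keyFst {lam : ℕ} (k : Fin (2 * lam) → Bool) : Fin lam → Bool :=
  fun i => k ⟨i, by omega⟩

/-- The second half of the key. -/
def keySnd {lam : ℕ} (k : Fin (2 * lam) → Bool) : Fin lam → Bool :=
  fun i => k ⟨lam + i, by omega⟩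

theorem StateGen.start_apply {κ m n : ℕ → ℕ} (G : StateGen κ m n) (lam : ℕ)
    (k : Fin (κ lam) → Bool) (x : Fin (m lam) → Bool) (i : Fin (n lam + G.junk lam)) :
    G.start lam k x i = if (i : ℕ) < κ lam then bitAt k i else bitAt x (i - κ lam) := by
  simp only [StateGen.start, bitAt]
  by_cases h : (i : ℕ) < κ lam
  · have : (⟨i, by omega⟩ : Fin (κ lam + m lam)) = Fin.castAdd _ ⟨i, h⟩ := rfl
    rw [dif_pos (by omega), if_pos h, dif_pos h, this, Fin.append_left]
  · rw [if_neg h]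
    by_cases h' : (i : ℕ) < κ lam + m lam
    · have : (⟨i, h'⟩ : Fin (κ lam + m lam)) = Fin.natAdd _ ⟨i - κ lam, by omega⟩ := by
        ext; simp; omega
      rw [dif_pos h', dif_pos (by omega), this, Fin.append_right]
    · rw [dif_neg h', dif_neg (by omega)]

section

variable {N : ℕ} (hN : 0 < N)

theorem foldr_copy {S lam : ℕ} (hlam : lam ≤ S) (hS : S + lam ≤ N) (r : ℕ) (hr : r ≤ lam)
    (a : Fin N → Bool) (w : Fin N) :
    (List.range r).foldr (fun i => cnotFun (toWire hN i) (toWire hN (S + i))) a w =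
      if S ≤ w ∧ (w : ℕ) < S + r then (bitAt a (w - S) ^^ a w) else a w := by
  induction r generalizing a with
  | zero =>
    rw [if_neg (by omega)]
    rfl
  | succ r ih =>
    rw [List.range_succ, List.foldr_append, List.foldr_cons, List.foldr_nil, ih (by omega)]
    have hne : toWire hN r ≠ toWire hN (S + r) := fun h => by
      have := congrArg Fin.val h
      rw [toWire_val _ (by omega), toWire_val _ (by omega)] at this
      omega
    rw [cnotFun_of_ne hne]
    rw [toWire_of_lt hN (show r < N by omega), toWire_of_lt hN (show S + r < N by omega)]
    have hlow : ∀ i < S, bitAt (Function.update a ⟨S + r, by omega⟩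
        (a ⟨r, by omega⟩ ^^ a ⟨S + r, by omega⟩)) i = bitAt a i := by
      intro i hi
      simp only [bitAt]
      split_ifs
      · rw [Function.update_of_ne]
        intro h
        simp only [Fin.mk.injEq] at h
        omega
      · rfl
    by_cases hw : (w : ℕ) = S + r
    · have hw' : w = ⟨S + r, by omega⟩ := Fin.ext hw
      rw [if_neg (by omega), if_pos (by omega), hw', Function.update_self]
      simp only [Nat.add_sub_cancel_left]
      rw [bitAt_of_lt a (show r < N by omega)]
    · have hw' : w ≠ ⟨S + r, by omega⟩ := fun h => hw (congrArg Fin.val h)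
      rw [Function.update_of_ne hw']
      by_cases h : S ≤ (w : ℕ) ∧ (w : ℕ) < S + r
      · rw [if_pos h, if_pos (by omega), hlow _ (by omega)]
      · rw [if_neg h, if_neg (by omega)]

theorem foldr_swap {S n : ℕ} (hS : S + n ≤ N) (r : ℕ) (hr : r ≤ n) :
    ∃ e : Equiv.Perm (Fin N),
      (∀ b : Fin N → Bool, (List.range r).foldr
        (fun i b => b ∘ Equiv.swap (toWire hN i) (toWire hN (S + i))) b = b ∘ e) ∧
      (∀ i, i < r → e (toWire hN (S + i)) = toWire hN i) ∧
      ∀ w : Fin N, S + r ≤ w → e w = w := by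
  induction r with
  | zero => exact ⟨1, fun b => rfl, fun i hi => absurd hi (by omega), fun w _ => rfl⟩
  | succ r ih =>
    obtain ⟨e, h1, h2, h3⟩ := ih (by omega)
    have hinj : ∀ {i j : ℕ}, i < N → j < N → i ≠ j → toWire hN i ≠ toWire hN j := by
      intro i j hi hj hij h
      have := congrArg Fin.val h
      rw [toWire_val _ hi, toWire_val _ hj] at this
      exact hij this
    refine ⟨Equiv.swap (toWire hN r) (toWire hN (S + r)) * e, fun b => ?_, fun i hi => ?_,
      fun w hw => ?_⟩
    · rw [List.range_succ, List.foldr_append, List.foldr_cons, List.foldr_nil, h1]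
      rfl
    · rw [Equiv.Perm.mul_apply]
      by_cases hir : i = r
      · subst hir
        rw [h3 _ (by rw [toWire_val _ (by omega)]), Equiv.swap_apply_right]
      · rw [h2 i (by omega), Equiv.swap_apply_of_ne_of_ne]
        · exact hinj (by omega) (by omega) hir
        · exact hinj (by omega) (by omega) (by omega)
    · rw [Equiv.Perm.mul_apply, h3 w (by omega), Equiv.swap_apply_of_ne_of_ne]
      · intro h
        have := congrArg Fin.val h
        rw [toWire_val _ (by omega)] at this
        omega
      · intro h
        have := congrArg Fin.val h
        rw [toWire_val _ (by omega)] at this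
        omega

/-- The state after the copying gates and a circuit `L` on the wires `S + i`. -/
theorem runCircuit_copy_circuit {S lam M : ℕ} (hlam : lam ≤ S) (hM : lam ≤ M) (hNS : S + M = N)
    (b₀ : Fin N → Bool) (hb₀ : ∀ w : Fin N, S ≤ w → b₀ w = false) (d₀ : Fin M → Bool)
    (hd₀ : ∀ i : Fin M, d₀ i = if (i : ℕ) < lam then bitAt b₀ i else false)
    (L : List (Gate (Fin M))) (ι : Fin M → Fin N) (hι : ∀ i, (ι i : ℕ) = S + i)
    (b : Fin N → Bool) :
    runCircuit (L.map (Gate.map ι)) (runCircuit ((List.range lam).flatMap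
        fun i => [.cnot (toWire hN i) (toWire hN (S + i))]) (Pi.single b₀ 1)) b =
      if Function.extend ι (b ∘ ι) b₀ = b then circuitMat L (b ∘ ι) d₀ else 0 := by
  have hinj : Function.Injective ι := fun i j h => by
    have := congrArg Fin.val h
    rw [hι, hι] at this
    exact Fin.ext (by omega)
  have hrange : ∀ w : Fin N, S ≤ (w : ℕ) → ∃ i, ι i = w := fun w hw =>
    ⟨⟨w - S, by omega⟩, Fin.ext (by rw [hι]; simp; omega)⟩
  have hlow : ∀ w : Fin N, (w : ℕ) < S → ¬∃ i, ι i = w := by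
    rintro w hw ⟨i, rfl⟩
    rw [hι] at hw
    omega
  have hagree : Function.extend ι (b ∘ ι) b₀ = b ↔ ∀ w : Fin N, (w : ℕ) < S → b w = b₀ w := by
    constructor
    · intro h w hw
      rw [← h, Function.extend_apply' _ _ _ (hlow w hw)]
    · intro h
      funext w
      by_cases hw : (w : ℕ) < S
      · rw [Function.extend_apply' _ _ _ (hlow w hw), h w hw]
      · obtain ⟨i, rfl⟩ := hrange w (by omega)
        exact hinj.extend_apply _ _ _
  rw [runCircuit_map hinj]
  have hslice : (fun a => runCircuit ((List.range lam).flatMap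
        fun i => [.cnot (toWire hN i) (toWire hN (S + i))]) (Pi.single b₀ 1)
        (Function.extend ι a b)) =
      if Function.extend ι (b ∘ ι) b₀ = b then Pi.single d₀ 1 else 0 := by
    funext a
    rw [runCircuit_classical _ _ (fun i => cnotFun (toWire hN i) (toWire hN (S + i)))
      (fun i _ ψ a => by rw [runCircuit_cons, runCircuit_nil, cnot_mulVec])]
    have hfold := foldr_copy hN hlam (by omega) lam le_rfl (Function.extend ι a b)
    set F := (List.range lam).foldr (fun i => cnotFun (toWire hN i) (toWire hN (S + i)))
      (Function.extend ι a b)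
    have hF1 : ∀ w : Fin N, (w : ℕ) < S → F w = b w := fun w hw => by
      rw [hfold, if_neg (by omega), Function.extend_apply' _ _ _ (hlow w hw)]
    have hF2 : ∀ i : Fin M, F (ι i) = if (i : ℕ) < lam then (bitAt b i ^^ a i) else a i := by
      intro i
      rw [hfold, hinj.extend_apply, hι]
      by_cases hi : (i : ℕ) < lam
      · rw [if_pos (by omega), if_pos hi, Nat.add_sub_cancel_left]
        simp only [bitAt]
        rw [dif_pos (by omega), dif_pos (by omega),
          Function.extend_apply' _ _ _ (hlow _ (by simp; omega))]
      · rw [if_neg (by omega), if_neg hi]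
    have key : F = b₀ ↔ (∀ w : Fin N, (w : ℕ) < S → b w = b₀ w) ∧ a = d₀ := by
      constructor
      · intro h
        have h1 : ∀ w : Fin N, (w : ℕ) < S → b w = b₀ w := fun w hw => by
          rw [← hF1 w hw, h]
        refine ⟨h1, funext fun i => ?_⟩
        have h2 := hF2 i
        rw [h, hb₀ _ (by rw [hι]; omega)] at h2
        rw [hd₀]
        by_cases hi : (i : ℕ) < lam
        · rw [if_pos hi] at h2 ⊢
          have h3 : bitAt b i = bitAt b₀ i := by
            simp only [bitAt]
            rw [dif_pos (by omega), dif_pos (by omega), h1 _ (by simp; omega)]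
          rw [← h3]
          revert h2
          cases bitAt b i <;> cases a i <;> simp
        · rw [if_neg hi] at h2 ⊢
          exact h2.symm
      · rintro ⟨h1, rfl⟩
        funext w
        by_cases hw : (w : ℕ) < S
        · rw [hF1 w hw, h1 w hw]
        · obtain ⟨i, rfl⟩ := hrange w (by omega)
          rw [hF2, hb₀ _ (by omega), hd₀]
          by_cases hi : (i : ℕ) < lam
          · have h3 : bitAt b i = bitAt b₀ i := by
              simp only [bitAt]
              rw [dif_pos (by omega), dif_pos (by omega), h1 _ (by simp; omega)]
            rw [if_pos hi, if_pos hi, h3, Bool.xor_self]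
          · rw [if_neg hi, if_neg hi]
    rw [Pi.single_apply]
    by_cases h : ∀ w : Fin N, (w : ℕ) < S → b w = b₀ w
    · rw [if_pos (hagree.2 h), Pi.single_apply]
      exact if_congr (key.trans (and_iff_right h)) rfl rfl
    · rw [if_neg (fun h' => h (hagree.1 h')), if_neg (fun h' => h (key.1 h').1)]
      rfl
  rw [hslice]
  by_cases h : Function.extend ι (b ∘ ι) b₀ = b
  · rw [if_pos h, if_pos h, circuitMat_apply]
  · rw [if_neg h, if_neg h, runCircuit, Matrix.mulVec_zero]
    rfl

end

theorem prfsGates_partialTrace {lam m n J : ℕ} (hlam : lam < n) (hm : 0 < lam → 0 < m)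
    (hN : 0 < n + (2 * lam + m + J)) (L : List (Gate (Fin (n + J))))
    (b₀ : Fin (n + (2 * lam + m + J)) → Bool) (k : Fin (2 * lam) → Bool) (x : Fin m → Bool)
    (hb₀ : ∀ w, b₀ w = if (w : ℕ) < 2 * lam then bitAt k w else bitAt x (w - 2 * lam))
    (d₀ : Fin (n + J) → Bool)
    (hd₀ : ∀ i, d₀ i = if (i : ℕ) < lam then bitAt (keyFst k) i else false)
    (u v : Fin n → Bool) :
    partialTrace (Fin.castAdd (2 * lam + m + J)) (fun b => circuitMat
        ((prfsGates lam m n (L.map (Gate.map Fin.val))).map (Gate.map (toWire hN))) b b₀) u v =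
      phaseSign lam (keySnd k) x u * star (phaseSign lam (keySnd k) x v) *
        partialTrace (Fin.castAdd J) (fun d => circuitMat L d d₀) u v := by
  obtain ⟨S, hS⟩ : ∃ S, S = 2 * lam + m := ⟨_, rfl⟩
  let ι : Fin (n + J) → Fin (n + (2 * lam + m + J)) := fun i => ⟨S + i, by omega⟩
  have hι : ∀ i, (ι i : ℕ) = S + i := fun i => rfl
  obtain ⟨e, he1, he2, -⟩ := foldr_swap hN (S := S) (n := n) (by omega) n le_rfl
  let Ψ : (Fin (n + (2 * lam + m + J)) → Bool) → ℂ := fun b =>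
    ((List.range lam).map fun t => if b (toWire hN (lam + t)) = true ∧
      b (toWire hN (2 * lam + t % m)) = true ∧ b (toWire hN (S + t)) = true
      then (-1 : ℂ) else 1).prod *
    if Function.extend ι (b ∘ ι) b₀ = b then circuitMat L (b ∘ ι) d₀ else 0
  have hg : (prfsGates lam m n (L.map (Gate.map Fin.val))).map (Gate.map (toWire hN)) =
      ((List.range lam).flatMap fun i => [.cnot (toWire hN i) (toWire hN (S + i))]) ++
      (L.map (Gate.map ι) ++
      (((List.range lam).flatMap fun t => [.had (toWire hN (S + t)),
        .toffoli (toWire hN (lam + t)) (toWire hN (2 * lam + t % m)) (toWire hN (S + t)),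
        .had (toWire hN (S + t))]) ++
      ((List.range n).flatMap fun i => [.cnot (toWire hN i) (toWire hN (S + i)),
        .cnot (toWire hN (S + i)) (toWire hN i), .cnot (toWire hN i) (toWire hN (S + i))]))) := by
    simp only [prfsGates, List.map_append, List.map_map, List.map_flatMap, List.map_cons,
      List.map_nil, Gate.map, ← hS]
    congr 1
    · generalize List.range lam = l
      induction l with
      | nil => rfl
      | cons a l ih => rw [List.map_cons, List.flatMap_cons, ih]; rfl
    · congr 1
      refine List.map_congr_left fun g _ => ?_
      simp only [Function.comp, gate_map_map]
      congr 1
      funext i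
      exact toWire_of_lt hN (by simp only [Function.comp]; omega)
  have hfinal : (fun b => circuitMat ((prfsGates lam m n (L.map (Gate.map Fin.val))).map
      (Gate.map (toWire hN))) b b₀) = fun b => Ψ (b ∘ e) := by
    funext b
    rw [circuitMat_apply, hg, runCircuit_append, runCircuit_append, runCircuit_append,
      runCircuit_classical _ _
        (fun i b => b ∘ Equiv.swap (toWire hN i) (toWire hN (S + i)))
        (fun i _ ψ a => runCircuit_swap _ _ ψ a), he1,
      runCircuit_phases _ _ (fun t b => if b (toWire hN (lam + t)) = true ∧
        b (toWire hN (2 * lam + t % m)) = true ∧ b (toWire hN (S + t)) = true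
        then (-1 : ℂ) else 1) ?_,
      runCircuit_copy_circuit hN (by omega) (by omega) (by omega) b₀ ?_ d₀ ?_ _ ι hι]
    · intro w hw
      rw [hb₀, if_neg (by omega), bitAt, dif_neg (by omega)]
    · intro i
      rw [hd₀]
      by_cases hi : (i : ℕ) < lam
      · rw [if_pos hi, if_pos hi]
        simp only [bitAt]
        rw [dif_pos hi, dif_pos (by omega), hb₀, if_pos (by simp; omega),
          bitAt_of_lt _ (by simp; omega)]
        rfl
      · rw [if_neg hi, if_neg hi]
    · intro t ht ψ a
      have ht := List.mem_range.1 ht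
      have hmod := Nat.mod_lt t (hm (by omega))
      apply runCircuit_ccz
      · intro h
        have := congrArg Fin.val h
        rw [toWire_val _ (by omega), toWire_val _ (by omega)] at this
        omega
      · intro h
        have := congrArg Fin.val h
        rw [toWire_val _ (by omega), toWire_val _ (by omega)] at this
        omega
  have hinj : Function.Injective ι := fun i j h => by
    have := congrArg Fin.val h
    rw [hι, hι] at this
    exact Fin.ext (by omega)
  have hcast : Fin.castAdd (2 * lam + m + J) = e ∘ (ι ∘ Fin.castAdd J : Fin n → _) := by
    funext i
    have h1 : ι (Fin.castAdd J i) = toWire hN (S + i) :=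
      (toWire_of_lt hN (by omega)).symm
    rw [Function.comp, Function.comp, h1, he2 i i.2, toWire_of_lt hN (by omega)]
    rfl
  rw [hfinal, hcast, partialTrace_comp _ (hinj.comp (Fin.castAdd_injective _ _))]
  refine partialTrace_of_embedding (Fin.castAdd J) (Fin.castAdd_injective _ _) ι hinj
    b₀ (phaseSign lam (keySnd k) x) _ Ψ (fun b hb => ?_) (fun d => ?_) u v
  · simp only [Ψ]
    rw [if_neg hb, mul_zero]
  · have hcomp : Function.extend ι d b₀ ∘ ι = d := by
      funext i; exact hinj.extend_apply d b₀ i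
    simp only [Ψ]
    rw [hcomp, if_pos rfl]
    congr 1
    rw [phaseSign, ← List.prod_toFinset _ (List.nodup_range), List.toFinset_range]
    refine Finset.prod_congr rfl fun t ht => ?_
    have ht := Finset.mem_range.1 ht
    have hmod := Nat.mod_lt t (hm (by omega))
    have hlow : ∀ i, (hi : i < S) → Function.extend ι d b₀ (toWire hN i) =
        if i < 2 * lam then bitAt k i else bitAt x (i - 2 * lam) := by
      intro i hi
      rw [Function.extend_apply', hb₀, toWire_val _ (by omega)]
      rintro ⟨j, hj⟩
      have := congrArg Fin.val hj
      rw [toWire_val _ (by omega), hι] at this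
      omega
    have h1 : toWire hN (S + t) = ι ⟨t, by omega⟩ := toWire_of_lt hN (by omega)
    rw [(hlow (lam + t) (by omega)).trans (if_pos (by omega)),
      (hlow (2 * lam + t % m) (by omega)).trans (if_neg (by omega)), h1, hinj.extend_apply, Nat.add_sub_cancel_left,
      bitAt_of_lt k (by omega : lam + t < 2 * lam), bitAt_of_lt (keySnd k) ht,
      bitAt_of_lt (d ∘ _) (by omega : t < n)]
    rfl

theorem phaseSign_norm {lam a m n : ℕ} (k : Fin a → Bool) (x : Fin m → Bool)
    (u : Fin n → Bool) : ‖phaseSign lam k x u‖ = 1 := by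
  rw [phaseSign, norm_prod]
  refine Finset.prod_eq_one fun t _ => ?_
  split_ifs <;> simp

/-- The state obtained from `φ` by applying the phases. -/
def PureState.phased (lam : ℕ) {a m n : ℕ} (k : Fin a → Bool) (x : Fin m → Bool)
    (φ : PureState n) : PureState n :=
  ⟨WithLp.toLp 2 fun u => phaseSign lam k x u * φ.1 u, by
    have h : ‖φ.1‖ = 1 := mem_sphere_zero_iff_norm.1 φ.2
    rw [mem_sphere_zero_iff_norm]
    refine Eq.trans ?_ h
    rw [EuclideanSpace.norm_eq, EuclideanSpace.norm_eq]
    simp [phaseSign_norm]⟩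

section

variable {n : ℕ → ℕ} (G : StateGen (fun lam => lam) (fun _ => 0) n) (m : ℕ → ℕ)
  (hn : ∀ lam, lam < n lam)

theorem prfsGen_output (hm : ∀ lam, 0 < lam → 0 < m lam) (lam : ℕ) (k : Fin (2 * lam) → Bool)
    (x : Fin (m lam) → Bool) (u v : Fin (n lam) → Bool) :
    (prfsGen G m hn).output lam k x u v =
      phaseSign lam (keySnd k) x u * star (phaseSign lam (keySnd k) x v) *
        G.output lam (keyFst k) Fin.elim0 u v := by
  rw [StateGen.output, StateGen.output, sum_append_eq_partialTrace, sum_append_eq_partialTrace]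
  refine prfsGates_partialTrace (hn lam) (hm lam) _ (G.gates lam) _ k x
    ((prfsGen G m hn).start_apply lam k x) (G.start lam (keyFst k) Fin.elim0) (fun i => ?_) u v
  rw [StateGen.start_apply]
  by_cases hi : (i : ℕ) < lam
  · rw [if_pos hi, if_pos hi]
  · rw [if_neg hi, if_neg hi]
    exact dif_neg (Nat.not_lt_zero _)

theorem prfsGen_output_density (hm : ∀ lam, 0 < lam → 0 < m lam) {lam : ℕ}
    {k : Fin (2 * lam) → Bool} {φ : PureState (n lam)}
    (hφ : G.output lam (keyFst k) Fin.elim0 = φ.density) (x : Fin (m lam) → Bool) :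
    (prfsGen G m hn).output lam k x = (φ.phased lam (keySnd k) x).density := by
  funext u v
  rw [prfsGen_output G m hn hm, hφ]
  simp only [PureState.density, PureState.phased, star_mul']
  ring

theorem prfsGen_isPure (hm : ∀ lam, 0 < lam → 0 < m lam) (hG : G.IsPure) :
    (prfsGen G m hn).IsPure := by
  intro lam k x
  obtain ⟨φ, hφ⟩ := hG lam (keyFst k) Fin.elim0
  exact ⟨_, prfsGen_output_density G m hn hm hφ x⟩

end

/-! ### Distinguishers on pure states -/

/-- `|Ψ⟩⟨Ψ|` -/
def outer {W : Type} (Ψ : (W → Bool) → ℂ) : Matrix (W → Bool) (W → Bool) ℂ :=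
  Matrix.vecMulVec Ψ (star Ψ)

/-- `Ψ ⊗ |0⟩` -/
def padVec {Q : Type} (a : ℕ) (Ψ : (Q → Bool) → ℂ) : (Q ⊕ Fin a → Bool) → ℂ :=
  fun u => if ∀ i, u (.inr i) = false then Ψ (fun q => u (.inl q)) else 0

/-- `|x₁, …, x_ℓ⟩ ⊗ Ψ` -/
def stringsVec {ℓ m : ℕ} {Q : Type} (x : Fin ℓ → Fin m → Bool) (Ψ : (Q → Bool) → ℂ) :
    ((Fin ℓ × Fin m) ⊕ Q → Bool) → ℂ :=
  fun u => if ∀ i j, u (.inl (i, j)) = x i j then Ψ (fun q => u (.inr q)) else 0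

/-- The tensor product of state vectors. -/
def tensorVec {ℓ n : ℕ} (φ : Fin ℓ → PureState n) : (Fin ℓ × Fin n → Bool) → ℂ :=
  fun u => ∏ i, (φ i).1 fun j => u (i, j)

theorem padZero_outer {Q : Type} (a : ℕ) (Ψ : (Q → Bool) → ℂ) :
    padZero a (outer Ψ) = outer (padVec a Ψ) := by
  funext u v
  simp only [padZero, outer, padVec, Matrix.vecMulVec_apply, Pi.star_apply]
  by_cases h : ∀ i, u (.inr i) = false <;> by_cases h' : ∀ i, v (.inr i) = false <;>
    simp [h, h']

theorem withStrings_outer {ℓ m : ℕ} {Q : Type} (x : Fin ℓ → Fin m → Bool) (Ψ : (Q → Bool) → ℂ) :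
    withStrings x (outer Ψ) = outer (stringsVec x Ψ) := by
  funext u v
  simp only [withStrings, outer, stringsVec, Matrix.vecMulVec_apply, Pi.star_apply]
  by_cases h : ∀ i j, u (.inl (i, j)) = x i j <;>
    by_cases h' : ∀ i j, v (.inl (i, j)) = x i j <;> simp [h, h']

theorem tensor_density {ℓ n : ℕ} (φ : Fin ℓ → PureState n) :
    tensor (fun i => (φ i).density) = outer (tensorVec φ) := by
  funext u v
  simp [tensor, outer, tensorVec, Matrix.vecMulVec_apply, PureState.density,
    Finset.prod_mul_distrib]

theorem Distinguisher.accept_outer {Q : Type} [Fintype Q] [DecidableEq Q] (A : Distinguisher Q)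
    (Ψ : (Q → Bool) → ℂ) :
    A.accept (outer Ψ) = ∑ b : Q ⊕ Fin A.anc → Bool,
      if b A.out = true then ‖runCircuit A.gates (padVec A.anc Ψ) b‖ ^ 2 else 0 := by
  rw [Distinguisher.accept, padZero_outer]
  refine Finset.sum_congr rfl fun b _ => ?_
  rw [outer, Matrix.mul_vecMulVec, Matrix.vecMulVec_mul, ← Matrix.star_mulVec,
    Matrix.vecMulVec_apply, Pi.star_apply]
  change (if _ then (runCircuit A.gates (padVec A.anc Ψ) b *
    star (runCircuit A.gates (padVec A.anc Ψ) b)).re else 0) = _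
  rw [Complex.star_def, Complex.mul_conj, Complex.ofReal_re, Complex.normSq_eq_norm_sq]

theorem padVec_norm {Q : Type} [Fintype Q] [DecidableEq Q] (a : ℕ) (Ψ : (Q → Bool) → ℂ) :
    ∑ u, ‖padVec a Ψ u‖ ^ 2 = ∑ u, ‖Ψ u‖ ^ 2 := by
  symm
  refine Fintype.sum_of_injective (fun u : Q → Bool => Sum.elim u fun _ : Fin a => false)
    (fun u u' h => funext fun q => congrFun h (.inl q)) _ _ (fun w hw => ?_) (fun u => ?_)
  · rw [padVec, if_neg, norm_zero, zero_pow two_ne_zero]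
    exact fun h => hw ⟨fun q => w (.inl q), funext fun i => by
      cases i with
      | inl q => rfl
      | inr i => exact (h i).symm⟩
  · simp [padVec]

theorem stringsVec_norm {ℓ m : ℕ} {Q : Type} [Fintype Q] [DecidableEq Q]
    (x : Fin ℓ → Fin m → Bool) (Ψ : (Q → Bool) → ℂ) :
    ∑ u, ‖stringsVec x Ψ u‖ ^ 2 = ∑ u, ‖Ψ u‖ ^ 2 := by
  symm
  refine Fintype.sum_of_injective
    (fun u : Q → Bool => Sum.elim (fun p : Fin ℓ × Fin m => x p.1 p.2) u)
    (fun u u' h => funext fun q => congrFun h (.inr q)) _ _ (fun w hw => ?_) (fun u => ?_)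
  · rw [stringsVec, if_neg, norm_zero, zero_pow two_ne_zero]
    exact fun h => hw ⟨fun q => w (.inr q), funext fun i => by
      cases i with
      | inl p => exact (h p.1 p.2).symm
      | inr q => rfl⟩
  · simp [stringsVec]

/-! ### From PRFS distinguishers to PRS distinguishers -/

section Reduction

variable {ℓ m n : ℕ}

/-- Flip the wires of the strings that hold a `1` in `x`. -/
def writeStrings (x : Fin ℓ → Fin m → Bool) (a : ℕ) :
    List (Gate (((Fin ℓ × Fin m) ⊕ (Fin ℓ × Fin n)) ⊕ Fin a)) :=
  (Finset.univ : Finset (Fin ℓ × Fin m)).toList.flatMap fun p =>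
    if x p.1 p.2 = true then xGate (.inl (.inl p)) else []

/-- Apply the phases of the PRFS generator. -/
def applyPhases {lam : ℕ} (h : lam ≤ n) (k : Fin lam → Bool) (x : Fin ℓ → Fin m → Bool) (a : ℕ) :
    List (Gate (((Fin ℓ × Fin m) ⊕ (Fin ℓ × Fin n)) ⊕ Fin a)) :=
  (Finset.univ : Finset (Fin ℓ × Fin lam)).toList.flatMap fun p =>
    if k p.2 = true ∧ bitAt (x p.1) (p.2 % m) = true then
      zGate (.inl (.inr (p.1, Fin.castLE h p.2))) else []

/-- The wires of the reduction. -/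
def reductionWires (ℓ m n a : ℕ) : ((Fin ℓ × Fin m) ⊕ (Fin ℓ × Fin n)) ⊕ Fin a ≃
    (Fin ℓ × Fin n) ⊕ Fin (ℓ * m + a) :=
  (((Equiv.sumComm _ _).sumCongr (Equiv.refl _)).trans (Equiv.sumAssoc _ _ _)).trans
    ((Equiv.refl _).sumCongr ((finProdFinEquiv.sumCongr (Equiv.refl _)).trans finSumFinEquiv))

/-- The PRS distinguisher that runs `A` on the strings `x` and its input with phases applied. -/
def reduction {lam : ℕ} (h : lam ≤ n) (k : Fin lam → Bool) (x : Fin ℓ → Fin m → Bool)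
    (A : Distinguisher ((Fin ℓ × Fin m) ⊕ (Fin ℓ × Fin n))) : Distinguisher (Fin ℓ × Fin n) where
  anc := ℓ * m + A.anc
  gates := (writeStrings x A.anc ++ (applyPhases h k x A.anc ++ A.gates)).map
    (Gate.map (reductionWires ℓ m n A.anc))
  out := reductionWires ℓ m n A.anc A.out

theorem runCircuit_writeStrings (x : Fin ℓ → Fin m → Bool) (a : ℕ)
    (ψ : (((Fin ℓ × Fin m) ⊕ (Fin ℓ × Fin n)) ⊕ Fin a → Bool) → ℂ)
    (b : ((Fin ℓ × Fin m) ⊕ (Fin ℓ × Fin n)) ⊕ Fin a → Bool) :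
    runCircuit (writeStrings x a) ψ b =
      ψ (Sum.elim (Sum.elim (fun p => b (.inl (.inl p)) ^^ x p.1 p.2) fun q => b (.inl (.inr q)))
        fun i => b (.inr i)) := by
  rw [writeStrings, runCircuit_classical _ _
    (fun p b => if x p.1 p.2 = true then Function.update b (.inl (.inl p)) (!(b (.inl (.inl p))))
      else b)]
  · congr 1
    suffices H : ∀ l : List (Fin ℓ × Fin m), l.Nodup →
        l.foldr (fun p b => if x p.1 p.2 = true then
          Function.update b (.inl (.inl p)) (!(b (.inl (.inl p)))) else b) b =
        Sum.elim (Sum.elim (fun p => if p ∈ l then (b (.inl (.inl p)) ^^ x p.1 p.2)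
          else b (.inl (.inl p))) fun q => b (.inl (.inr q))) fun i => b (.inr i) by
      rw [H _ (Finset.nodup_toList _)]
      simp
    intro l hl
    induction l with
    | nil =>
      funext w
      rcases w with (p | q) | i <;> simp
    | cons p l ih =>
      obtain ⟨hp, hl⟩ := List.nodup_cons.1 hl
      rw [List.foldr_cons, ih hl]
      funext w
      cases hx : x p.1 p.2
      · rcases w with (p' | q) | i
        · by_cases hp' : p' = p
          · subst hp'; simp [hp, hx]
          · simp [hp']
        · simp
        · simp
      · rcases w with (p' | q) | i
        · by_cases hp' : p' = p
          · subst hp'; simp [hp, hx]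
          · simp [hp']
        · simp
        · simp
  · intro p _ ψ b
    split_ifs
    · exact runCircuit_xGate _ _ _
    · rw [runCircuit_nil]

theorem runCircuit_applyPhases {lam : ℕ} (h : lam ≤ n) (k : Fin lam → Bool)
    (x : Fin ℓ → Fin m → Bool) (a : ℕ)
    (ψ : (((Fin ℓ × Fin m) ⊕ (Fin ℓ × Fin n)) ⊕ Fin a → Bool) → ℂ)
    (b : ((Fin ℓ × Fin m) ⊕ (Fin ℓ × Fin n)) ⊕ Fin a → Bool) :
    runCircuit (applyPhases h k x a) ψ b =
      (∏ i, phaseSign lam k (x i) fun t => b (.inl (.inr (i, t)))) * ψ b := by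
  rw [applyPhases, runCircuit_phases _ _ (fun p b => if k p.2 = true ∧
    bitAt (x p.1) (p.2 % m) = true ∧ b (.inl (.inr (p.1, Fin.castLE h p.2))) = true
    then (-1 : ℂ) else 1)]
  · rw [Finset.prod_map_toList, Fintype.prod_prod_type]
    congr 1
    refine Finset.prod_congr rfl fun i _ => ?_
    rw [phaseSign, Finset.prod_range]
    refine Finset.prod_congr rfl fun t _ => ?_
    rw [bitAt_of_lt k t.2, bitAt_of_lt _ (t.2.trans_le h)]
    rfl
  · intro p _ ψ b
    by_cases hp : k p.2 = true ∧ bitAt (x p.1) (p.2 % m) = true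
    · rw [if_pos hp, runCircuit_zGate]
      simp [hp]
    · rw [if_neg hp, runCircuit_nil, if_neg (fun h => hp ⟨h.1, h.2.1⟩), one_mul]

theorem reduction_accept {lam : ℕ} (h : lam ≤ n) (k : Fin lam → Bool) (x : Fin ℓ → Fin m → Bool)
    (A : Distinguisher ((Fin ℓ × Fin m) ⊕ (Fin ℓ × Fin n))) (φ : PureState n) :
    (reduction h k x A).accept (tensor fun _ => φ.density) =
      A.accept (withStrings x (tensor fun i => (φ.phased lam k (x i)).density)) := by
  rw [tensor_density (fun _ => φ), tensor_density (fun i => φ.phased lam k (x i)),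
    withStrings_outer, Distinguisher.accept_outer, Distinguisher.accept_outer]
  set e := reductionWires ℓ m n A.anc with he
  refine Fintype.sum_equiv (Equiv.arrowCongr e.symm (Equiv.refl Bool)) _ _ fun b => ?_
  have hb : (Equiv.arrowCongr e.symm (Equiv.refl Bool)) b = b ∘ e := by
    funext w; simp
  rw [hb]
  have key : runCircuit ((writeStrings x A.anc ++ (applyPhases h k x A.anc ++ A.gates)).map
      (Gate.map e)) (padVec (ℓ * m + A.anc) (tensorVec fun _ => φ)) b =
      runCircuit A.gates (padVec A.anc (stringsVec x (tensorVec fun i => φ.phased lam k (x i))))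
        (b ∘ e) := by
    rw [runCircuit_map e.injective, runCircuit_append, runCircuit_append]
    congr 2
    funext a
    rw [runCircuit_applyPhases, runCircuit_writeStrings]
    have hext : ∀ a : ((Fin ℓ × Fin m) ⊕ (Fin ℓ × Fin n)) ⊕ Fin A.anc → Bool,
        Function.extend e a b = a ∘ e.symm := fun a => by
      funext w
      conv_lhs => rw [← e.apply_symm_apply w]
      exact e.injective.extend_apply _ _ _
    rw [hext]
    have h1 : ∀ c : ((Fin ℓ × Fin m) ⊕ (Fin ℓ × Fin n)) ⊕ Fin A.anc → Bool,
        padVec (ℓ * m + A.anc) (tensorVec fun _ => φ) (c ∘ e.symm) =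
        if (∀ p, c (.inl (.inl p)) = false) ∧ ∀ i, c (.inr i) = false then
          (tensorVec fun _ => φ) fun q => c (.inl (.inr q)) else 0 := by
      intro c
      have h2 : (∀ i : Fin (ℓ * m + A.anc), (c ∘ e.symm) (.inr i) = false) ↔
          (∀ p, c (.inl (.inl p)) = false) ∧ ∀ i, c (.inr i) = false := by
        constructor
        · intro hc
          refine ⟨fun p => ?_, fun i => ?_⟩
          · rw [← hc (Fin.castAdd _ (finProdFinEquiv p))]
            simp [he, reductionWires]
          · rw [← hc (Fin.natAdd _ i)]
            simp [he, reductionWires]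
        · rintro ⟨hc, hc'⟩ i
          refine Fin.addCases (fun p => ?_) (fun i => ?_) i
          · rw [← hc (finProdFinEquiv.symm p)]
            simp [he, reductionWires]
          · rw [← hc' i]
            simp [he, reductionWires]
      refine (if_congr h2 ?_ rfl)
      rfl
    rw [h1]
    simp only [Sum.elim_inl, Sum.elim_inr, padVec, stringsVec]
    have h3 : (∀ p : Fin ℓ × Fin m, (a (.inl (.inl p)) ^^ x p.1 p.2) = false) ↔
        ∀ i j, a (.inl (.inl (i, j))) = x i j := by
      simp [Prod.forall]
    refine (congrArg _ (if_congr (and_congr h3 Iff.rfl) rfl rfl)).trans ?_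
    by_cases h4 : ∀ i j, a (.inl (.inl (i, j))) = x i j
    · by_cases h5 : ∀ i, a (.inr i) = false
      · rw [if_pos ⟨h4, h5⟩, if_pos h5, if_pos h4]
        simp only [tensorVec, PureState.phased, Finset.prod_mul_distrib]
      · rw [if_neg (fun h => h5 h.2), if_neg h5, mul_zero]
    · rw [if_neg (fun h => h4 h.1), if_neg h4, ite_self, mul_zero]
  rw [← key]
  rfl

theorem length_flatMap_le {α β : Type} (l : List α) (f : α → List β) (c : ℕ)
    (h : ∀ a, (f a).length ≤ c) : (l.flatMap f).length ≤ l.length * c := by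
  induction l with
  | nil => simp
  | cons a l ih =>
    rw [List.flatMap_cons, List.length_append, List.length_cons, Nat.succ_mul]
    have := h a
    omega

theorem reduction_size {lam : ℕ} (h : lam ≤ n) (k : Fin lam → Bool) (x : Fin ℓ → Fin m → Bool)
    (A : Distinguisher ((Fin ℓ × Fin m) ⊕ (Fin ℓ × Fin n))) :
    (reduction h k x A).size ≤ A.size + 7 * (ℓ * m) + 4 * (ℓ * lam) := by
  have h1 : (writeStrings (n := n) x A.anc).length ≤ (ℓ * m) * 6 := by
    refine (length_flatMap_le _ _ 6 fun p => ?_).trans (by simp)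
    split_ifs <;> simp [xGate, zGate]
  have h2 : (applyPhases h k x A.anc).length ≤ (ℓ * lam) * 4 := by
    refine (length_flatMap_le _ _ 4 fun p => ?_).trans (by simp)
    split_ifs <;> simp [zGate]
  simp only [Distinguisher.size, reduction, List.length_map, List.length_append]
  omega

end Reduction

/-! ### Invariance of the Haar measure -/

/-- The action of a real-linear isometry on pure states. -/
def PureState.rotate {n : ℕ}
    (U : EuclideanSpace ℂ (Fin n → Bool) ≃ₗᵢ[ℝ] EuclideanSpace ℂ (Fin n → Bool))
    (φ : PureState n) : PureState n :=
  ⟨U φ.1, by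
    rw [mem_sphere_zero_iff_norm, U.norm_map]
    exact mem_sphere_zero_iff_norm.1 φ.2⟩

theorem PureState.continuous_rotate {n : ℕ}
    (U : EuclideanSpace ℂ (Fin n → Bool) ≃ₗᵢ[ℝ] EuclideanSpace ℂ (Fin n → Bool)) :
    Continuous (PureState.rotate U) :=
  Continuous.subtype_mk (U.continuous.comp continuous_subtype_val) _

open scoped Pointwise in
theorem haarState_rotate {n : ℕ}
    (U : EuclideanSpace ℂ (Fin n → Bool) ≃ₗᵢ[ℝ] EuclideanSpace ℂ (Fin n → Bool)) :
    MeasurePreserving (PureState.rotate U) (haarState n) (haarState n) := by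
  have hmeas := (PureState.continuous_rotate U).measurable
  refine MeasurePreserving.smul_measure ⟨hmeas, ?_⟩ _
  ext s hs
  rw [Measure.map_apply hmeas hs, Measure.toSphere_apply' _ hs,
    Measure.toSphere_apply' _ (hmeas hs)]
  congr 1
  have himg : Set.Ioo (0 : ℝ) 1 • (Subtype.val '' (PureState.rotate U ⁻¹' s)) =
      U ⁻¹' (Set.Ioo (0 : ℝ) 1 • (Subtype.val '' s)) := by
    ext v
    simp only [Set.mem_smul, Set.mem_preimage, Set.mem_image]
    constructor
    · rintro ⟨r, hr, _, ⟨φ, hφ, rfl⟩, rfl⟩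
      exact ⟨r, hr, _, ⟨_, hφ, rfl⟩, by simp [PureState.rotate]⟩
    · rintro ⟨r, hr, _, ⟨φ, hφ, rfl⟩, h⟩
      refine ⟨r, hr, _, ⟨PureState.rotate U.symm φ, ?_, rfl⟩, ?_⟩
      · have : PureState.rotate U (PureState.rotate U.symm φ) = φ :=
          Subtype.ext (U.apply_symm_apply _)
        rwa [this]
      · apply U.injective
        rw [← h]
        simp [PureState.rotate]
  rw [himg]
  exact U.measurePreserving.measure_preimage_equiv (f := U.toMeasurableEquiv) _

theorem PureState.continuous_coord {n : ℕ} (a : Fin n → Bool) :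
    Continuous fun φ : PureState n => φ.1 a :=
  (PiLp.continuous_apply 2 _ a).comp continuous_subtype_val

theorem PureState.sum_sq {n : ℕ} (φ : PureState n) : ∑ a, ‖φ.1 a‖ ^ 2 = 1 := by
  have h : ‖φ.1‖ = 1 := mem_sphere_zero_iff_norm.1 φ.2
  rw [← EuclideanSpace.norm_sq_eq, h, one_pow]

/-- Multiplication of the coordinates by phases. -/
def phaseIsometry {n : ℕ} (z : (Fin n → Bool) → Circle) :
    EuclideanSpace ℂ (Fin n → Bool) ≃ₗᵢ[ℝ] EuclideanSpace ℂ (Fin n → Bool) :=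
  LinearIsometryEquiv.piLpCongrRight 2 fun a => rotation (z a)

theorem phaseIsometry_apply {n : ℕ} (z : (Fin n → Bool) → Circle) (φ : PureState n)
    (a : Fin n → Bool) : (φ.rotate (phaseIsometry z)).1 a = z a * φ.1 a := by
  simp [phaseIsometry, PureState.rotate]

/-- Permutation of the coordinates. -/
def permIsometry {n : ℕ} (σ : Equiv.Perm (Fin n → Bool)) :
    EuclideanSpace ℂ (Fin n → Bool) ≃ₗᵢ[ℝ] EuclideanSpace ℂ (Fin n → Bool) :=
  LinearIsometryEquiv.piLpCongrLeft 2 ℝ ℂ σ.symm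

theorem permIsometry_apply {n : ℕ} (σ : Equiv.Perm (Fin n → Bool)) (φ : PureState n)
    (a : Fin n → Bool) : (φ.rotate (permIsometry σ)).1 a = φ.1 (σ a) := by
  simp [permIsometry, PureState.rotate, LinearIsometryEquiv.piLpCongrLeft_apply,
    Equiv.piCongrLeft']

/-- The Hadamard gate on qubit `i`. -/
def hadIsometry {n : ℕ} (i : Fin n) :
    EuclideanSpace ℂ (Fin n → Bool) ≃ₗᵢ[ℝ] EuclideanSpace ℂ (Fin n → Bool) :=
  LinearIsometry.toLinearIsometryEquiv
    { toFun := fun φ => WithLp.toLp 2 ((Gate.had i).mat.mulVec φ.ofLp)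
      map_add' := fun φ ψ => by
        rw [WithLp.ofLp_add, Matrix.mulVec_add, WithLp.toLp_add]
      map_smul' := fun r φ => by
        rw [WithLp.ofLp_smul, Matrix.mulVec_smul, WithLp.toLp_smul, RingHom.id_apply]
      norm_map' := fun φ => by
        change ‖WithLp.toLp 2 ((Gate.had i).mat.mulVec φ.ofLp)‖ = ‖φ‖
        rw [EuclideanSpace.norm_eq, EuclideanSpace.norm_eq]
        exact congrArg _ (gate_norm (Gate.had i) φ.ofLp) } rfl

theorem hadIsometry_apply {n : ℕ} (i : Fin n) (φ : PureState n) (a : Fin n → Bool) :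
    (φ.rotate (hadIsometry i)).1 a = (Gate.had i).mat.mulVec φ.1.ofLp a := rfl

theorem integrable_of_continuous {X E : Type*} [TopologicalSpace X] [CompactSpace X]
    [MeasurableSpace X] [OpensMeasurableSpace X] [NormedAddCommGroup E] {μ : Measure X}
    [IsFiniteMeasure μ] {f : X → E} [SecondCountableTopologyEither X E]
    (hf : Continuous f) : Integrable f μ := by
  obtain ⟨C, hC⟩ := isCompact_univ.exists_bound_of_continuousOn hf.continuousOn
  exact Integrable.of_bound hf.aestronglyMeasurable C (ae_of_all _ fun x => hC x trivial)

theorem integral_rotate {n : ℕ} {F : PureState n → ℝ} (hF : Continuous F)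
    (U : EuclideanSpace ℂ (Fin n → Bool) ≃ₗᵢ[ℝ] EuclideanSpace ℂ (Fin n → Bool)) :
    ∫ φ, F (φ.rotate U) ∂(haarState n) = ∫ φ, F φ ∂(haarState n) := by
  have h := haarState_rotate U
  conv_rhs => rw [← h.map_eq]
  rw [integral_map h.measurable.aemeasurable hF.aestronglyMeasurable]

/-! ### Fourth moments -/

theorem haar_fourth_moment_eq {n : ℕ} (a b : Fin n → Bool) :
    ∫ φ, ‖φ.1 a‖ ^ 4 ∂(haarState n) = ∫ φ, ‖φ.1 b‖ ^ 4 ∂(haarState n) := by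
  rw [← integral_rotate (n := n) (F := fun φ => ‖φ.1 b‖ ^ 4)
    ((PureState.continuous_coord b).norm.pow 4)
    (permIsometry (Equiv.swap b a))]
  simp [permIsometry_apply]

theorem haar_mixed_moment_eq {n : ℕ} {a b a' b' : Fin n → Bool} (h : a ≠ b) (h' : a' ≠ b') :
    ∫ φ, ‖φ.1 a‖ ^ 2 * ‖φ.1 b‖ ^ 2 ∂(haarState n) =
      ∫ φ, ‖φ.1 a'‖ ^ 2 * ‖φ.1 b'‖ ^ 2 ∂(haarState n) := by
  obtain ⟨σ, hσ, hσ'⟩ : ∃ σ : Equiv.Perm (Fin n → Bool), σ a' = a ∧ σ b' = b := by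
    have := Equiv.Perm.isMultiplyPretransitive (Fin n → Bool) 2
    rw [MulAction.is_two_pretransitive_iff] at this
    obtain ⟨g, h1, h2⟩ := this h' h
    exact ⟨g, h1, h2⟩
  rw [← integral_rotate (n := n) (F := fun φ => ‖φ.1 a'‖ ^ 2 * ‖φ.1 b'‖ ^ 2)
    (((PureState.continuous_coord a').norm.pow 2).mul ((PureState.continuous_coord b').norm.pow 2))
    (permIsometry σ)]
  simp [permIsometry_apply, hσ, hσ']

theorem norm_add_pow_four_le (x y : ℂ) :
    ‖x + y‖ ^ 4 + ‖x - y‖ ^ 4 ≤ 2 * ‖x‖ ^ 4 + 2 * ‖y‖ ^ 4 + 12 * (‖x‖ ^ 2 * ‖y‖ ^ 2) := by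
  have h1 := parallelogram_law_with_norm ℝ x y
  have h2 : ‖x + y‖ ≤ ‖x‖ + ‖y‖ := norm_add_le _ _
  have h3 : ‖x - y‖ ≤ ‖x‖ + ‖y‖ := norm_sub_le _ _
  have e1 : ‖x + y‖ ^ 2 = ‖x‖ ^ 2 + 2 * inner ℝ x y + ‖y‖ ^ 2 := norm_add_sq_real x y
  have e2 : ‖x - y‖ ^ 2 = ‖x‖ ^ 2 - 2 * inner ℝ x y + ‖y‖ ^ 2 := norm_sub_sq_real x y
  have e3 : (inner ℝ x y : ℝ) ^ 2 ≤ ‖x‖ ^ 2 * ‖y‖ ^ 2 := by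
    rw [← mul_pow, sq_le_sq, abs_mul, abs_norm, abs_norm]
    exact abs_real_inner_le_norm x y
  have e4 : ‖x + y‖ ^ 4 = (‖x + y‖ ^ 2) ^ 2 := by ring
  have e5 : ‖x - y‖ ^ 4 = (‖x - y‖ ^ 2) ^ 2 := by ring
  rw [e4, e5, e1, e2]
  nlinarith

theorem haar_fourth_moment_le_mixed {n : ℕ} (i : Fin n) {a b : Fin n → Bool} (h : a ≠ b) :
    ∫ φ, ‖φ.1 a‖ ^ 4 ∂(haarState n) ≤ 3 * ∫ φ, ‖φ.1 a‖ ^ 2 * ‖φ.1 b‖ ^ 2 ∂(haarState n) := by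
  have hc : ∀ a : Fin n → Bool, Continuous fun φ : PureState n => ‖φ.1 a‖ ^ 4 := fun a =>
    (PureState.continuous_coord a).norm.pow 4
  have hc2 : ∀ a b : Fin n → Bool, Continuous fun φ : PureState n => ‖φ.1 a‖ ^ 2 * ‖φ.1 b‖ ^ 2 :=
    fun a b => ((PureState.continuous_coord a).norm.pow 2).mul
      ((PureState.continuous_coord b).norm.pow 2)
  let p : Fin n → Bool := Function.update a i false
  let q : Fin n → Bool := Function.update a i true
  have hpq : p ≠ q := fun h => by simpa [p, q] using congrFun h i
  have h1 := integral_rotate (hc p) (hadIsometry i)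
  have h2 := integral_rotate (hc q) (hadIsometry i)
  have hs : ‖(Real.sqrt 2 : ℂ)‖ ^ 4 = 4 := by
    rw [Complex.norm_real, Real.norm_eq_abs, abs_of_nonneg (Real.sqrt_nonneg 2),
      show (4 : ℕ) = 2 * 2 by rfl, pow_mul, Real.sq_sqrt (by norm_num)]
    norm_num
  simp only [hadIsometry_apply, had_mulVec, p, q, Function.update_idem, Function.update_self,
    Bool.false_eq_true, if_false, if_true, one_mul, neg_mul, norm_div, div_pow, hs] at h1 h2
  rw [haar_mixed_moment_eq h hpq]
  rw [haar_fourth_moment_eq a p]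
  have hq := haar_fourth_moment_eq q p
  have key : ∫ φ : PureState n, (‖φ.1 p + φ.1 q‖ ^ 4 / 4 + ‖φ.1 p - φ.1 q‖ ^ 4 / 4) ∂(haarState n)
      ≤ ∫ φ : PureState n, ((1 / 2) * ‖φ.1 p‖ ^ 4 + (1 / 2) * ‖φ.1 q‖ ^ 4 +
        3 * (‖φ.1 p‖ ^ 2 * ‖φ.1 q‖ ^ 2)) ∂(haarState n) := by
    refine integral_mono (integrable_of_continuous ?_) (integrable_of_continuous ?_) fun φ => ?_
    · exact ((((PureState.continuous_coord p).add (PureState.continuous_coord q)).norm.pow 4).div_const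
        4).add ((((PureState.continuous_coord p).sub (PureState.continuous_coord q)).norm.pow
          4).div_const 4)
    · exact ((continuous_const.mul (hc p)).add (continuous_const.mul (hc q))).add
        (continuous_const.mul (hc2 p q))
    · have := norm_add_pow_four_le (φ.1 p) (φ.1 q)
      dsimp only
      linarith
  rw [integral_add, integral_add, integral_add, integral_const_mul, integral_const_mul,
    integral_const_mul] at key
  · have h1' : ∫ φ : PureState n, ‖φ.1 p + φ.1 q‖ ^ 4 / 4 ∂(haarState n) =
      ∫ φ : PureState n, ‖φ.1 p‖ ^ 4 ∂(haarState n) := h1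
    have h2' : ∫ φ : PureState n, ‖φ.1 p - φ.1 q‖ ^ 4 / 4 ∂(haarState n) =
      ∫ φ : PureState n, ‖φ.1 q‖ ^ 4 ∂(haarState n) := by
      simpa only [sub_eq_add_neg] using h2
    rw [h1', h2', hq] at key
    linarith
  · exact integrable_of_continuous (continuous_const.mul (hc p))
  · exact integrable_of_continuous (continuous_const.mul (hc q))
  · exact integrable_of_continuous ((continuous_const.mul (hc p)).add (continuous_const.mul (hc q)))
  · exact integrable_of_continuous (continuous_const.mul (hc2 p q))
  · exact integrable_of_continuous
      ((((PureState.continuous_coord p).add (PureState.continuous_coord q)).norm.pow 4).div_const 4)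
  · exact integrable_of_continuous
      ((((PureState.continuous_coord p).sub (PureState.continuous_coord q)).norm.pow 4).div_const 4)

theorem haar_fourth_moment_le {n : ℕ} (hn : 0 < n) (a : Fin n → Bool) :
    ∫ φ, ‖φ.1 a‖ ^ 4 ∂(haarState n) ≤ 3 / ((2 : ℝ) ^ n) ^ 2 := by
  have hc2 : ∀ a b : Fin n → Bool, Continuous fun φ : PureState n => ‖φ.1 a‖ ^ 2 * ‖φ.1 b‖ ^ 2 :=
    fun a b => ((PureState.continuous_coord a).norm.pow 2).mul
      ((PureState.continuous_coord b).norm.pow 2)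
  have hcard : (Fintype.card (Fin n → Bool) : ℝ) = 2 ^ n := by simp
  have hpos : (0 : ℝ) < 2 ^ n := by positivity
  have h1 : ∑ b, ∑ c, ∫ φ, ‖φ.1 b‖ ^ 2 * ‖φ.1 c‖ ^ 2 ∂(haarState n) = 1 := by
    calc _ = ∫ φ, ∑ b, ∑ c, ‖φ.1 b‖ ^ 2 * ‖φ.1 c‖ ^ 2 ∂(haarState n) := by
          rw [integral_finsetSum]
          · refine Finset.sum_congr rfl fun b _ => ?_
            rw [integral_finsetSum]
            exact fun c _ => integrable_of_continuous (hc2 b c)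
          · exact fun b _ => integrable_of_continuous (continuous_finsetSum _ fun c _ => hc2 b c)
      _ = ∫ _ : PureState n, 1 ∂(haarState n) := by
          refine integral_congr_ae (ae_of_all _ fun φ => ?_)
          dsimp only
          rw [← Finset.sum_mul_sum, φ.sum_sq, one_mul]
      _ = 1 := by simp
  have h2 : ∀ b c : Fin n → Bool, (∫ φ, ‖φ.1 a‖ ^ 4 ∂(haarState n)) / 3 ≤
      ∫ φ, ‖φ.1 b‖ ^ 2 * ‖φ.1 c‖ ^ 2 ∂(haarState n) := by
    intro b c
    by_cases hbc : b = c
    · subst hbc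
      have : (fun φ : PureState n => ‖φ.1 b‖ ^ 2 * ‖φ.1 b‖ ^ 2) = fun φ => ‖φ.1 b‖ ^ 4 := by
        funext φ; ring
      rw [this, haar_fourth_moment_eq a b]
      have : 0 ≤ ∫ φ, ‖φ.1 b‖ ^ 4 ∂(haarState n) := integral_nonneg fun φ => by positivity
      linarith
    · rw [haar_fourth_moment_eq a b]
      have := haar_fourth_moment_le_mixed ⟨0, hn⟩ hbc
      linarith
  have h3 := Finset.sum_le_sum fun b (_ : b ∈ Finset.univ) =>
    Finset.sum_le_sum fun c (_ : c ∈ Finset.univ) => h2 b c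
  rw [h1] at h3
  simp only [Finset.sum_const, Finset.card_univ, nsmul_eq_mul, hcard] at h3
  rw [le_div_iff₀ (by positivity)]
  linarith

/-! ### Tensor products of independent Haar states -/

section Moments

variable {I : Type} [Fintype I] {n ℓ : ℕ}

/-- Independent Haar states. -/
abbrev haarFamily (I : Type) [Fintype I] (n : ℕ) : Measure (I → PureState n) :=
  Measure.pi fun _ => haarState n

/-- The vector `⨂ i, φ (x i)`. -/
def prodVec (x : Fin ℓ → I) (φ : I → PureState n) (u : Fin ℓ → Fin n → Bool) : ℂ :=
  ∏ i, (φ (x i)).1 (u i)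

/-- The averaged density matrix of `⨂ i, φ (x i)`. -/
def moment (x : Fin ℓ → I) (u v : Fin ℓ → Fin n → Bool) : ℂ :=
  ∫ φ, prodVec x φ u * star (prodVec x φ v) ∂(haarFamily I n)

/-- The distribution of the outcome when `⨂ i, φ (x i)` is measured. -/
def weight (x : Fin ℓ → I) (u : Fin ℓ → Fin n → Bool) : ℝ :=
  ∫ φ, ‖prodVec x φ u‖ ^ 2 ∂(haarFamily I n)

theorem continuous_prodVec {J : Type} (x : Fin ℓ → J) (u : Fin ℓ → Fin n → Bool) :
    Continuous fun φ : J → PureState n => prodVec x φ u :=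
  continuous_finsetProd _ fun i _ =>
    (PureState.continuous_coord (u i)).comp (continuous_apply (x i))

theorem integral_rotate_family {E : Type*} [NormedAddCommGroup E] [NormedSpace ℝ E]
    [SecondCountableTopology E]
    {F : (I → PureState n) → E} (hF : Continuous F)
    (U : I → EuclideanSpace ℂ (Fin n → Bool) ≃ₗᵢ[ℝ] EuclideanSpace ℂ (Fin n → Bool)) :
    ∫ φ, F (fun y => (φ y).rotate (U y)) ∂(haarFamily I n) = ∫ φ, F φ ∂(haarFamily I n) := by
  have h := measurePreserving_pi (fun _ : I => haarState n) (fun _ => haarState n)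
    fun y => haarState_rotate (U y)
  conv_rhs => rw [haarFamily, ← h.map_eq]
  rw [integral_map h.measurable.aemeasurable hF.aestronglyMeasurable]

theorem integral_eval_family {F : PureState n → ℝ} (hF : Continuous F) (y : I) :
    ∫ φ, F (φ y) ∂(haarFamily I n) = ∫ φ, F φ ∂(haarState n) := by
  have h := measurePreserving_eval (fun _ : I => haarState n) y
  conv_rhs => rw [← h.map_eq]
  rw [integral_map h.measurable.aemeasurable hF.aestronglyMeasurable]

theorem weight_nonneg (x : Fin ℓ → I) (u : Fin ℓ → Fin n → Bool) : 0 ≤ weight x u :=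
  integral_nonneg fun _ => by positivity

theorem sum_prod_eq {α : Type} [Fintype α] [DecidableEq α] (p : Fin ℓ → α → ℝ) :
    ∑ u : Fin ℓ → α, ∏ i, p i (u i) = ∏ i, ∑ a, p i a := by
  rw [Finset.prod_univ_sum, Fintype.piFinset_univ]

theorem norm_prodVec_sq {J : Type} (x : Fin ℓ → J) (φ : J → PureState n) (u : Fin ℓ → Fin n → Bool) :
    ‖prodVec x φ u‖ ^ 2 = ∏ i, ‖(φ (x i)).1 (u i)‖ ^ 2 := by
  rw [prodVec, norm_prod, Finset.prod_pow]

theorem sum_weight (x : Fin ℓ → I) : ∑ u : Fin ℓ → Fin n → Bool, weight x u = 1 := by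
  have hc : ∀ u : Fin ℓ → Fin n → Bool, Continuous fun φ : I → PureState n =>
      ‖prodVec x φ u‖ ^ 2 := fun u => (continuous_prodVec x u).norm.pow 2
  calc _ = ∫ φ : I → PureState n, ∑ u, ‖prodVec x φ u‖ ^ 2 ∂(haarFamily I n) :=
        (integral_finsetSum _ fun u _ => integrable_of_continuous (hc u)).symm
    _ = ∫ _ : I → PureState n, 1 ∂(haarFamily I n) := by
        refine integral_congr_ae (ae_of_all _ fun φ => ?_)
        simp only [norm_prodVec_sq]
        rw [sum_prod_eq fun i a => ‖(φ (x i)).1 a‖ ^ 2]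
        exact Finset.prod_eq_one fun i _ => (φ (x i)).sum_sq
    _ = 1 := by simp

theorem moment_comp_perm (x : Fin ℓ → I) (u : Fin ℓ → Fin n → Bool) (τ : Equiv.Perm (Fin ℓ))
    (hτ : x ∘ τ = x) : moment x u (u ∘ τ) = weight x u := by
  rw [moment, weight, ← integral_complex_ofReal]
  refine integral_congr_ae (ae_of_all _ fun φ => ?_)
  have h : prodVec x φ (u ∘ τ) = prodVec x φ u := by
    rw [prodVec, prodVec, ← Equiv.prod_comp τ fun i => (φ (x i)).1 (u i)]
    refine Finset.prod_congr rfl fun i _ => ?_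
    rw [show x (τ i) = x i from congrFun hτ i]
    rfl
  dsimp only
  rw [h, Complex.star_def, Complex.mul_conj, Complex.normSq_eq_norm_sq]

theorem moment_eq_zero_or (x : Fin ℓ → I) {u v : Fin ℓ → Fin n → Bool}
    (hu : Function.Injective u) (h : moment x u v ≠ 0) :
    ∃ τ : Equiv.Perm (Fin ℓ), v ∘ τ = u ∧ x ∘ τ = x := by
  classical
  have key : ∀ i, ∃ j, x j = x i ∧ v j = u i := by
    intro i
    let cnt : (Fin ℓ → Fin n → Bool) → ℕ := fun w =>
      (Finset.univ.filter fun k => x k = x i ∧ w k = u i).card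
    let ζ : Circle := Circle.exp (2 * Real.pi / (ℓ + 1 : ℕ))
    have hζ : IsPrimitiveRoot (ζ : ℂ) (ℓ + 1) := by
      have := Complex.isPrimitiveRoot_exp (ℓ + 1) (Nat.succ_ne_zero ℓ)
      convert! this using 1
      rw [Circle.coe_exp]
      congr 1
      push_cast
      ring
    have hrot := integral_rotate_family (I := I)
      (F := fun φ : I → PureState n => prodVec x φ u * star (prodVec x φ v))
      ((continuous_prodVec x u).mul (continuous_prodVec x v).star)
      (fun y => phaseIsometry fun a => if y = x i ∧ a = u i then ζ else 1)
    have hpv : ∀ (φ : I → PureState n) (w : Fin ℓ → Fin n → Bool),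
        prodVec x (fun y => (φ y).rotate
          (phaseIsometry fun a => if y = x i ∧ a = u i then ζ else 1)) w =
        (ζ : ℂ) ^ cnt w * prodVec x φ w := by
      intro φ w
      simp only [prodVec, phaseIsometry_apply, Finset.prod_mul_distrib]
      congr 1
      rw [← Finset.prod_const, Finset.prod_filter]
      refine Finset.prod_congr rfl fun k _ => ?_
      split_ifs <;> simp
    simp only [hpv] at hrot
    have hfac : ∀ φ : I → PureState n,
        (ζ : ℂ) ^ cnt u * prodVec x φ u * star ((ζ : ℂ) ^ cnt v * prodVec x φ v) =
        ((ζ : ℂ) ^ cnt u * star ((ζ : ℂ) ^ cnt v)) * (prodVec x φ u * star (prodVec x φ v)) := by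
      intro φ
      rw [star_mul']
      ring
    simp only [hfac] at hrot
    rw [integral_const_mul] at hrot
    change _ * moment x u v = moment x u v at hrot
    have h1 : (ζ : ℂ) ^ cnt u * star ((ζ : ℂ) ^ cnt v) = 1 := mul_right_cancel₀ h (by rw [hrot, one_mul])
    have h2 : (ζ : ℂ) ^ cnt v * star ((ζ : ℂ) ^ cnt v) = 1 := by
      rw [Complex.star_def, Complex.mul_conj, Complex.normSq_eq_norm_sq, norm_pow,
        Circle.norm_coe, one_pow, one_pow, Complex.ofReal_one]
    have h3 : (ζ : ℂ) ^ cnt u = (ζ : ℂ) ^ cnt v := by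
      have hne : star ((ζ : ℂ) ^ cnt v) ≠ 0 := fun h0 => by
        rw [h0, mul_zero] at h2; exact zero_ne_one h2
      exact mul_right_cancel₀ hne (h1.trans h2.symm)
    have hlt : ∀ w, cnt w < ℓ + 1 := fun w =>
      Nat.lt_succ_of_le ((Finset.card_le_univ _).trans (by simp))
    have h4 := hζ.pow_inj (hlt u) (hlt v) h3
    have h5 : 0 < cnt u := Finset.card_pos.2 ⟨i, by simp⟩
    rw [h4] at h5
    obtain ⟨j, hj⟩ := Finset.card_pos.1 h5
    exact ⟨j, (Finset.mem_filter.1 hj).2⟩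
  choose τ hτ hτ' using key
  have hinj : Function.Injective τ := fun i j hij => hu (by rw [← hτ', ← hτ', hij])
  exact ⟨Equiv.ofBijective τ (Finite.injective_iff_bijective.1 hinj), funext hτ', funext hτ⟩

theorem weight_eq_of_injective (x : Fin ℓ → I) :
    ∃ p : ℝ, 0 ≤ p ∧ ∀ u : Fin ℓ → Fin n → Bool, Function.Injective u → weight x u = p := by
  by_cases h : ∃ u : Fin ℓ → Fin n → Bool, Function.Injective u
  · obtain ⟨u, hu⟩ := h
    refine ⟨weight x u, weight_nonneg x u, fun v hv => ?_⟩
    obtain ⟨σ, hσ⟩ : ∃ σ : Equiv.Perm (Fin n → Bool), ∀ i, σ (v i) = u i := by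
      have := Equiv.Perm.isMultiplyPretransitive (Fin n → Bool) ℓ
      let v' : Fin ℓ ↪ (Fin n → Bool) := ⟨v, hv⟩
      let u' : Fin ℓ ↪ (Fin n → Bool) := ⟨u, hu⟩
      obtain ⟨σ, hσ⟩ := MulAction.exists_smul_eq (Equiv.Perm (Fin n → Bool)) v' u'
      exact ⟨σ, fun i => DFunLike.congr_fun hσ i⟩
    have := integral_rotate_family (I := I) (F := fun φ : I → PureState n => ‖prodVec x φ v‖ ^ 2)
      ((continuous_prodVec x v).norm.pow 2) (fun _ => permIsometry σ)
    rw [weight, weight, ← this]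
    simp only [prodVec, permIsometry_apply, hσ]
  · exact ⟨0, le_rfl, fun u hu => absurd ⟨u, hu⟩ h⟩

/-! ### Collisions -/

theorem sum_collision {α : Type} [Fintype α] [DecidableEq α] (p : Fin ℓ → α → ℝ)
    (hp : ∀ i, ∑ a, p i a = 1) {i j : Fin ℓ} (hij : i ≠ j) :
    ∑ u : Fin ℓ → α, (if u i = u j then ∏ k, p k (u k) else 0) = ∑ a, p i a * p j a := by
  have h : ∀ u : Fin ℓ → α, (if u i = u j then ∏ k, p k (u k) else 0) =
      ∑ a, ∏ k, (if (k = i ∨ k = j) ∧ u k ≠ a then 0 else p k (u k)) := by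
    intro u
    rw [Finset.sum_eq_single (u i)]
    · by_cases hu : u i = u j
      · rw [if_pos hu]
        refine Finset.prod_congr rfl fun k _ => (if_neg ?_).symm
        rintro ⟨rfl | rfl, h⟩
        · exact h rfl
        · exact h hu.symm
      · rw [if_neg hu]
        symm
        exact Finset.prod_eq_zero (Finset.mem_univ j)
          (if_pos ⟨Or.inr rfl, fun h => hu h.symm⟩)
    · intro a _ ha
      exact Finset.prod_eq_zero (Finset.mem_univ i) (if_pos ⟨Or.inl rfl, fun h => ha h.symm⟩)
    · simp
  rw [Finset.sum_congr rfl fun u _ => h u, Finset.sum_comm]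
  refine Finset.sum_congr rfl fun a _ => ?_
  rw [sum_prod_eq fun k b => if (k = i ∨ k = j) ∧ b ≠ a then 0 else p k b]
  rw [Finset.prod_eq_mul i j hij]
  · congr 1
    · rw [Finset.sum_eq_single a] <;> simp +contextual
    · rw [Finset.sum_eq_single a] <;> simp +contextual
  · rintro k - ⟨hki, hkj⟩
    rw [← hp k]
    exact Finset.sum_congr rfl fun b _ => if_neg fun h => h.1.elim hki hkj
  · simp
  · simp

theorem sum_not_injective_le {α : Type} [Fintype α] [DecidableEq α] (p : Fin ℓ → α → ℝ)
    (hp0 : ∀ i a, 0 ≤ p i a) (hp : ∀ i, ∑ a, p i a = 1) :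
    ∑ u : Fin ℓ → α, (if Function.Injective u then 0 else ∏ k, p k (u k)) ≤
      ∑ i, ∑ j, if i = j then 0 else ∑ a, p i a * p j a := by
  calc _ ≤ ∑ u : Fin ℓ → α, ∑ i, ∑ j, (if i = j then 0 else
        if u i = u j then ∏ k, p k (u k) else 0) := by
        refine Finset.sum_le_sum fun u _ => ?_
        have h0 : ∀ i j : Fin ℓ, 0 ≤ (if i = j then 0 else
            if u i = u j then ∏ k, p k (u k) else 0) := fun i j => by
          split_ifs
          · exact le_rfl
          · exact Finset.prod_nonneg fun k _ => hp0 k _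
          · exact le_rfl
        by_cases hu : Function.Injective u
        · rw [if_pos hu]
          exact Finset.sum_nonneg fun i _ => Finset.sum_nonneg fun j _ => h0 i j
        · rw [if_neg hu]
          obtain ⟨i, j, h1, h2⟩ : ∃ i j, u i = u j ∧ i ≠ j := by
            simpa [Function.Injective] using hu
          calc _ = (if i = j then 0 else if u i = u j then ∏ k, p k (u k) else 0) := by
                rw [if_neg h2, if_pos h1]
            _ ≤ ∑ j, (if i = j then 0 else if u i = u j then ∏ k, p k (u k) else 0) :=
                Finset.single_le_sum
                  (f := fun j => if i = j then 0 else if u i = u j then ∏ k, p k (u k) else 0)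
                  (fun j _ => h0 i j) (Finset.mem_univ j)
            _ ≤ _ := Finset.single_le_sum
                  (f := fun i => ∑ j, if i = j then 0 else if u i = u j then ∏ k, p k (u k) else 0)
                  (fun i _ => Finset.sum_nonneg fun j _ => h0 i j) (Finset.mem_univ i)
    _ = _ := by
        rw [Finset.sum_comm]
        refine Finset.sum_congr rfl fun i _ => ?_
        rw [Finset.sum_comm]
        refine Finset.sum_congr rfl fun j _ => ?_
        by_cases hij : i = j
        · simp [hij]
        · simp only [if_neg hij]
          exact sum_collision p hp hij

theorem weight_not_injective_le (hn : 0 < n) (x : Fin ℓ → I) :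
    ∑ u : Fin ℓ → Fin n → Bool, (if Function.Injective u then 0 else weight x u) ≤
      3 * (ℓ : ℝ) ^ 2 / 2 ^ n := by
  have hd : (0 : ℝ) < 2 ^ n := by positivity
  have hc : ∀ u : Fin ℓ → Fin n → Bool, Continuous fun φ : I → PureState n =>
      if Function.Injective u then 0 else ‖prodVec x φ u‖ ^ 2 := fun u => by
    split_ifs
    · exact continuous_const
    · exact (continuous_prodVec x u).norm.pow 2
  have hc4 : ∀ (y : I) (a : Fin n → Bool), Continuous fun φ : I → PureState n =>
      ‖(φ y).1 a‖ ^ 4 := fun y a =>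
    ((PureState.continuous_coord a).comp (continuous_apply y)).norm.pow 4
  have hcg : Continuous fun φ : I → PureState n => ∑ i : Fin ℓ, ∑ j : Fin ℓ, ∑ a : Fin n → Bool,
      (‖(φ (x i)).1 a‖ ^ 4 + ‖(φ (x j)).1 a‖ ^ 4) / 2 :=
    continuous_finsetSum _ fun i _ => continuous_finsetSum _ fun j _ =>
      continuous_finsetSum _ fun a _ => ((hc4 _ a).add (hc4 _ a)).div_const 2
  calc _ = ∑ u : Fin ℓ → Fin n → Bool, ∫ φ : I → PureState n,
        (if Function.Injective u then 0 else ‖prodVec x φ u‖ ^ 2) ∂(haarFamily I n) := by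
        refine Finset.sum_congr rfl fun u _ => ?_
        split_ifs
        · simp
        · rfl
    _ = ∫ φ : I → PureState n, ∑ u, (if Function.Injective u then 0 else ‖prodVec x φ u‖ ^ 2)
          ∂(haarFamily I n) :=
        (integral_finsetSum _ fun u _ => integrable_of_continuous (hc u)).symm
    _ ≤ ∫ φ : I → PureState n, ∑ i : Fin ℓ, ∑ j : Fin ℓ, ∑ a : Fin n → Bool,
          (‖(φ (x i)).1 a‖ ^ 4 + ‖(φ (x j)).1 a‖ ^ 4) / 2 ∂(haarFamily I n) := by
        refine integral_mono (integrable_of_continuous (continuous_finsetSum _ fun u _ => hc u))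
          (integrable_of_continuous hcg) fun φ => ?_
        simp only [norm_prodVec_sq]
        refine (sum_not_injective_le (fun i a => ‖(φ (x i)).1 a‖ ^ 2) (fun i a => by positivity)
          fun i => (φ (x i)).sum_sq).trans ?_
        refine Finset.sum_le_sum fun i _ => Finset.sum_le_sum fun j _ => ?_
        split_ifs
        · exact Finset.sum_nonneg fun a _ => by positivity
        · refine Finset.sum_le_sum fun a _ => ?_
          nlinarith [sq_nonneg (‖(φ (x i)).1 a‖ ^ 2 - ‖(φ (x j)).1 a‖ ^ 2)]
    _ = ∑ i : Fin ℓ, ∑ j : Fin ℓ, ∑ a : Fin n → Bool,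
          ((∫ φ, ‖φ.1 a‖ ^ 4 ∂(haarState n)) + ∫ φ, ‖φ.1 a‖ ^ 4 ∂(haarState n)) / 2 := by
        have e : ∀ (y : I) (a : Fin n → Bool), ∫ φ : I → PureState n, ‖(φ y).1 a‖ ^ 4
            ∂(haarFamily I n) = ∫ φ, ‖φ.1 a‖ ^ 4 ∂(haarState n) := fun y a =>
          integral_eval_family (F := fun φ => ‖φ.1 a‖ ^ 4)
            ((PureState.continuous_coord a).norm.pow 4) y
        have hci : ∀ (i j : Fin ℓ) (a : Fin n → Bool), Continuous fun φ : I → PureState n =>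
            (‖(φ (x i)).1 a‖ ^ 4 + ‖(φ (x j)).1 a‖ ^ 4) / 2 := fun i j a =>
          ((hc4 (x i) a).add (hc4 (x j) a)).div_const 2
        rw [integral_finsetSum _ fun i _ => integrable_of_continuous
          (continuous_finsetSum _ fun j _ => continuous_finsetSum _ fun a _ => hci i j a)]
        refine Finset.sum_congr rfl fun i _ => ?_
        rw [integral_finsetSum _ fun j _ => integrable_of_continuous
          (continuous_finsetSum _ fun a _ => hci i j a)]
        refine Finset.sum_congr rfl fun j _ => ?_
        rw [integral_finsetSum _ fun a _ => integrable_of_continuous (hci i j a)]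
        refine Finset.sum_congr rfl fun a _ => ?_
        rw [integral_div, integral_add (integrable_of_continuous (hc4 _ a))
          (integrable_of_continuous (hc4 _ a)), e, e]
    _ ≤ ∑ i : Fin ℓ, ∑ j : Fin ℓ, ∑ a : Fin n → Bool, 3 / ((2 : ℝ) ^ n) ^ 2 := by
        refine Finset.sum_le_sum fun i _ => Finset.sum_le_sum fun j _ =>
          Finset.sum_le_sum fun a _ => ?_
        have := haar_fourth_moment_le hn a
        linarith
    _ = 3 * (ℓ : ℝ) ^ 2 / 2 ^ n := by
        simp only [Finset.sum_const, Finset.card_univ, Fintype.card_fin, Fintype.card_fun,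
          Fintype.card_bool, nsmul_eq_mul]
        push_cast
        field_simp

theorem two_mul_card_injective_ge (hd : 2 * ℓ ^ 2 ≤ 2 ^ n) :
    (2 ^ n : ℝ) ^ ℓ ≤
      2 * (Finset.univ.filter fun u : Fin ℓ → Fin n → Bool => Function.Injective u).card := by
  have hd0 : (0 : ℝ) < 2 ^ n := by positivity
  have h := sum_not_injective_le (ℓ := ℓ) (α := Fin n → Bool) (fun _ _ => 1 / 2 ^ n)
    (fun _ _ => by positivity) (fun _ => by simp)
  have h1 : ∑ i : Fin ℓ, ∑ j : Fin ℓ, (if i = j then (0 : ℝ) else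
      ∑ _a : Fin n → Bool, 1 / 2 ^ n * (1 / 2 ^ n)) ≤ 1 / 2 := by
    calc _ ≤ ∑ i : Fin ℓ, ∑ j : Fin ℓ, (1 : ℝ) / 2 ^ n := by
          refine Finset.sum_le_sum fun i _ => Finset.sum_le_sum fun j _ => ?_
          split_ifs
          · positivity
          · simp
      _ = (ℓ : ℝ) ^ 2 / 2 ^ n := by
          simp only [Finset.sum_const, Finset.card_univ, Fintype.card_fin, nsmul_eq_mul]
          ring
      _ ≤ 1 / 2 := by
          rw [div_le_div_iff₀ hd0 two_pos]
          have : (2 * ℓ ^ 2 : ℝ) ≤ 2 ^ n := by exact_mod_cast hd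
          linarith
  have h2 := h.trans h1
  have h3 : ∑ u : Fin ℓ → Fin n → Bool, (if Function.Injective u then (0 : ℝ) else
      ∏ _k : Fin ℓ, 1 / 2 ^ n) = ((2 ^ n : ℝ) ^ ℓ - (Finset.univ.filter
        fun u : Fin ℓ → Fin n → Bool => Function.Injective u).card) / (2 ^ n : ℝ) ^ ℓ := by
    have e : ∀ u : Fin ℓ → Fin n → Bool, (if Function.Injective u then (0 : ℝ) else
      ∏ _k : Fin ℓ, 1 / 2 ^ n) =
        (1 - if Function.Injective u then 1 else 0) / (2 ^ n : ℝ) ^ ℓ := fun u => by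
      split_ifs <;> simp
    rw [Finset.sum_congr rfl fun u _ => e u, ← Finset.sum_div, Finset.sum_sub_distrib,
      Finset.sum_boole]
    simp
  rw [h3, div_le_iff₀ (by positivity)] at h2
  linarith

/-- The probability of a bad outcome. -/
theorem weight_bad_le (hn : 0 < n) (hd : 2 * ℓ ^ 2 ≤ 2 ^ n) (x : Fin ℓ → I)
    (good : (Fin ℓ → Fin n → Bool) → Prop) [DecidablePred good] :
    ∑ u : Fin ℓ → Fin n → Bool, (if good u then 0 else weight x u) ≤
      3 * (ℓ : ℝ) ^ 2 / 2 ^ n +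
        2 * (Finset.univ.filter fun u => ¬good u).card / (2 ^ n : ℝ) ^ ℓ := by
  obtain ⟨p, hp0, hp⟩ := weight_eq_of_injective (n := n) x
  have hpos : (0 : ℝ) < (2 ^ n) ^ ℓ := by positivity
  have hp1 : p * (2 ^ n : ℝ) ^ ℓ ≤ 2 := by
    have h1 : p * (Finset.univ.filter
        fun u : Fin ℓ → Fin n → Bool => Function.Injective u).card ≤ 1 := by
      rw [← sum_weight (n := n) x, mul_comm, ← nsmul_eq_mul, ← Finset.sum_const, Finset.sum_filter]
      refine Finset.sum_le_sum fun u _ => ?_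
      split_ifs with h
      · exact (hp u h).ge
      · exact weight_nonneg x u
    have h2 := mul_le_mul_of_nonneg_left (two_mul_card_injective_ge hd) hp0
    linarith
  calc _ ≤ ∑ u : Fin ℓ → Fin n → Bool, ((if Function.Injective u then 0 else weight x u) +
        if ¬good u then p else 0) := by
        refine Finset.sum_le_sum fun u _ => ?_
        have := weight_nonneg x u
        by_cases h : good u <;> by_cases h' : Function.Injective u <;> simp [h, h', hp0, this]
        exact (hp u h').le
    _ ≤ _ := by
        rw [Finset.sum_add_distrib]
        refine add_le_add (weight_not_injective_le hn x) ?_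
        rw [← Finset.sum_filter, Finset.sum_const, nsmul_eq_mul, le_div_iff₀ hpos]
        have : (0 : ℝ) ≤ (Finset.univ.filter fun u => ¬good u).card := by positivity
        nlinarith

end Moments

/-! ### Averaged density matrices -/

section Averaged

variable {U : Type} [Fintype U]

/-- `M` pairs nonnegatively with every nonnegative quadratic form. -/
def IsAveraged (M : U → U → ℂ) : Prop :=
  ∀ c : U → U → ℂ, (∀ Ψ : U → ℂ, 0 ≤ (∑ u, ∑ v, c u v * (Ψ u * star (Ψ v))).re) →
    0 ≤ (∑ u, ∑ v, c u v * M u v).re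

/-- On a subset `s` of the basis, a form between `0` and the norm pairs with `M` to a number
between `0` and the trace of `M` on `s`. -/
theorem IsAveraged.mask {M : U → U → ℂ} (hM : IsAveraged M) {c : U → U → ℂ}
    (h0 : ∀ Ψ : U → ℂ, 0 ≤ (∑ u, ∑ v, c u v * (Ψ u * star (Ψ v))).re)
    (h1 : ∀ Ψ : U → ℂ, (∑ u, ∑ v, c u v * (Ψ u * star (Ψ v))).re ≤ ∑ u, ‖Ψ u‖ ^ 2)
    (s : U → Prop) [DecidablePred s] :
    0 ≤ (∑ u, ∑ v, if s u ∧ s v then c u v * M u v else 0).re ∧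
      (∑ u, ∑ v, if s u ∧ s v then c u v * M u v else 0).re ≤
        ∑ u, if s u then (M u u).re else 0 := by
  classical
  have hmask : ∀ Ψ : U → ℂ,
      ∑ u, ∑ v, (if s u ∧ s v then c u v else 0) * (Ψ u * star (Ψ v)) =
        ∑ u, ∑ v, c u v * ((if s u then Ψ u else 0) * star (if s v then Ψ v else 0)) := by
    intro Ψ
    refine Finset.sum_congr rfl fun u _ => Finset.sum_congr rfl fun v _ => ?_
    by_cases hu : s u <;> by_cases hv : s v <;> simp [hu, hv]
  have hM' : ∑ u, ∑ v, (if s u ∧ s v then c u v * M u v else 0) =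
      ∑ u, ∑ v, (if s u ∧ s v then c u v else 0) * M u v := by
    simp only [ite_mul, zero_mul]
  rw [hM']
  constructor
  · refine hM _ fun Ψ => ?_
    rw [hmask]
    exact h0 _
  · have h := hM (fun u v => (if u = v then if s u then 1 else 0 else 0) -
      if s u ∧ s v then c u v else 0) fun Ψ => ?_
    · simp only [sub_mul, Finset.sum_sub_distrib, Complex.sub_re, sub_nonneg] at h
      refine h.trans (le_of_eq ?_)
      simp only [ite_mul, one_mul, zero_mul, Finset.sum_ite_eq, Finset.mem_univ, if_true,
        Complex.re_sum]
      exact Finset.sum_congr rfl fun u _ => by split_ifs <;> simp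
    · simp only [sub_mul, Finset.sum_sub_distrib, Complex.sub_re, sub_nonneg]
      rw [hmask]
      refine (h1 _).trans (le_of_eq ?_)
      simp only [ite_mul, one_mul, zero_mul, Finset.sum_ite_eq, Finset.mem_univ, if_true,
        Complex.re_sum]
      refine Finset.sum_congr rfl fun u _ => ?_
      split_ifs
      · rw [Complex.star_def, Complex.mul_conj, Complex.normSq_eq_norm_sq, Complex.ofReal_re]
      · simp

/-- Two averaged density matrices that are proportional on the good part of the basis, which they
do not mix with the rest, are close. -/
theorem IsAveraged.close {M₁ M₂ : U → U → ℂ} (hM₁ : IsAveraged M₁) (hM₂ : IsAveraged M₂)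
    {c : U → U → ℂ}
    (h0 : ∀ Ψ : U → ℂ, 0 ≤ (∑ u, ∑ v, c u v * (Ψ u * star (Ψ v))).re)
    (h1 : ∀ Ψ : U → ℂ, (∑ u, ∑ v, c u v * (Ψ u * star (Ψ v))).re ≤ ∑ u, ‖Ψ u‖ ^ 2)
    (good : U → Prop) [DecidablePred good] {p₁ p₂ : ℝ} (hp₁ : 0 ≤ p₁)
    {T : U → U → ℂ} (hT : ∀ u, good u → T u u = 1)
    (hMT₁ : ∀ u v, good u → M₁ u v = p₁ * T u v) (hMT₂ : ∀ u v, good u → M₂ u v = p₂ * T u v)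
    (hz₁ : ∀ u v, ¬(good u ↔ good v) → M₁ u v = 0) (hz₂ : ∀ u v, ¬(good u ↔ good v) → M₂ u v = 0)
    (ht₁ : ∑ u, (M₁ u u).re = 1) (ht₂ : ∑ u, (M₂ u u).re = 1) :
    |(∑ u, ∑ v, c u v * M₁ u v).re - (∑ u, ∑ v, c u v * M₂ u v).re| ≤
      2 * ((∑ u, if good u then 0 else (M₁ u u).re) + ∑ u, if good u then 0 else (M₂ u u).re) := by
  set t : ℝ := (∑ u, ∑ v, if good u ∧ good v then c u v * T u v else 0).re with ht
  set g : ℝ := ∑ u, if good u then 1 else 0 with hg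
  have hg0 : 0 ≤ g := Finset.sum_nonneg fun u _ => by split_ifs <;> norm_num
  have main : ∀ (M : U → U → ℂ) (p : ℝ), IsAveraged M → (∀ u v, good u → M u v = p * T u v) →
      (∀ u v, ¬(good u ↔ good v) → M u v = 0) → ∑ u, (M u u).re = 1 →
      ∃ r : ℝ, (∑ u, ∑ v, c u v * M u v).re = p * t + r ∧ 0 ≤ r ∧
        r ≤ (∑ u, if good u then 0 else (M u u).re) ∧ 0 ≤ p * t ∧ p * t ≤ p * g ∧
        p * g + (∑ u, if good u then 0 else (M u u).re) = 1 := by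
    intro M p hM hMT hz htr
    have hgood := hM.mask h0 h1 good
    have hbad := hM.mask h0 h1 fun u => ¬good u
    have e1 : (∑ u, ∑ v, if good u ∧ good v then c u v * M u v else 0).re = p * t := by
      rw [ht, ← Complex.re_ofReal_mul, Finset.mul_sum]
      congr 1
      refine Finset.sum_congr rfl fun u _ => ?_
      rw [Finset.mul_sum]
      refine Finset.sum_congr rfl fun v _ => ?_
      split_ifs with h
      · rw [hMT u v h.1]; ring
      · rw [mul_zero]
    have e2 : (∑ u, if good u then (M u u).re else 0) = p * g := by
      rw [hg, Finset.mul_sum]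
      refine Finset.sum_congr rfl fun u _ => ?_
      split_ifs with h
      · rw [hMT u u h, hT u h]; simp
      · rw [mul_zero]
    have e3 : (∑ u, if ¬good u then (M u u).re else 0) =
        ∑ u, if good u then 0 else (M u u).re := by
      simp only [ite_not]
    rw [e1, e2] at hgood
    rw [e3] at hbad
    refine ⟨_, ?_, hbad.1, hbad.2, hgood.1, hgood.2, ?_⟩
    · rw [← e1, ← Complex.add_re, ← Finset.sum_add_distrib]
      congr 1
      refine Finset.sum_congr rfl fun u _ => ?_
      rw [← Finset.sum_add_distrib]
      refine Finset.sum_congr rfl fun v _ => ?_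
      by_cases hu : good u <;> by_cases hv : good v
      · simp [hu, hv]
      · rw [hz u v (by simp [hu, hv])]; simp
      · rw [hz u v (by simp [hu, hv])]; simp
      · simp [hu, hv]
    · rw [← e2, ← htr, ← Finset.sum_add_distrib]
      exact Finset.sum_congr rfl fun u _ => by split_ifs <;> simp
  obtain ⟨r₁, a1, a2, a3, a4, a5, a6⟩ := main M₁ p₁ hM₁ hMT₁ hz₁ ht₁
  obtain ⟨r₂, b1, b2, b3, b4, b5, b6⟩ := main M₂ p₂ hM₂ hMT₂ hz₂ ht₂
  rw [a1, b1]
  set d₁ := ∑ u, if good u then 0 else (M₁ u u).re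
  set d₂ := ∑ u, if good u then 0 else (M₂ u u).re
  have key : |p₁ * t - p₂ * t| ≤ d₁ + d₂ := by
    rcases eq_or_ne p₁ 0 with h₁ | h₁
    · rw [abs_le]
      rw [h₁] at a6 ⊢
      constructor <;> nlinarith
    · have htg : t ≤ g := le_of_mul_le_mul_left a5 (lt_of_le_of_ne hp₁ h₁.symm)
      have ht0 : 0 ≤ t := nonneg_of_mul_nonneg_right a4 (lt_of_le_of_ne hp₁ h₁.symm)
      rw [← sub_mul, abs_mul, abs_of_nonneg ht0]
      calc |p₁ - p₂| * t ≤ |p₁ - p₂| * g := mul_le_mul_of_nonneg_left htg (abs_nonneg _)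
        _ = |(p₁ - p₂) * g| := by rw [abs_mul, abs_of_nonneg hg0]
        _ ≤ _ := by rw [abs_le]; constructor <;> nlinarith
  rw [abs_le] at key ⊢
  constructor <;> linarith

end Averaged

/-! ### Haar states with signs -/

section Signed

variable {I : Type} [Fintype I] {n ℓ : ℕ} {K : Type} [Fintype K]

/-- The averaged density matrix of `⨂ i, φ (x i)` multiplied by a random sign vector `s k`. -/
def signedMoment (s : K → (Fin ℓ → Fin n → Bool) → ℂ) (x : Fin ℓ → I)
    (u v : Fin ℓ → Fin n → Bool) : ℂ :=
  (∑ k, s k u * star (s k v)) / Fintype.card K * moment x u v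

theorem sum_mul_signedMoment (s : K → (Fin ℓ → Fin n → Bool) → ℂ) (x : Fin ℓ → I)
    (c : (Fin ℓ → Fin n → Bool) → (Fin ℓ → Fin n → Bool) → ℂ) :
    ∑ u, ∑ v, c u v * signedMoment s x u v =
      (∑ k, ∫ φ, ∑ u, ∑ v, c u v * ((s k u * prodVec x φ u) * star (s k v * prodVec x φ v))
        ∂(haarFamily I n)) / Fintype.card K := by
  have hint : ∀ k u v, Integrable (fun φ : I → PureState n =>
      c u v * ((s k u * prodVec x φ u) * star (s k v * prodVec x φ v))) (haarFamily I n) :=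
    fun k u v => integrable_of_continuous (continuous_const.mul
      ((continuous_const.mul (continuous_prodVec x u)).mul
        (continuous_const.mul (continuous_prodVec x v)).star))
  have h : ∀ k, ∫ φ, ∑ u, ∑ v, c u v * ((s k u * prodVec x φ u) * star (s k v * prodVec x φ v))
        ∂(haarFamily I n) = ∑ u, ∑ v, c u v * (s k u * star (s k v)) * moment x u v := by
    intro k
    rw [integral_finsetSum _ fun u _ => integrable_finsetSum _ fun v _ => hint k u v]
    refine Finset.sum_congr rfl fun u _ => ?_
    rw [integral_finsetSum _ fun v _ => hint k u v]
    refine Finset.sum_congr rfl fun v _ => ?_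
    rw [moment, ← integral_const_mul]
    refine integral_congr_ae (ae_of_all _ fun φ => ?_)
    dsimp only
    rw [star_mul']
    ring
  simp only [h, Finset.sum_div]
  conv_rhs => rw [Finset.sum_comm]
  refine Finset.sum_congr rfl fun u _ => ?_
  rw [Finset.sum_comm]
  refine Finset.sum_congr rfl fun v _ => ?_
  rw [signedMoment, Finset.sum_div, Finset.sum_mul, Finset.mul_sum]
  exact Finset.sum_congr rfl fun k _ => by ring

theorem sum_mul_signedMoment_ofReal (s : K → (Fin ℓ → Fin n → Bool) → ℂ) (x : Fin ℓ → I)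
    (c : (Fin ℓ → Fin n → Bool) → (Fin ℓ → Fin n → Bool) → ℂ)
    (q : ((Fin ℓ → Fin n → Bool) → ℂ) → ℝ)
    (hq : ∀ Ψ, (∑ u, ∑ v, c u v * (Ψ u * star (Ψ v))).re = q Ψ) :
    (∑ u, ∑ v, c u v * signedMoment s x u v).re =
      (∑ k, ∫ φ, q (fun u => s k u * prodVec x φ u) ∂(haarFamily I n)) / Fintype.card K := by
  rw [sum_mul_signedMoment, Complex.div_natCast_re, Complex.re_sum]
  congr 1
  refine Finset.sum_congr rfl fun k _ => ?_
  rw [← Complex.reCLM_apply, ← ContinuousLinearMap.integral_comp_comm]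
  · simp only [Complex.reCLM_apply, hq]
  · exact integrable_finsetSum _ fun u _ => integrable_finsetSum _ fun v _ =>
      integrable_of_continuous (continuous_const.mul
        ((continuous_const.mul (continuous_prodVec x u)).mul
          (continuous_const.mul (continuous_prodVec x v)).star))

theorem isAveraged_signedMoment (s : K → (Fin ℓ → Fin n → Bool) → ℂ) (x : Fin ℓ → I) :
    IsAveraged (signedMoment s x) := by
  intro c hc
  rw [sum_mul_signedMoment_ofReal s x c _ fun _ => rfl]
  exact div_nonneg (Finset.sum_nonneg fun k _ => integral_nonneg fun φ => hc _) (by positivity)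

theorem signedMoment_star (s : K → (Fin ℓ → Fin n → Bool) → ℂ) (x : Fin ℓ → I)
    (u v : Fin ℓ → Fin n → Bool) : star (signedMoment s x u v) = signedMoment s x v u := by
  have h : star (moment x u v) = moment x v u := by
    rw [moment, moment, Complex.star_def, ← integral_conj]
    refine integral_congr_ae (ae_of_all _ fun φ => ?_)
    simp [mul_comm]
  rw [signedMoment, signedMoment, star_mul', h, star_div₀, star_sum]
  congr 2
  · exact Finset.sum_congr rfl fun k _ => by rw [star_mul', star_star, mul_comm]
  · simp

theorem signedMoment_self [Nonempty K] {s : K → (Fin ℓ → Fin n → Bool) → ℂ}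
    (hs : ∀ k u, ‖s k u‖ = 1) (x : Fin ℓ → I) (u : Fin ℓ → Fin n → Bool) :
    signedMoment s x u u = weight x u := by
  have h : ∀ k, s k u * star (s k u) = 1 := fun k => by
    rw [Complex.star_def, Complex.mul_conj, Complex.normSq_eq_norm_sq, hs, one_pow,
      Complex.ofReal_one]
  have h2 := moment_comp_perm x u (Equiv.refl _) rfl
  rw [signedMoment, Finset.sum_congr rfl fun k _ => h k]
  change _ * moment x u (u ∘ Equiv.refl _) = _
  rw [h2]
  simp

/-- Haar states with labels `y` and random signs look like Haar states with labels `x`, provided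
that on good basis vectors the signs cancel all entries of the density matrix that are not due to
permutations that preserve `x`. -/
theorem signed_haar_close {J : Type} [Fintype J] [Nonempty K] (hn : 0 < n)
    (hd : 2 * ℓ ^ 2 ≤ 2 ^ n)
    {s : K → (Fin ℓ → Fin n → Bool) → ℂ} (hs : ∀ k u, ‖s k u‖ = 1) (x : Fin ℓ → I) (y : J)
    (good : (Fin ℓ → Fin n → Bool) → Prop) [DecidablePred good]
    (hinj : ∀ u, good u → Function.Injective u)
    (hperm : ∀ (u v) (τ : Equiv.Perm (Fin ℓ)), v ∘ τ = u → good u → good v)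
    (h1 : ∀ (u v) (τ : Equiv.Perm (Fin ℓ)), v ∘ τ = u → x ∘ τ = x → ∀ k, s k u = s k v)
    (h0 : ∀ (u v) (τ : Equiv.Perm (Fin ℓ)), v ∘ τ = u → x ∘ τ ≠ x → good u →
      ∑ k, s k u * star (s k v) = 0)
    {c : (Fin ℓ → Fin n → Bool) → (Fin ℓ → Fin n → Bool) → ℂ}
    {q : ((Fin ℓ → Fin n → Bool) → ℂ) → ℝ}
    (hq : ∀ Ψ, (∑ u, ∑ v, c u v * (Ψ u * star (Ψ v))).re = q Ψ)
    (hq0 : ∀ Ψ, 0 ≤ q Ψ) (hq1 : ∀ Ψ, q Ψ ≤ ∑ u, ‖Ψ u‖ ^ 2) :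
    |(∑ k, ∫ φ, q (fun u => s k u * ∏ i, φ.1 (u i)) ∂(haarState n)) / Fintype.card K -
        ∫ φ, q (prodVec x φ) ∂(haarFamily I n)| ≤
      4 * (3 * (ℓ : ℝ) ^ 2 / 2 ^ n +
        2 * (Finset.univ.filter fun u => ¬good u).card / (2 ^ n : ℝ) ^ ℓ) := by
  classical
  obtain ⟨p₁, hp₁, hw₁⟩ := weight_eq_of_injective (n := n) (fun _ : Fin ℓ => y)
  obtain ⟨p₂, -, hw₂⟩ := weight_eq_of_injective (n := n) x
  let M₁ := signedMoment s fun _ : Fin ℓ => y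
  let M₂ := signedMoment (fun (_ : Unit) (_ : Fin ℓ → Fin n → Bool) => (1 : ℂ)) x
  let T : (Fin ℓ → Fin n → Bool) → (Fin ℓ → Fin n → Bool) → ℂ := fun u v =>
    if ∃ τ : Equiv.Perm (Fin ℓ), v ∘ τ = u ∧ x ∘ τ = x then 1 else 0
  have back : ∀ {u v : Fin ℓ → Fin n → Bool} {τ : Equiv.Perm (Fin ℓ)}, v ∘ τ = u →
      v = u ∘ τ.symm := fun {u v τ} h => by rw [← h]; funext i; simp
  have hMT₁ : ∀ u v, good u → M₁ u v = p₁ * T u v := by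
    intro u v hu
    by_cases hT : ∃ τ : Equiv.Perm (Fin ℓ), v ∘ τ = u ∧ x ∘ τ = x
    · obtain ⟨τ, hτ, hx⟩ := id hT
      simp only [T, if_pos hT, mul_one, M₁]
      have e1 : moment (fun _ : Fin ℓ => y) u v = weight (fun _ : Fin ℓ => y) u := by
        rw [back hτ]
        exact moment_comp_perm _ u τ.symm rfl
      have e2 : ∀ k, s k u * star (s k v) = 1 := fun k => by
        rw [← h1 u v τ hτ hx, Complex.star_def, Complex.mul_conj, Complex.normSq_eq_norm_sq, hs,
          one_pow, Complex.ofReal_one]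
      rw [signedMoment, e1, hw₁ u (hinj u hu), Finset.sum_congr rfl fun k _ => e2 k]
      simp
    · simp only [T, if_neg hT, mul_zero, M₁, signedMoment]
      by_cases hm : moment (fun _ : Fin ℓ => y) u v = 0
      · rw [hm, mul_zero]
      · obtain ⟨τ, hτ, -⟩ := moment_eq_zero_or _ (hinj u hu) hm
        rw [h0 u v τ hτ (fun hx => hT ⟨τ, hτ, hx⟩) hu, zero_div, zero_mul]
  have hMT₂ : ∀ u v, good u → M₂ u v = p₂ * T u v := by
    intro u v hu
    by_cases hT : ∃ τ : Equiv.Perm (Fin ℓ), v ∘ τ = u ∧ x ∘ τ = x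
    · obtain ⟨τ, hτ, hx⟩ := id hT
      have e1 : moment x u v = weight x u := by
        rw [back hτ]
        refine moment_comp_perm _ u τ.symm ?_
        conv_lhs => rw [← hx]
        funext i
        simp
      simp [T, if_pos hT, M₂, signedMoment, e1, hw₂ u (hinj u hu)]
    · have hm : moment x u v = 0 := by
        by_contra hm
        exact hT (moment_eq_zero_or x (hinj u hu) hm)
      simp [T, if_neg hT, M₂, signedMoment, hm]
  have hz : ∀ (M : (Fin ℓ → Fin n → Bool) → (Fin ℓ → Fin n → Bool) → ℂ) (p : ℝ),
      (∀ u v, star (M u v) = M v u) → (∀ u v, good u → M u v = p * T u v) →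
      ∀ u v, ¬(good u ↔ good v) → M u v = 0 := by
    intro M p hst hMT
    have h : ∀ u v, good u → ¬good v → M u v = 0 := by
      intro u v hu hv
      rw [hMT u v hu]
      simp only [T]
      rw [if_neg, mul_zero]
      rintro ⟨τ, hτ, -⟩
      exact hv (hperm u v τ hτ hu)
    intro u v huv
    by_cases hu : good u
    · exact h u v hu fun hv => huv ⟨fun _ => hv, fun _ => hu⟩
    · have hv : good v := by
        by_contra hv
        exact huv ⟨fun h => absurd h hu, fun h => absurd h hv⟩
      rw [← hst v u, h v u hv hu, star_zero]
  have hT : ∀ u, good u → T u u = 1 := fun u _ => if_pos ⟨Equiv.refl _, rfl, rfl⟩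
  have d₁ : ∀ u, (M₁ u u).re = weight (fun _ : Fin ℓ => y) u := fun u => by
    simp only [M₁]
    rw [signedMoment_self hs, Complex.ofReal_re]
  have d₂ : ∀ u, (M₂ u u).re = weight x u := fun u => by
    simp only [M₂]
    rw [signedMoment_self (fun _ _ => norm_one), Complex.ofReal_re]
  have main := IsAveraged.close (isAveraged_signedMoment s fun _ : Fin ℓ => y)
    (isAveraged_signedMoment (fun (_ : Unit) (_ : Fin ℓ → Fin n → Bool) => (1 : ℂ)) x)
    (c := c) (fun Ψ => by rw [hq]; exact hq0 Ψ) (fun Ψ => by rw [hq]; exact hq1 Ψ) good hp₁ hT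
    hMT₁ hMT₂ (hz M₁ p₁ (signedMoment_star s _) hMT₁)
    (hz M₂ p₂ (signedMoment_star _ x) hMT₂)
    (by simp only [M₁] at d₁; rw [Finset.sum_congr rfl fun u _ => d₁ u, sum_weight])
    (by simp only [M₂] at d₂; rw [Finset.sum_congr rfl fun u _ => d₂ u, sum_weight])
  rw [sum_mul_signedMoment_ofReal s _ c q hq, sum_mul_signedMoment_ofReal _ x c q hq] at main
  simp only [M₁] at d₁
  simp only [M₂] at d₂
  simp only [d₁, d₂] at main
  have b₁ := weight_bad_le hn hd (fun _ : Fin ℓ => y) good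
  have b₂ := weight_bad_le hn hd x good
  have hqc : ∀ k, Continuous fun φ : PureState n => q (fun u => s k u * ∏ i, φ.1 (u i)) := by
    intro k
    simp only [← hq]
    have hc : ∀ u : Fin ℓ → Fin n → Bool, Continuous fun φ : PureState n =>
        s k u * ∏ i, φ.1 (u i) := fun u =>
      continuous_const.mul (continuous_finsetProd _ fun i _ => PureState.continuous_coord (u i))
    exact Complex.continuous_re.comp (continuous_finsetSum _ fun u _ =>
      continuous_finsetSum _ fun v _ => continuous_const.mul ((hc u).mul (hc v).star))
  have e₁ : ∀ k, ∫ φ, q (fun u => s k u * prodVec (fun _ : Fin ℓ => y) φ u) ∂(haarFamily J n) =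
      ∫ φ, q (fun u => s k u * ∏ i, φ.1 (u i)) ∂(haarState n) := fun k =>
    integral_eval_family (hqc k) y
  rw [Finset.sum_congr rfl fun k _ => e₁ k] at main
  simp only [Finset.univ_unique, one_mul, Finset.sum_const, Finset.card_singleton, one_smul,
    Fintype.card_unit, Nat.cast_one, div_one] at main
  refine main.trans ?_
  linarith

end Signed

/-! ### The acceptance probability as a quadratic form -/

section Form

variable {ℓ m n : ℕ}

/-- Acceptance on the strings `x` and a state vector indexed by tuples. -/
def acceptVec (A : Distinguisher ((Fin ℓ × Fin m) ⊕ (Fin ℓ × Fin n))) (x : Fin ℓ → Fin m → Bool)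
    (Ψ : (Fin ℓ → Fin n → Bool) → ℂ) : ℝ :=
  A.accept (withStrings x (outer fun w => Ψ fun i j => w (i, j)))

theorem acceptVec_eq (A : Distinguisher ((Fin ℓ × Fin m) ⊕ (Fin ℓ × Fin n)))
    (x : Fin ℓ → Fin m → Bool) (Ψ : (Fin ℓ → Fin n → Bool) → ℂ) :
    acceptVec A x Ψ = ∑ b, if b A.out = true then
      ‖runCircuit A.gates (padVec A.anc (stringsVec x fun w => Ψ fun i j => w (i, j))) b‖ ^ 2
      else 0 := by
  rw [acceptVec, withStrings_outer, Distinguisher.accept_outer]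

theorem acceptVec_nonneg (A : Distinguisher ((Fin ℓ × Fin m) ⊕ (Fin ℓ × Fin n)))
    (x : Fin ℓ → Fin m → Bool) (Ψ : (Fin ℓ → Fin n → Bool) → ℂ) : 0 ≤ acceptVec A x Ψ := by
  rw [acceptVec_eq]
  exact Finset.sum_nonneg fun b _ => by split_ifs <;> positivity

theorem acceptVec_le (A : Distinguisher ((Fin ℓ × Fin m) ⊕ (Fin ℓ × Fin n)))
    (x : Fin ℓ → Fin m → Bool) (Ψ : (Fin ℓ → Fin n → Bool) → ℂ) :
    acceptVec A x Ψ ≤ ∑ u, ‖Ψ u‖ ^ 2 := by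
  rw [acceptVec_eq]
  calc _ ≤ ∑ b, ‖runCircuit A.gates
        (padVec A.anc (stringsVec x fun w => Ψ fun i j => w (i, j))) b‖ ^ 2 :=
        Finset.sum_le_sum fun b _ => by split_ifs <;> first | exact le_rfl | positivity
    _ = _ := by
        rw [runCircuit_norm, padVec_norm, stringsVec_norm]
        exact Fintype.sum_equiv (Equiv.curry (Fin ℓ) (Fin n) Bool) _ _ fun w => rfl

theorem exists_acceptVec_form (A : Distinguisher ((Fin ℓ × Fin m) ⊕ (Fin ℓ × Fin n)))
    (x : Fin ℓ → Fin m → Bool) :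
    ∃ c : (Fin ℓ → Fin n → Bool) → (Fin ℓ → Fin n → Bool) → ℂ, ∀ Ψ,
      (∑ u, ∑ v, c u v * (Ψ u * star (Ψ v))).re = acceptVec A x Ψ := by
  let d : (((Fin ℓ × Fin m) ⊕ (Fin ℓ × Fin n)) ⊕ Fin A.anc → Bool) →
      (Fin ℓ → Fin n → Bool) → ℂ := fun b u =>
    runCircuit A.gates (padVec A.anc (stringsVec x fun w => if (fun i j => w (i, j)) = u then 1
      else 0)) b
  have hd : ∀ (Ψ : (Fin ℓ → Fin n → Bool) → ℂ) b, runCircuit A.gates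
      (padVec A.anc (stringsVec x fun w => Ψ fun i j => w (i, j))) b = ∑ u, d b u * Ψ u := by
    intro Ψ b
    simp only [d, runCircuit, Matrix.mulVec, dotProduct, Finset.sum_mul]
    rw [Finset.sum_comm]
    refine Finset.sum_congr rfl fun a _ => ?_
    simp only [mul_assoc]
    rw [← Finset.mul_sum]
    congr 1
    simp only [padVec, stringsVec]
    split_ifs <;> simp
  refine ⟨fun u v => ∑ b, if b A.out = true then d b u * star (d b v) else 0, fun Ψ => ?_⟩
  have h : ∑ u, ∑ v, (∑ b, if b A.out = true then d b u * star (d b v) else 0) *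
      (Ψ u * star (Ψ v)) = (acceptVec A x Ψ : ℂ) := by
    rw [acceptVec_eq, Complex.ofReal_sum]
    simp only [Finset.sum_mul]
    rw [Finset.sum_congr rfl fun u _ => Finset.sum_comm, Finset.sum_comm]
    refine Finset.sum_congr rfl fun b _ => ?_
    split_ifs
    · rw [hd, ← Complex.normSq_eq_norm_sq, ← Complex.mul_conj, ← Complex.star_def, star_sum,
        Finset.sum_mul_sum]
      refine Finset.sum_congr rfl fun u _ => Finset.sum_congr rfl fun v _ => ?_
      rw [star_mul']
      ring
    · simp
  rw [h, Complex.ofReal_re]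

end Form

/-! ### Good tuples -/

section Good

variable {ℓ m n lam : ℕ}

/-- `(-1) ^ b` -/
def sgn (b : Bool) : ℂ := if b = true then -1 else 1

theorem sgn_mul_self (b : Bool) : sgn b * sgn b = 1 := by cases b <;> simp [sgn]

theorem star_sgn (b : Bool) : star (sgn b) = sgn b := by cases b <;> simp [sgn]

theorem sgn_ne_zero (b : Bool) : sgn b ≠ 0 := by cases b <;> simp [sgn]

theorem sgn_injective : Function.Injective sgn := by
  intro a b
  cases a <;> cases b <;> simp [sgn] <;> norm_num

theorem prod_sgn_eq_or {ι : Type} (s : Finset ι) (b : ι → Bool) :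
    ∏ i ∈ s, sgn (b i) = 1 ∨ ∏ i ∈ s, sgn (b i) = -1 := by
  classical
  induction s using Finset.induction_on with
  | empty => simp
  | insert i s hi ih =>
    rw [Finset.prod_insert hi]
    rcases ih with h | h <;> rw [h] <;> cases b i <;> simp [sgn]

/-- The positions below `lam` fall into `m` classes; the restrictions of the strings `u i` to every
class are linearly independent in the weak sense that no sum over a nonempty set vanishes. -/
def IsGood (lam m : ℕ) (u : Fin ℓ → Fin n → Bool) : Prop :=
  ∀ j < m, ∀ T : Finset (Fin ℓ), T.Nonempty →
    ∃ q < lam / m, ∏ i ∈ T, sgn (bitAt (u i) (j + q * m)) = -1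

theorem IsGood.injective (hm : 0 < m) {u : Fin ℓ → Fin n → Bool} (hu : IsGood lam m u) :
    Function.Injective u := by
  intro i i' h
  by_contra hne
  obtain ⟨q, -, hq⟩ := hu 0 hm {i, i'} ⟨i, by simp⟩
  rw [Finset.prod_pair hne, h, sgn_mul_self] at hq
  norm_num at hq

theorem IsGood.perm {u v : Fin ℓ → Fin n → Bool} {τ : Equiv.Perm (Fin ℓ)} (h : v ∘ τ = u)
    (hu : IsGood lam m u) : IsGood lam m v := by
  intro j hj T hT
  obtain ⟨q, hq, hp⟩ := hu j hj (T.map τ.symm.toEmbedding) (by simpa using hT)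
  refine ⟨q, hq, ?_⟩
  rw [← hp, Finset.prod_map]
  refine Finset.prod_congr rfl fun i _ => ?_
  rw [← h]
  simp

theorem prod_phaseSign (k : Fin lam → Bool) (x : Fin ℓ → Fin m → Bool)
    (u : Fin ℓ → Fin n → Bool) :
    ∏ i, phaseSign lam k (x i) (u i) =
      ∏ t : Fin lam, ∏ i, sgn (k t && (bitAt (x i) (t % m) && bitAt (u i) t)) := by
  rw [Finset.prod_comm]
  refine Finset.prod_congr rfl fun i _ => ?_
  rw [phaseSign, Finset.prod_range]
  refine Finset.prod_congr rfl fun t _ => ?_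
  rw [bitAt_of_lt k t.2]
  simp [sgn]

theorem IsGood.sum_phaseSign {x : Fin ℓ → Fin m → Bool} {u v : Fin ℓ → Fin n → Bool}
    {τ : Equiv.Perm (Fin ℓ)} (h : v ∘ τ = u) (hx : x ∘ τ ≠ x) (hu : IsGood lam m u) :
    ∑ k : Fin lam → Bool, (∏ i, phaseSign lam k (x i) (u i)) *
      star (∏ i, phaseSign lam k (x i) (v i)) = 0 := by
  obtain ⟨i₀, hi₀⟩ := Function.ne_iff.1 hx
  obtain ⟨j, hj⟩ := Function.ne_iff.1 hi₀
  obtain ⟨q, hq, hp⟩ := hu j j.2 (Finset.univ.filter fun i => x (τ i) j ≠ x i j)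
    ⟨i₀, by simpa using hj⟩
  have hm : 0 < m := j.pos
  have ht : j + q * m < lam := by
    have h1 : (q + 1) * m ≤ lam / m * m := Nat.mul_le_mul_right m hq
    have h2 := Nat.div_mul_le_self lam m
    have := j.2
    nlinarith
  let g : Fin lam → Bool → ℂ := fun t b =>
    (∏ i, sgn (b && (bitAt (x i) (t % m) && bitAt (u i) t))) *
      ∏ i, sgn (b && (bitAt (x i) (t % m) && bitAt (v i) t))
  have hg : ∀ k : Fin lam → Bool, (∏ i, phaseSign lam k (x i) (u i)) *
      star (∏ i, phaseSign lam k (x i) (v i)) = ∏ t, g t (k t) := by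
    intro k
    rw [prod_phaseSign, prod_phaseSign]
    simp only [star_prod, star_sgn, g]
    rw [← Finset.prod_mul_distrib]
  rw [Finset.sum_congr rfl fun k _ => hg k]
  have hsum : ∑ k : Fin lam → Bool, ∏ t, g t (k t) = ∏ t, ∑ b, g t b := by
    rw [Finset.prod_univ_sum, Fintype.piFinset_univ]
  rw [hsum]
  refine Finset.prod_eq_zero (Finset.mem_univ (⟨j + q * m, ht⟩ : Fin lam)) ?_
  rw [Fintype.sum_bool]
  have hmod : (j + q * m) % m = j := by
    rw [Nat.add_mul_mod_self_right, Nat.mod_eq_of_lt j.2]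
  have hf : g ⟨j + q * m, ht⟩ false = 1 := by simp [g, sgn]
  have htrue : g ⟨j + q * m, ht⟩ true = -1 := by
    simp only [g, Bool.true_and, hmod]
    rw [← Equiv.prod_comp τ fun i => sgn (bitAt (x i) j && bitAt (v i) (j + q * m)),
      ← Finset.prod_mul_distrib, ← hp, Finset.prod_filter]
    refine Finset.prod_congr rfl fun i _ => ?_
    rw [show v (τ i) = u i from congrFun h i, bitAt_of_lt _ j.2, bitAt_of_lt _ j.2]
    generalize bitAt (u i) (j + q * m) = b
    cases x i j <;> cases x (τ i) j <;> cases b <;> simp [sgn]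
  rw [hf, htrue, neg_add_cancel]

theorem prod_phaseSign_perm {x : Fin ℓ → Fin m → Bool} {u v : Fin ℓ → Fin n → Bool}
    {τ : Equiv.Perm (Fin ℓ)} (h : v ∘ τ = u) (hx : x ∘ τ = x) (k : Fin lam → Bool) :
    ∏ i, phaseSign lam k (x i) (u i) = ∏ i, phaseSign lam k (x i) (v i) := by
  rw [← Equiv.prod_comp τ fun i => phaseSign lam k (x i) (v i)]
  refine Finset.prod_congr rfl fun i _ => ?_
  rw [show v (τ i) = u i from congrFun h i, show x (τ i) = x i from congrFun hx i]

/-- Few tuples have a vanishing sum over `T` on the positions `pos q`. -/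
theorem card_prod_sgn_eq_one_le {N : ℕ} (T : Finset (Fin ℓ)) (hT : T.Nonempty)
    (pos : Fin N → Fin n) (hpos : Function.Injective pos) :
    (Finset.univ.filter fun u : Fin ℓ → Fin n → Bool =>
      ∀ q, ∏ i ∈ T, sgn (u i (pos q)) = 1).card * 2 ^ N ≤ (2 ^ n) ^ ℓ := by
  obtain ⟨i₀, hi₀⟩ := hT
  let Z : Finset (Fin ℓ × Fin n) := Finset.univ.image fun q => (i₀, pos q)
  have hZ : Z.card = N := by
    rw [Finset.card_image_of_injective _ fun q q' h => hpos (Prod.ext_iff.1 h).2]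
    simp
  have hle : (Finset.univ.filter fun u : Fin ℓ → Fin n → Bool =>
      ∀ q, ∏ i ∈ T, sgn (u i (pos q)) = 1).card ≤
      (Finset.univ : Finset ({p // p ∈ Zᶜ} → Bool)).card := by
    refine Finset.card_le_card_of_injOn (fun u p => u p.1.1 p.1.2) (fun _ _ => by simp) ?_
    intro u hu v hv huv
    have hu' := (Finset.mem_filter.1 (Finset.mem_coe.1 hu)).2
    have hv' := (Finset.mem_filter.1 (Finset.mem_coe.1 hv)).2
    have hoff : ∀ i a, (i, a) ∉ Z → u i a = v i a := fun i a h =>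
      congrFun huv ⟨(i, a), Finset.mem_compl.2 h⟩
    funext i a
    by_cases h : (i, a) ∈ Z
    · obtain ⟨q, -, hq⟩ := Finset.mem_image.1 h
      obtain ⟨rfl, rfl⟩ := Prod.ext_iff.1 hq
      have h1 := (hu' q).trans (hv' q).symm
      rw [← Finset.mul_prod_erase T _ hi₀, ← Finset.mul_prod_erase T _ hi₀] at h1
      have h2 : ∏ i ∈ T.erase i₀, sgn (u i (pos q)) = ∏ i ∈ T.erase i₀, sgn (v i (pos q)) := by
        refine Finset.prod_congr rfl fun i hi => ?_
        rw [hoff]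
        intro hmem
        obtain ⟨q', -, hq'⟩ := Finset.mem_image.1 hmem
        exact Finset.ne_of_mem_erase hi (Prod.ext_iff.1 hq').1.symm
      rw [h2] at h1
      exact sgn_injective (mul_right_cancel₀
        (Finset.prod_ne_zero_iff.2 fun i _ => sgn_ne_zero _) h1)
    · exact hoff i a h
  have hc : (Finset.univ : Finset ({p // p ∈ Zᶜ} → Bool)).card = 2 ^ (Zᶜ).card := by
    rw [Finset.card_univ, Fintype.card_fun, Fintype.card_bool, Fintype.card_coe]
  have hcard : (Zᶜ).card + N = ℓ * n := by
    have := Finset.card_compl_add_card Z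
    rwa [hZ, Fintype.card_prod, Fintype.card_fin, Fintype.card_fin] at this
  calc _ ≤ 2 ^ (Zᶜ).card * 2 ^ N := Nat.mul_le_mul_right _ (hc ▸ hle)
    _ = (2 ^ n) ^ ℓ := by rw [← pow_add, hcard, ← pow_mul, mul_comm]

theorem card_not_isGood_le (hm : 0 < m) (hn : lam < n)
    [DecidablePred (IsGood (ℓ := ℓ) (n := n) lam m)] :
    (Finset.univ.filter fun u : Fin ℓ → Fin n → Bool => ¬IsGood lam m u).card * 2 ^ (lam / m) ≤
      m * 2 ^ ℓ * (2 ^ n) ^ ℓ := by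
  classical
  have hlt : ∀ (j : Fin m) (q : Fin (lam / m)), (j : ℕ) + q * m < n := by
    intro j q
    have h1 : ((q : ℕ) + 1) * m ≤ lam / m * m := Nat.mul_le_mul_right m q.2
    have h2 := Nat.div_mul_le_self lam m
    have := j.2
    nlinarith
  let pos : Fin m → Fin (lam / m) → Fin n := fun j q => ⟨j + q * m, hlt j q⟩
  have hpos : ∀ j, Function.Injective (pos j) := by
    intro j q q' h
    have h1 : (j : ℕ) + q * m = j + q' * m := congrArg Fin.val h
    exact Fin.ext (Nat.eq_of_mul_eq_mul_right hm (by omega))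
  let S : Fin m × Finset (Fin ℓ) → Finset (Fin ℓ → Fin n → Bool) := fun p =>
    if p.2.Nonempty then Finset.univ.filter fun u => ∀ q, ∏ i ∈ p.2, sgn (u i (pos p.1 q)) = 1
    else ∅
  have hsub : (Finset.univ.filter fun u : Fin ℓ → Fin n → Bool => ¬IsGood lam m u) ⊆
      Finset.univ.biUnion S := by
    intro u hu
    have hu' := (Finset.mem_filter.1 hu).2
    simp only [IsGood] at hu'
    push Not at hu'
    obtain ⟨j, hj, T, hT, h⟩ := hu'
    refine Finset.mem_biUnion.2 ⟨(⟨j, hj⟩, T), Finset.mem_univ _, ?_⟩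
    simp only [S, if_pos hT, Finset.mem_filter, Finset.mem_univ, true_and]
    intro q
    refine (prod_sgn_eq_or _ _).resolve_right fun h' => h q q.2 ?_
    rw [← h']
    refine Finset.prod_congr rfl fun i _ => ?_
    rw [bitAt_of_lt _ (hlt ⟨j, hj⟩ q)]
  calc _ ≤ (∑ p, (S p).card) * 2 ^ (lam / m) :=
        Nat.mul_le_mul_right _ ((Finset.card_le_card hsub).trans Finset.card_biUnion_le)
    _ = ∑ p, (S p).card * 2 ^ (lam / m) := Finset.sum_mul _ _ _
    _ ≤ ∑ _p : Fin m × Finset (Fin ℓ), (2 ^ n) ^ ℓ := by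
        refine Finset.sum_le_sum fun p _ => ?_
        simp only [S]
        split_ifs with h
        · exact card_prod_sgn_eq_one_le p.2 h (pos p.1) (hpos p.1)
        · simp
    _ = _ := by simp

/-- Random phases on copies of one Haar state are as good as independent Haar states. -/
theorem phased_haar_close (hm : 0 < m) (hn : lam < n) (hd : 2 * ℓ ^ 2 ≤ 2 ^ n)
    (x : Fin ℓ → Fin m → Bool) (A : Distinguisher ((Fin ℓ × Fin m) ⊕ (Fin ℓ × Fin n))) :
    |(∑ k : Fin lam → Bool, ∫ φ, A.accept (withStrings x
          (tensor fun i => (PureState.phased lam k (x i) φ).density)) ∂(haarState n)) / 2 ^ lam -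
        ∫ φ : (Fin m → Bool) → PureState n, A.accept (withStrings x
          (tensor fun i => (φ (x i)).density)) ∂(Measure.pi fun _ => haarState n)| ≤
      4 * (3 * (ℓ : ℝ) ^ 2 / 2 ^ n + 2 * (m * 2 ^ ℓ / 2 ^ (lam / m))) := by
  classical
  obtain ⟨c, hc⟩ := exists_acceptVec_form A x
  have main := signed_haar_close (K := Fin lam → Bool) (by omega : 0 < n) hd
    (s := fun k u => ∏ i, phaseSign lam k (x i) (u i))
    (fun k u => by rw [norm_prod]; exact Finset.prod_eq_one fun i _ => phaseSign_norm _ _ _)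
    x () (IsGood lam m) (fun u hu => hu.injective hm) (fun u v τ h hu => hu.perm h)
    (fun u v τ h hx k => prod_phaseSign_perm h hx k)
    (fun u v τ h hx hu => hu.sum_phaseSign h hx) hc (acceptVec_nonneg A x) (acceptVec_le A x)
  have e₁ : ∀ (k : Fin lam → Bool) (φ : PureState n), acceptVec A x
      (fun u => (∏ i, phaseSign lam k (x i) (u i)) * ∏ i, φ.1 (u i)) =
      A.accept (withStrings x (tensor fun i => (PureState.phased lam k (x i) φ).density)) := by
    intro k φ
    rw [tensor_density fun i => PureState.phased lam k (x i) φ, acceptVec]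
    congr 3
    funext w
    simp only [tensorVec, PureState.phased, Finset.prod_mul_distrib]
  have e₂ : ∀ φ : (Fin m → Bool) → PureState n, acceptVec A x (prodVec x φ) =
      A.accept (withStrings x (tensor fun i => (φ (x i)).density)) := by
    intro φ
    rw [tensor_density fun i => φ (x i), acceptVec]
    rfl
  simp only [e₁, e₂] at main
  have hK : ((Fintype.card (Fin lam → Bool) : ℕ) : ℝ) = 2 ^ lam := by simp
  rw [hK] at main
  refine main.trans ?_
  have hbad : 2 * ((Finset.univ.filter fun u : Fin ℓ → Fin n → Bool => ¬IsGood lam m u).card : ℝ) /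
      (2 ^ n : ℝ) ^ ℓ ≤ 2 * (m * 2 ^ ℓ / 2 ^ (lam / m)) := by
    rw [mul_div_assoc]
    refine mul_le_mul_of_nonneg_left ?_ zero_le_two
    rw [div_le_div_iff₀ (by positivity) (by positivity)]
    exact_mod_cast card_not_isGood_le (ℓ := ℓ) hm hn
  linarith

end Good

/-! ### Asymptotics -/

theorem negligible_rpow_exp {δ b : ℝ} (hδ : 0 < δ) (hb : 0 < b) :
    Negligible fun lam : ℕ => Real.exp (-b * (lam : ℝ) ^ δ) := by
  intro N
  have h := (tendsto_rpow_mul_exp_neg_mul_atTop_nhds_zero (N / δ) b hb).comp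
    ((tendsto_rpow_atTop hδ).comp tendsto_natCast_atTop_atTop)
  refine h.congr fun lam => ?_
  simp only [Function.comp]
  rw [← Real.rpow_mul (Nat.cast_nonneg lam), mul_div_cancel₀ _ hδ.ne', Real.rpow_natCast]

theorem Negligible.of_le {f g : ℕ → ℝ} (hg : Negligible g) (h : ∀ᶠ lam in atTop, |f lam| ≤ g lam) :
    Negligible f :=
  hg.trans_eventually_abs_le (h.mono fun _ h => h.trans (le_abs_self _))

section Lengths

variable {c : ℝ} {m : ℕ → ℕ}

theorem length_pos (hc0 : 0 ≤ c) (hm : ∀ lam : ℕ, |(m lam : ℝ) - (lam : ℝ) ^ c| < 1)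
    (lam : ℕ) (hlam : 0 < lam) : 0 < m lam := by
  have h1 : (1 : ℝ) ≤ (lam : ℝ) ^ c := Real.one_le_rpow (by exact_mod_cast hlam) hc0
  have h2 := (abs_lt.1 (hm lam)).1
  have h3 : (0 : ℝ) < m lam := by linarith
  exact_mod_cast h3

theorem length_le (hc0 : 0 ≤ c) (hc1 : c < 1)
    (hm : ∀ lam : ℕ, |(m lam : ℝ) - (lam : ℝ) ^ c| < 1) (lam : ℕ) : m lam ≤ lam + 1 := by
  have h2 := (abs_lt.1 (hm lam)).2
  rcases Nat.eq_zero_or_pos lam with rfl | hlam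
  · have h1 : ((0 : ℕ) : ℝ) ^ c ≤ 1 := Real.rpow_le_one (by simp) (by simp) hc0
    have h3 : (m 0 : ℝ) < 2 := by linarith
    have : m 0 < 2 := by exact_mod_cast h3
    omega
  · have h1 : (lam : ℝ) ^ c ≤ (lam : ℝ) ^ (1 : ℝ) :=
      Real.rpow_le_rpow_of_exponent_le (by exact_mod_cast hlam) hc1.le
    rw [Real.rpow_one] at h1
    have h3 : (m lam : ℝ) < lam + 1 := by linarith
    have : m lam < lam + 1 := by exact_mod_cast h3
    omega

theorem rpow_le_div_length (hc0 : 0 ≤ c)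
    (hm : ∀ lam : ℕ, |(m lam : ℝ) - (lam : ℝ) ^ c| < 1) (lam : ℕ) (hlam : 0 < lam) :
    (lam : ℝ) ^ (1 - c) / 2 - 1 ≤ (lam / m lam : ℕ) := by
  have hm0 := length_pos hc0 hm lam hlam
  have hl : (0 : ℝ) < lam := by exact_mod_cast hlam
  have h1 : (1 : ℝ) ≤ (lam : ℝ) ^ c := Real.one_le_rpow (by exact_mod_cast hlam) hc0
  have h2 := (abs_lt.1 (hm lam)).2
  have h3 : (lam : ℝ) < ((lam / m lam : ℕ) + 1) * m lam := by
    exact_mod_cast (Nat.div_lt_iff_lt_mul hm0).1 (Nat.lt_succ_self (lam / m lam))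
  have h4 : (lam : ℝ) ^ (1 - c) * (lam : ℝ) ^ c = lam := by
    rw [← Real.rpow_add hl, sub_add_cancel, Real.rpow_one]
  have h5 : ((lam / m lam : ℕ) + 1 : ℝ) * m lam ≤
      ((lam / m lam : ℕ) + 1 : ℝ) * (2 * (lam : ℝ) ^ c) :=
    mul_le_mul_of_nonneg_left (by linarith) (by positivity)
  have h6 : (lam : ℝ) ^ (1 - c) < 2 * ((lam / m lam : ℕ) + 1 : ℝ) := by
    refine lt_of_mul_lt_mul_right ?_ (zero_le_one.trans h1)
    linarith
  linarith

theorem copies_le {ε : ℝ} {ℓ : ℕ → ℕ} (hε : 0 < ε)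
    (hℓ : (fun lam : ℕ => (ℓ lam : ℝ)) =O[atTop]
      fun lam : ℕ => (lam : ℝ) ^ (1 - c) / Real.log lam ^ (1 + ε)) :
    ∀ᶠ lam : ℕ in atTop, (ℓ lam : ℝ) ≤ (lam : ℝ) ^ (1 - c) / 8 := by
  obtain ⟨C, hC0, hC⟩ := hℓ.exists_pos
  have hlog : Tendsto (fun lam : ℕ => Real.log lam ^ (1 + ε)) atTop atTop :=
    (tendsto_rpow_atTop (by linarith)).comp (Real.tendsto_log_atTop.comp
      tendsto_natCast_atTop_atTop)
  filter_upwards [hC.bound, hlog.eventually_ge_atTop (8 * C)] with lam h1 h2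
  have hpos : 0 < Real.log lam ^ (1 + ε) := by linarith
  have hx : (0 : ℝ) ≤ (lam : ℝ) ^ (1 - c) := by positivity
  rw [Real.norm_of_nonneg (by positivity), Real.norm_of_nonneg (by positivity)] at h1
  refine h1.trans ?_
  rw [← mul_div_assoc, div_le_div_iff₀ hpos (by norm_num)]
  nlinarith

theorem eventually_two_mul_sq_le {ℓ n : ℕ → ℕ} (hn : ∀ lam, lam < n lam)
    (h : ∀ᶠ lam in atTop, ℓ lam ≤ lam) : ∀ᶠ lam in atTop, 2 * ℓ lam ^ 2 ≤ 2 ^ n lam := by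
  have h2 := (tendsto_pow_const_div_const_pow_of_one_lt 2 (one_lt_two (α := ℝ))).eventually_lt_const
    zero_lt_one
  filter_upwards [h, h2] with lam h1 h2
  rw [div_lt_one (by positivity)] at h2
  have h3 : lam ^ 2 < 2 ^ lam := by exact_mod_cast h2
  calc 2 * ℓ lam ^ 2 ≤ 2 * lam ^ 2 := Nat.mul_le_mul_left _ (Nat.pow_le_pow_left h1 2)
    _ ≤ 2 * 2 ^ lam := Nat.mul_le_mul_left _ h3.le
    _ = 2 ^ (lam + 1) := by rw [pow_succ, mul_comm]
    _ ≤ 2 ^ n lam := Nat.pow_le_pow_right two_pos (hn lam)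

theorem eventually_copies_le_self (hc0 : 0 ≤ c) {ℓ : ℕ → ℕ}
    (h : ∀ᶠ lam : ℕ in atTop, (ℓ lam : ℝ) ≤ (lam : ℝ) ^ (1 - c) / 8) :
    ∀ᶠ lam in atTop, ℓ lam ≤ lam := by
  filter_upwards [h, eventually_gt_atTop 0] with lam h hlam
  have h1 : (lam : ℝ) ^ (1 - c) ≤ (lam : ℝ) ^ (1 : ℝ) :=
    Real.rpow_le_rpow_of_exponent_le (by exact_mod_cast hlam) (by linarith)
  rw [Real.rpow_one] at h1
  have h2 : (ℓ lam : ℝ) ≤ lam := by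
    have : (0 : ℝ) ≤ lam := by positivity
    linarith
  exact_mod_cast h2

theorem negligible_statistical (hc0 : 0 ≤ c) (hc1 : c < 1) {n ℓ : ℕ → ℕ}
    (hm : ∀ lam : ℕ, |(m lam : ℝ) - (lam : ℝ) ^ c| < 1) (hn : ∀ lam, lam < n lam)
    (hℓ : ∀ᶠ lam : ℕ in atTop, (ℓ lam : ℝ) ≤ (lam : ℝ) ^ (1 - c) / 8) :
    Negligible fun lam => 4 * (3 * (ℓ lam : ℝ) ^ 2 / 2 ^ n lam +
      2 * (m lam * 2 ^ ℓ lam / 2 ^ (lam / m lam))) := by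
  have hb : 0 < 3 / 8 * Real.log 2 := mul_pos (by norm_num) (Real.log_pos one_lt_two)
  have hneg : Negligible fun lam : ℕ =>
      44 * ((lam : ℝ) ^ 2 * Real.exp (-(3 / 8 * Real.log 2) * (lam : ℝ) ^ (1 - c))) :=
    ((negligible_rpow_exp (sub_pos.2 hc1) hb).param_pow_mul 2).const_mul 44
  refine hneg.of_le ?_
  filter_upwards [hℓ, eventually_copies_le_self hc0 hℓ, eventually_gt_atTop 0] with lam h1 h2 hlam
  set X : ℝ := (lam : ℝ) ^ (1 - c) with hX
  have hX0 : 0 ≤ X := by positivity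
  have hl1 : (1 : ℝ) ≤ lam := by exact_mod_cast hlam
  have hXl : X ≤ lam := by
    have : (lam : ℝ) ^ (1 - c) ≤ (lam : ℝ) ^ (1 : ℝ) :=
      Real.rpow_le_rpow_of_exponent_le hl1 (by linarith)
    rwa [Real.rpow_one] at this
  have hexp : Real.exp (-(3 / 8 * Real.log 2) * X) = (2 : ℝ) ^ (-(3 / 8) * X) := by
    rw [Real.rpow_def_of_pos two_pos]
    congr 1
    ring
  rw [hexp, abs_of_nonneg (by positivity)]
  set Y : ℝ := (2 : ℝ) ^ (-(3 / 8) * X) with hY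
  have e1 : (ℓ lam : ℝ) ^ 2 / 2 ^ n lam ≤ lam ^ 2 * Y := by
    rw [div_eq_mul_inv]
    refine mul_le_mul ?_ ?_ (by positivity) (by positivity)
    · have : (ℓ lam : ℝ) ≤ lam := by exact_mod_cast h2
      exact pow_le_pow_left₀ (by positivity) this 2
    · rw [← Real.rpow_natCast, ← Real.rpow_neg zero_le_two]
      refine Real.rpow_le_rpow_of_exponent_le one_le_two ?_
      have : (lam : ℝ) ≤ n lam := by exact_mod_cast (hn lam).le
      linarith
  have e2 : (m lam : ℝ) * 2 ^ ℓ lam / 2 ^ (lam / m lam) ≤ 2 * lam * (2 * Y) := by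
    rw [mul_div_assoc]
    refine mul_le_mul ?_ ?_ (by positivity) (by positivity)
    · have : (m lam : ℝ) ≤ lam + 1 := by exact_mod_cast length_le hc0 hc1 hm lam
      linarith
    · rw [← Real.rpow_natCast, ← Real.rpow_natCast, ← Real.rpow_sub two_pos]
      calc _ ≤ (2 : ℝ) ^ (1 + -(3 / 8) * X) := by
            refine Real.rpow_le_rpow_of_exponent_le one_le_two ?_
            have := rpow_le_div_length hc0 hm lam hlam
            linarith
        _ = 2 * Y := by rw [Real.rpow_add two_pos, Real.rpow_one]
  have hY0 : 0 ≤ Y := by positivity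
  have e3 : (lam : ℝ) * Y ≤ lam ^ 2 * Y := mul_le_mul_of_nonneg_right (by nlinarith) hY0
  rw [mul_div_assoc]
  linarith

end Lengths

theorem exists_copies_le_add {ℓ : ℕ → ℕ} (h : ∀ᶠ lam in atTop, ℓ lam ≤ lam) :
    ∃ C, ∀ lam, ℓ lam ≤ lam + C := by
  obtain ⟨N, hN⟩ := eventually_atTop.1 h
  refine ⟨∑ i ∈ Finset.range N, ℓ i, fun lam => ?_⟩
  rcases lt_or_ge lam N with h | h
  · exact (Finset.single_le_sum (f := ℓ) (fun _ _ => Nat.zero_le _)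
      (Finset.mem_range.2 h)).trans (Nat.le_add_left _ _)
  · exact (hN lam h).trans (Nat.le_add_right _ _)

/-! ### Security -/

theorem sum_key {lam : ℕ} (F : (Fin lam → Bool) → (Fin lam → Bool) → ℝ) :
    ∑ k : Fin (2 * lam) → Bool, F (keyFst k) (keySnd k) = ∑ k₂, ∑ k₁, F k₁ k₂ := by
  have hinj : Function.Injective fun k : Fin (2 * lam) → Bool => (keySnd k, keyFst k) := by
    intro k k' h
    obtain ⟨h1, h2⟩ := Prod.ext_iff.1 h
    funext i
    rcases lt_or_ge (i : ℕ) lam with hi | hi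
    · exact congrFun h2 ⟨i, hi⟩
    · have h3 : k ⟨lam + (i - lam), by omega⟩ = k' ⟨lam + (i - lam), by omega⟩ :=
        congrFun h1 ⟨i - lam, by omega⟩
      have h4 : (⟨lam + (i - lam), by omega⟩ : Fin (2 * lam)) = i := Fin.ext (by simp; omega)
      rwa [h4] at h3
  have hbij : Function.Bijective fun k : Fin (2 * lam) → Bool => (keySnd k, keyFst k) := by
    refine (Fintype.bijective_iff_injective_and_card _).2 ⟨hinj, ?_⟩
    simp [two_mul, pow_add]
  rw [← Fintype.sum_prod_type' fun k₂ k₁ => F k₁ k₂]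
  exact Fintype.sum_bijective _ hbij _ _ fun k => rfl

section Security

variable {m n ℓ : ℕ → ℕ} (G : StateGen (fun lam => lam) (fun _ => 0) n) (hn : ∀ lam, lam < n lam)

/-- The advantage of `B` against the PRS generator. -/
def prsAdv (lam : ℕ) (B : Distinguisher (Fin (ℓ lam) × Fin (n lam))) : ℝ :=
  |(∑ k : Fin lam → Bool, B.accept (tensor fun _ => G.output lam k Fin.elim0)) / 2 ^ lam
    - ∫ φ, B.accept (tensor fun _ => φ.density) ∂(haarState (n lam))|

theorem prfs_advantage_le (hm : ∀ lam, 0 < lam → 0 < m lam) (hG : G.IsPure) (lam : ℕ)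
    (hlam : 0 < lam) (hd : 2 * ℓ lam ^ 2 ≤ 2 ^ n lam) (x : Fin (ℓ lam) → Fin (m lam) → Bool)
    (A : Distinguisher ((Fin (ℓ lam) × Fin (m lam)) ⊕ (Fin (ℓ lam) × Fin (n lam)))) {a : ℝ}
    (ha : ∀ k, prsAdv G lam (reduction (hn lam).le k x A) ≤ a) :
    |(∑ k : Fin (2 * lam) → Bool, A.accept (withStrings x
          (tensor fun i => (prfsGen G m hn).output lam k (x i)))) / 2 ^ (2 * lam)
        - ∫ φ : (Fin (m lam) → Bool) → PureState (n lam), A.accept (withStrings x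
            (tensor fun i => (φ (x i)).density)) ∂(Measure.pi fun _ => haarState (n lam))| ≤
      a + 4 * (3 * (ℓ lam : ℝ) ^ 2 / 2 ^ n lam +
        2 * (m lam * 2 ^ ℓ lam / 2 ^ (lam / m lam))) := by
  have hstat := phased_haar_close (hm lam hlam) (hn lam) hd x A
  simp only [← reduction_accept (hn lam).le] at hstat
  have hreal : ∀ k : Fin (2 * lam) → Bool, A.accept (withStrings x
      (tensor fun i => (prfsGen G m hn).output lam k (x i))) =
      (reduction (hn lam).le (keySnd k) x A).accept
        (tensor fun _ => G.output lam (keyFst k) Fin.elim0) := by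
    intro k
    obtain ⟨φ, hφ⟩ := hG lam (keyFst k) Fin.elim0
    simp only [prfsGen_output_density G m hn hm hφ]
    rw [hφ, reduction_accept]
  rw [Finset.sum_congr rfl fun k _ => hreal k, sum_key fun k₁ k₂ =>
    (reduction (hn lam).le k₂ x A).accept (tensor fun _ => G.output lam k₁ Fin.elim0)]
  set P : (Fin lam → Bool) → ℝ := fun k₂ => ∑ k₁ : Fin lam → Bool,
    (reduction (hn lam).le k₂ x A).accept (tensor fun _ => G.output lam k₁ Fin.elim0) with hP
  set H : (Fin lam → Bool) → ℝ := fun k₂ =>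
    ∫ φ, (reduction (hn lam).le k₂ x A).accept (tensor fun _ => φ.density)
      ∂(haarState (n lam)) with hH
  have hcomp : |(∑ k₂, P k₂) / 2 ^ (2 * lam) - (∑ k₂, H k₂) / 2 ^ lam| ≤ a := by
    have e : (∑ k₂, P k₂) / 2 ^ (2 * lam) - (∑ k₂, H k₂) / 2 ^ lam =
        (∑ k₂, (P k₂ / 2 ^ lam - H k₂)) / 2 ^ lam := by
      rw [Finset.sum_sub_distrib, ← Finset.sum_div, sub_div, div_div, ← pow_add, ← two_mul]
    rw [e, abs_div, abs_of_pos (by positivity : (0 : ℝ) < 2 ^ lam), div_le_iff₀ (by positivity)]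
    calc _ ≤ ∑ k₂, |P k₂ / 2 ^ lam - H k₂| := Finset.abs_sum_le_sum_abs _ _
      _ ≤ ∑ _k₂ : Fin lam → Bool, a := Finset.sum_le_sum fun k₂ _ => ha k₂
      _ = a * 2 ^ lam := by simp [mul_comm]
  exact (abs_sub_le _ _ _).trans (add_le_add hcomp hstat)

theorem prfsGen_isSelectivePRFS (hm : ∀ lam, 0 < lam → 0 < m lam)
    (hm' : ∀ lam, m lam ≤ lam + 1) (hℓ : ∀ᶠ lam in atTop, ℓ lam ≤ lam)
    (hstat : Negligible fun lam => 4 * (3 * (ℓ lam : ℝ) ^ 2 / 2 ^ n lam +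
      2 * (m lam * 2 ^ ℓ lam / 2 ^ (lam / m lam)))) (hG : IsPRS n ℓ G) :
    IsSelectivePRFS (fun lam => 2 * lam) m n ℓ (prfsGen G m hn) := by
  obtain ⟨hqpt, hpure, hsec⟩ := hG
  refine ⟨prfsGen_isQPT G m hn hqpt hm hm', prfsGen_isPure G m hn hm hpure, fun A x hA => ?_⟩
  have hmax : ∀ lam, ∃ k₀ : Fin lam → Bool, ∀ k,
      prsAdv G lam (reduction (hn lam).le k (x lam) (A lam)) ≤
        prsAdv G lam (reduction (hn lam).le k₀ (x lam) (A lam)) := fun lam =>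
    Finite.exists_max _
  choose k₀ hk₀ using hmax
  have hpoly : PolySize fun lam => reduction (hn lam).le (k₀ lam) (x lam) (A lam) := by
    obtain ⟨p, hp⟩ := hA
    obtain ⟨C, hC⟩ := exists_copies_le_add hℓ
    refine ⟨p + 7 * ((.X + .C C) * (.X + 1)) + 4 * ((.X + .C C) * .X), fun lam => ?_⟩
    refine (reduction_size _ _ _ _).trans ?_
    simp only [Polynomial.eval_add, Polynomial.eval_mul, Polynomial.eval_ofNat, Polynomial.eval_X,
      Polynomial.eval_C, Polynomial.eval_one]
    exact Nat.add_le_add (Nat.add_le_add (hp lam) (Nat.mul_le_mul_left _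
      (Nat.mul_le_mul (hC lam) (hm' lam))))
      (Nat.mul_le_mul_left _ (Nat.mul_le_mul_right _ (hC lam)))
  have hadv := hsec _ hpoly
  refine Negligible.of_le (hadv.add hstat) ?_
  filter_upwards [eventually_two_mul_sq_le hn hℓ, eventually_gt_atTop 0] with lam hd hlam
  rw [abs_abs]
  exact prfs_advantage_le G hn hm hpure lam hlam hd (x lam) (A lam) (hk₀ lam)

end Security

end PRFS

end

theorem mainTheorem10 (c ε : ℝ) (hc0 : 0 ≤ c) (hc1 : c < 1) (hε : 0 < ε)
    (m n ℓ : ℕ → ℕ)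
    (hm : ∀ lam : ℕ, |(m lam : ℝ) - (lam : ℝ) ^ c| < 1)
    (hn : ∀ lam : ℕ, lam < n lam)
    (hℓ : (fun lam : ℕ => (ℓ lam : ℝ)) =O[Filter.atTop]
      fun lam : ℕ => (lam : ℝ) ^ (1 - c) / Real.log lam ^ (1 + ε))
    (hPRS : ∃ G : PRFS.StateGen (fun lam => lam) (fun _ => 0) n, PRFS.IsPRS n ℓ G) :
    ∃ G : PRFS.StateGen (fun lam => 2 * lam) m n,
      PRFS.IsSelectivePRFS (fun lam => 2 * lam) m n ℓ G := by
  obtain ⟨G, hG⟩ := hPRS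
  have h := PRFS.copies_le (c := c) hε hℓ
  exact ⟨_, PRFS.prfsGen_isSelectivePRFS G hn (PRFS.length_pos hc0 hm)
    (PRFS.length_le hc0 hc1 hm) (PRFS.eventually_copies_le_self hc0 h)
    (PRFS.negligible_statistical hc0 hc1 hm hn h) hG⟩
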